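/- Let $\delta,T,K>0$, and write $\|\cdot\|$ for the norm of $L^2=L^2(0,1)$. Let $W(y)=\frac14(y^2-1)^2$, and let $V\in C^\infty(\mathbb R)$ be a modified double-well potential: $V=W$ on $[-s,s]$ for some $s>0$, and every derivative $V^{(k)}$, $k\ge1$, is bounded on $\mathbb R$. Let $\varphi_-\in H_0^1(0,1)$, $\varphi_-\le 0$ a.e., be a minimizer over $H^1_0(0,1)$ of the energy $\int_0^1\big(\frac\delta2\varphi_x^2+\delta^{-1}W(\varphi)\big)\,dx$. Let $A=-\delta\,d^2/dx^2$ with domain $H^2(0,1)\cap H_0^1(0,1)$; it has the eigenvalues $k_n=\delta\pi^2n^2$ and orthonormal eigenfunctions $\psi_n(x)=\sqrt2\sin(n\pi x)$, $n\ge1$. Let $S(t)=e^{-tA}=\sum_n e^{-k_nt}(\psi_n,\cdot)\psi_n$ be the semigroup generated by $-A$, and let $A^\gamma f=\sum_n k_n^\gamma(\psi_n,f)\psi_n$ for $f\in D(A^\gamma)=\{f\in L^2:\sum_n k_n^{2\gamma}(\psi_n,f)^2<\infty\}$. For $\varphi_0\in H_0^1(0,1)$ and $0\le t_0\le T$, consider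 the minimization of $$v_{\varphi_0,t_0}(\alpha)=\int_{t_0}^T\tfrac12\|\alpha(t)\|^2\,dt+K\|\varphi(T)-\varphi_-\|^2$$ over all controls $\alpha\in L^2(t_0,T;L^2)$, where $\varphi\in C([t_0,T];L^2)$ is the mild solution of $\varphi_t=\delta\varphi_{xx}-\delta^{-1}V'(\varphi)+\alpha$, $\varphi(t_0)=\varphi_0$, that is, $$\varphi(t)=S(t-t_0)\varphi_0+\int_{t_0}^tS(t-s)\big(-\delta^{-1}V'(\varphi(s))+\alpha(s)\big)\,ds,\qquad t_0\le t\le T.$$ An optimal state is the state $\varphi$ of a control attaining the infimum $u(\varphi_0,t_0)$ of $v_{\varphi_0,t_0}$. Its dual $\lambda\in C([t_0,T];L^2)$ is the mild solution of $-\lambda_t=\delta\lambda_{xx}-\delta^{-1}V''(\varphi)\lambda$, $\lambda(T)=2K(\varphi(T)-\varphi_-)$, that is, $$\lambda(t)=S(T-t)\lambda(T)-\delta^{-1}\int_t^TS(s-t)\big(V''(\varphi(s))\lambda(s)\big)\,ds,\qquad t_0\le t\le T.$$ **Theorem.** For every $C>0$ there is a $D>0$ (depending only on $C$ and on the data $\delta,T,K,V,\varphi_-$)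 such that for all $(\varphi_0,t_0)$ with $\varphi_0\in H_0^1(0,1)$, $\|\varphi_0\|_{H_0^1(0,1)}\le C$ and $0\le t_0\le T$, there exists an optimal state $\varphi$, with corresponding dual $\lambda$, such that $\varphi(t),\lambda(t)\in H_0^1(0,1)$ for all $t_0\le t\le T$, $\varphi(t)\in H^2(0,1)$ for all $t_0<t\le T$, $\lambda(t)\in H^2(0,1)$ for all $t_0\le t\le T$ if $t_0<T$, and $$\|\varphi(t)\|_{H_0^1(0,1)}\le D,\qquad \|\lambda(t)\|_{H_0^1(0,1)}\le D\qquad (t_0\le t\le T),$$ $$\|\varphi(t)\|_{H^2(0,1)}\le D(t-t_0)^{-1/2}\quad(t_0<t\le T),$$ $$\|\lambda(t)\|_{H^2(0,1)}\le D(T-t_0)^{-1/2}\quad(t_0\le t\le T,\ t_0<T).$$ If in addition $\varphi_0\in D(A^{5/7})$ and $\|A^{5/7}\varphi_0\|\le C$, then also $$\|\varphi(t)\|_{H^2(0,1)}\le D(t-t_0)^{-2/7}\quad(t_0<t\le T),$$ $$\|\lambda(t)\|_{H^2(0,1)}\le D(T-t_0)^{-2/7}\quad(t_0\le t\le T,\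 t_0<T).$$ -/

import Mathlib

open MeasureTheory Set
open scoped ContDiff

namespace GinzburgLandau

noncomputable section

/-- Lebesgue measure on the spatial interval `(0,1)`. -/
abbrev spaceMeasure : Measure ℝ := volume.restrict (Ioo (0 : ℝ) 1)

/-- The Hilbert space `L²(0,1)`. -/
abbrev L2 : Type := Lp ℝ 2 spaceMeasure

open Classical in
/-- The class in `L²(0,1)` of a square integrable function (and `0` for other functions). -/
def toL2 (f : ℝ → ℝ) : L2 :=
  if h : MemLp f 2 spaceMeasure then h.toLp f else 0

/-! ### Sobolev spaces on `(0,1)` -/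

/-- `η ∈ C_c^∞(0,1)`. -/
def IsTest (η : ℝ → ℝ) : Prop :=
  ContDiff ℝ ∞ η ∧ HasCompactSupport η ∧ tsupport η ⊆ Ioo (0 : ℝ) 1

/-- `g ∈ L²(0,1)` is the weak derivative of `f ∈ L²(0,1)`. -/
def IsWeakDeriv (f g : L2) : Prop :=
  ∀ η : ℝ → ℝ, IsTest η →
    ∫ x, f x * deriv η x ∂spaceMeasure = -∫ x, g x * η x ∂spaceMeasure

open Classical in
/-- The weak derivative `f_x` in `L²(0,1)` (and `0` if there is none). -/
def weakDeriv (f : L2) : L2 :=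
  if h : ∃ g, IsWeakDeriv f g then h.choose else 0

/-- Weak derivatives are unique. -/
theorem IsWeakDeriv.unique {f g₁ g₂ : L2} (h₁ : IsWeakDeriv f g₁) (h₂ : IsWeakDeriv f g₂) :
    g₁ = g₂ := by
  have hint : ∀ g : L2, Integrable (fun x => g x) spaceMeasure := fun g =>
    (Lp.memLp g).integrable (by norm_num)
  have key := isOpen_Ioo.ae_eq_zero_of_integral_contDiff_smul_eq_zero
    (U := Ioo (0 : ℝ) 1) (μ := volume) (f := fun x => g₁ x - g₂ x)
    (IntegrableOn.locallyIntegrableOn ((hint g₁).sub (hint g₂)))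
    (by
      intro η hη hc hs
      have e := (h₁ η ⟨hη, hc, hs⟩).symm.trans (h₂ η ⟨hη, hc, hs⟩)
      have hb : ∀ g : L2, Integrable (fun x => g x * η x) spaceMeasure := by
        intro g
        obtain ⟨C, hC⟩ := hc.exists_bound_of_continuous hη.continuous
        exact (hint g).mul_bdd hη.continuous.aestronglyMeasurable (Filter.Eventually.of_forall hC)
      have e2 : ∫ x, η x • (g₁ x - g₂ x) ∂spaceMeasure = 0 := by
        have : (fun x => η x • (g₁ x - g₂ x)) = fun x => g₁ x * η x - g₂ x * η x := by
          funext x; simp only [smul_eq_mul]; ring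
        rw [this, integral_sub (hb g₁) (hb g₂)]
        linarith
      rw [← e2]
      symm
      apply setIntegral_eq_integral_of_forall_compl_eq_zero
      intro x hx
      have : η x = 0 := by
        by_contra hne
        exact hx (hs (subset_tsupport _ hne))
      simp [this])
  apply Lp.ext
  have := (ae_restrict_iff' (μ := volume) measurableSet_Ioo).2 key
  filter_upwards [this] with x hx
  linarith

theorem IsWeakDeriv.weakDeriv_eq {f g : L2} (h : IsWeakDeriv f g) : weakDeriv f = g := by
  have hex : ∃ g, IsWeakDeriv f g := ⟨g, h⟩
  rw [weakDeriv, dif_pos hex]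
  exact hex.choose_spec.unique h

/-- `f ∈ H¹(0,1)`. -/
def MemH1 (f : L2) : Prop := ∃ g, IsWeakDeriv f g

/-- `f ∈ H²(0,1)`. -/
def MemH2 (f : L2) : Prop := MemH1 f ∧ MemH1 (weakDeriv f)

/-- `f ∈ H₀¹(0,1)`, the closure of `C_c^∞(0,1)` in `H¹(0,1)`. -/
def MemH10 (f : L2) : Prop :=
  MemH1 f ∧ ∀ ε > 0, ∃ η : ℝ → ℝ, IsTest η ∧
    ‖f - toL2 η‖ < ε ∧ ‖weakDeriv f - toL2 (deriv η)‖ < ε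

/-- The norm of `H¹(0,1)` and of its subspace `H₀¹(0,1)`. -/
def h1Norm (f : L2) : ℝ := Real.sqrt (‖f‖ ^ 2 + ‖weakDeriv f‖ ^ 2)

/-- The norm of `H²(0,1)`. -/
def h2Norm (f : L2) : ℝ :=
  Real.sqrt (‖f‖ ^ 2 + ‖weakDeriv f‖ ^ 2 + ‖weakDeriv (weakDeriv f)‖ ^ 2)

/-! ### The operator `A = -δ d²/dx²` with Dirichlet boundary conditions

Its eigenvalues are `δ π² n²`, `n ≥ 1`, with eigenfunctions `√2 sin (n π x)`; both are indexed here
by `n - 1`. -/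

/-- The `(n+1)`-st eigenvalue `δ π² (n+1)²` of `A`. -/
def eigenvalue (δ : ℝ) (n : ℕ) : ℝ := δ * Real.pi ^ 2 * ((n : ℝ) + 1) ^ 2

/-- The normalized eigenfunction `√2 sin ((n+1) π x)`. -/
def eigenfun (n : ℕ) : L2 :=
  toL2 fun x => Real.sqrt 2 * Real.sin (((n : ℝ) + 1) * Real.pi * x)

theorem toL2_coe_ae {f : ℝ → ℝ} (h : MemLp f 2 spaceMeasure) :
    toL2 f =ᵐ[spaceMeasure] f := by
  rw [toL2, dif_pos h]
  exact h.coeFn_toLp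

theorem eigenfun_coe_ae (n : ℕ) :
    eigenfun n =ᵐ[spaceMeasure]
      fun x => Real.sqrt 2 * Real.sin (((n : ℝ) + 1) * Real.pi * x) := by
  refine toL2_coe_ae (MemLp.of_bound (C := Real.sqrt 2) ?_ ?_)
  · exact (by fun_prop : Continuous fun x : ℝ =>
      Real.sqrt 2 * Real.sin (((n : ℝ) + 1) * Real.pi * x)).aestronglyMeasurable
  · refine Filter.Eventually.of_forall fun x => ?_
    rw [norm_mul, Real.norm_of_nonneg (Real.sqrt_nonneg 2)]
    exact mul_le_of_le_one_right (Real.sqrt_nonneg 2) (Real.abs_sin_le_one _)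

/-- The eigenfunctions are orthonormal. -/
theorem orthonormal_eigenfun : Orthonormal ℝ eigenfun := by
  have hcos : ∀ k : ℤ, ∫ x in (0 : ℝ)..1, Real.cos ((k : ℝ) * Real.pi * x) =
      if k = 0 then 1 else 0 := by
    intro k
    split_ifs with hk
    · simp [hk]
    · have hne : (k : ℝ) * Real.pi ≠ 0 := mul_ne_zero (by exact_mod_cast hk) Real.pi_ne_zero
      rw [intervalIntegral.integral_comp_mul_left (fun y => Real.cos y) hne]
      simp [Real.sin_int_mul_pi]
  rw [orthonormal_iff_ite]
  intro i j
  rw [MeasureTheory.L2.inner_def]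
  have h1 : ∫ x, inner ℝ (eigenfun i x) (eigenfun j x) ∂spaceMeasure =
      ∫ x, (Real.cos ((((i : ℤ) - j : ℤ) : ℝ) * Real.pi * x) -
        Real.cos ((((i : ℤ) + j + 2 : ℤ) : ℝ) * Real.pi * x)) ∂spaceMeasure := by
    apply integral_congr_ae
    filter_upwards [eigenfun_coe_ae i, eigenfun_coe_ae j] with x hi hj
    rw [hi, hj]
    have e1 : (((i : ℤ) - j : ℤ) : ℝ) * Real.pi * x =
        ((i : ℝ) + 1) * Real.pi * x - ((j : ℝ) + 1) * Real.pi * x := by push_cast; ring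
    have e2 : (((i : ℤ) + j + 2 : ℤ) : ℝ) * Real.pi * x =
        ((i : ℝ) + 1) * Real.pi * x + ((j : ℝ) + 1) * Real.pi * x := by push_cast; ring
    rw [e1, e2, Real.cos_sub, Real.cos_add]
    have h2 : Real.sqrt 2 * Real.sqrt 2 = 2 := Real.mul_self_sqrt (by norm_num)
    simp only [RCLike.inner_apply, conj_trivial]
    linear_combination Real.sin (((i : ℝ) + 1) * Real.pi * x) *
      Real.sin (((j : ℝ) + 1) * Real.pi * x) * h2
  rw [h1, ← integral_Ioc_eq_integral_Ioo, ← intervalIntegral.integral_of_le zero_le_one,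
    intervalIntegral.integral_sub, hcos, hcos]
  · have hne : ((i : ℤ) + j + 2) ≠ 0 := by omega
    rw [if_neg hne]
    by_cases hij : i = j
    · simp [hij]
    · rw [if_neg (by omega), if_neg hij]; ring
  · exact (by fun_prop : Continuous _).intervalIntegrable _ _
  · exact (by fun_prop : Continuous _).intervalIntegrable _ _

theorem summable_smul_eigenfun {c : ℕ → ℝ} (hc : Summable fun n => c n ^ 2) :
    Summable fun n => c n • eigenfun n := by
  have := (orthonormal_eigenfun.orthogonalFamily.summable_iff_norm_sq_summable
    (f := fun n => c n)).2 (by simpa using hc)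
  simpa using this

/-- The semigroup `S(t) = e^{-tA}`, `t ≥ 0`, generated by `δ d²/dx²` on `H²(0,1) ∩ H₀¹(0,1)`. -/
def semigroup (δ t : ℝ) (f : L2) : L2 :=
  ∑' n : ℕ, (Real.exp (-(eigenvalue δ n * t)) * inner ℝ (eigenfun n) f) • eigenfun n

/-- The series defining `S(t)` converges in `L²(0,1)` for all `t ≥ 0`. -/
theorem summable_semigroup {δ t : ℝ} (hδ : 0 ≤ δ) (ht : 0 ≤ t) (f : L2) :
    Summable fun n : ℕ =>
      (Real.exp (-(eigenvalue δ n * t)) * inner ℝ (eigenfun n) f) • eigenfun n := by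
  apply summable_smul_eigenfun
  have hb : Summable fun n => ‖(inner ℝ (eigenfun n) f : ℝ)‖ ^ 2 :=
    orthonormal_eigenfun.inner_products_summable f
  refine Summable.of_nonneg_of_le (fun n => sq_nonneg _) (fun n => ?_) hb
  rw [mul_pow, Real.norm_eq_abs, sq_abs]
  have hk : 0 ≤ eigenvalue δ n * t := by unfold eigenvalue; positivity
  have he : Real.exp (-(eigenvalue δ n * t)) ≤ 1 := Real.exp_le_one_iff.2 (by linarith)
  exact mul_le_of_le_one_left (sq_nonneg _) (pow_le_one₀ (Real.exp_pos _).le he)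

/-- `f ∈ D(A^γ)`. -/
def MemDomPow (δ γ : ℝ) (f : L2) : Prop :=
  Summable fun n : ℕ => eigenvalue δ n ^ (2 * γ) * (inner ℝ (eigenfun n) f) ^ 2

/-- `A^γ f` for `f ∈ D(A^γ)`. -/
def fracPow (δ γ : ℝ) (f : L2) : L2 :=
  ∑' n : ℕ, (eigenvalue δ n ^ γ * inner ℝ (eigenfun n) f) • eigenfun n

/-- The series defining `A^γ f` converges in `L²(0,1)` for all `f ∈ D(A^γ)`. -/
theorem summable_fracPow {δ γ : ℝ} (hδ : 0 ≤ δ) {f : L2} (hf : MemDomPow δ γ f) :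
    Summable fun n : ℕ => (eigenvalue δ n ^ γ * inner ℝ (eigenfun n) f) • eigenfun n := by
  apply summable_smul_eigenfun
  refine hf.congr fun n => ?_
  have hk : 0 ≤ eigenvalue δ n := by unfold eigenvalue; positivity
  rw [mul_pow, mul_comm 2 γ, Real.rpow_mul hk, Real.rpow_two]

/-! ### The potential and the target state -/

/-- The double-well potential. -/
def doubleWell (y : ℝ) : ℝ := (y ^ 2 - 1) ^ 2 / 4

/-- `V` is a modified double-well potential: it is smooth, agrees with the double-well potential on
some interval `[-s,s]`, and all its derivatives of positive order are bounded on `ℝ`. -/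
def IsModifiedDoubleWell (V : ℝ → ℝ) : Prop :=
  ContDiff ℝ ∞ V ∧ (∃ s > 0, ∀ y ∈ Icc (-s) s, V y = doubleWell y) ∧
    ∀ k : ℕ, 1 ≤ k → ∃ M : ℝ, ∀ y, |iteratedDeriv k V y| ≤ M

/-- The Ginzburg-Landau energy of `f ∈ H₀¹(0,1)`. -/
def energy (δ : ℝ) (f : L2) : ℝ :=
  ∫ x, (δ / 2 * weakDeriv f x ^ 2 + δ⁻¹ * doubleWell (f x)) ∂spaceMeasure

/-- `m` is the lower stable state `φ₋`: the nonpositive minimizer of the energy over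
`H₀¹(0,1)`. -/
def IsLowerMinimizer (δ : ℝ) (m : L2) : Prop :=
  MemH10 m ∧ (∀ᵐ x ∂spaceMeasure, m x ≤ 0) ∧ ∀ f, MemH10 f → energy δ m ≤ energy δ f

/-! ### The optimal control problem -/

/-- The right-hand side `-δ⁻¹ V'(φ) + a` of the state equation. -/
def stateSource (δ : ℝ) (V : ℝ → ℝ) (φ a : L2) : L2 :=
  -(δ⁻¹ • toL2 fun x => deriv V (φ x)) + a

/-- `φ ∈ C([t₀,T]; L²)` is the mild solution of `φ_t = δ φ_xx - δ⁻¹ V'(φ) + α`, `φ(t₀) = φ₀`. -/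
def IsMildState (δ T : ℝ) (V : ℝ → ℝ) (φ₀ : L2) (t₀ : ℝ) (α φ : ℝ → L2) : Prop :=
  ContinuousOn φ (Icc t₀ T) ∧
    ∀ t ∈ Icc t₀ T,
      IntervalIntegrable (fun s => semigroup δ (t - s) (stateSource δ V (φ s) (α s)))
        volume t₀ t ∧
      φ t = semigroup δ (t - t₀) φ₀ +
        ∫ s in t₀..t, semigroup δ (t - s) (stateSource δ V (φ s) (α s))

/-- `α ∈ L²(t₀,T; L²(0,1))` is a control, with state `φ` starting at `(φ₀,t₀)`. -/
def IsAdmissible (δ T : ℝ) (V : ℝ → ℝ) (φ₀ : L2) (t₀ : ℝ) (α φ : ℝ → L2) : Prop :=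
  MemLp α 2 (volume.restrict (Icc t₀ T)) ∧ IsMildState δ T V φ₀ t₀ α φ

/-- The cost `∫ h(α(t)) dt + g(φ(T))`, with `h(a) = ‖a‖² / 2` and `g(f) = K ‖f - φ₋‖²`. -/
def cost (T K : ℝ) (m : L2) (t₀ : ℝ) (α φ : ℝ → L2) : ℝ :=
  (∫ t in t₀..T, ‖α t‖ ^ 2 / 2) + K * ‖φ T - m‖ ^ 2

/-- The value function `u(φ₀,t₀)`. -/
def valueFunction (δ T K : ℝ) (V : ℝ → ℝ) (m φ₀ : L2) (t₀ : ℝ) : ℝ :=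
  sInf {c | ∃ α φ : ℝ → L2, IsAdmissible δ T V φ₀ t₀ α φ ∧ c = cost T K m t₀ α φ}

/-- `(α, φ)` is an optimal pair of control and state: the infimum in `u(φ₀,t₀)` is attained. -/
def IsOptimalPair (δ T K : ℝ) (V : ℝ → ℝ) (m φ₀ : L2) (t₀ : ℝ) (α φ : ℝ → L2) : Prop :=
  IsAdmissible δ T V φ₀ t₀ α φ ∧ cost T K m t₀ α φ = valueFunction δ T K V m φ₀ t₀

/-- The product `V''(φ) l`. -/
def dualSource (V : ℝ → ℝ) (φ l : L2) : L2 :=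
  toL2 fun x => iteratedDeriv 2 V (φ x) * l x

/-- `l ∈ C([t₀,T]; L²)` is the mild solution of the dual (backward) equation
`-l_t = δ l_xx - δ⁻¹ V''(φ) l`, `l(T) = 2K (φ(T) - φ₋)`. -/
def IsMildDual (δ T K : ℝ) (V : ℝ → ℝ) (m : L2) (t₀ : ℝ) (φ l : ℝ → L2) : Prop :=
  ContinuousOn l (Icc t₀ T) ∧ l T = (2 * K) • (φ T - m) ∧
    ∀ t ∈ Icc t₀ T,
      IntervalIntegrable (fun s => semigroup δ (s - t) (dualSource V (φ s) (l s))) volume t T ∧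
      l t = semigroup δ (T - t) (l T) -
        δ⁻¹ • ∫ s in t..T, semigroup δ (s - t) (dualSource V (φ s) (l s))

end

end GinzburgLandau

/-! In the sine basis all norms become weighted sums of squared coefficients. With `k` the
eigenvalues of `A`, weight `k` describes `H₀¹` as the form domain `D(A^(1/2))`, and weight `k²`
controls the `H²` norm. `SumLe` states such bounds through partial sums, so a bound contains
membership and survives coefficientwise limits.

The Duhamel integral gains half a power of `A` (`sum_duhamel_le`): a source in `L²` in time lands in
`D(A^(1/2))`, and a source bounded in `D(A^(1/2))` lands in `D(A)`. Bounded sets of the form domain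
are precompact in `L²` (`tendsto_of_sumLe`). Hence weakly convergent controls have strongly
convergent states, and the direct method gives an optimal control (`exists_optimal`).

Duality between the forward and the backward equation (`inner_duhamel_eq`) turns the first variation
of the cost into `α = -λ` a.e. (`optimal_eq_neg_dual`). The map `φ ↦ V'(φ)` need not be
differentiable on `L²`, but its Taylor remainder is quadratically small when paired with a bounded
function, and `λ` is bounded since `H₀¹` embeds into `L^∞`.

The estimates are then a bootstrap (`exists_optimal_regular`). Comparison with the zero control
bounds `∫ ‖α‖²`. This bounds `φ` in `H₀¹`, hence `λ(T)`, hence `λ`, whose source is at most a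
constant times `‖α‖`. As `V'(0) = 0`, both `V'(φ)` and `V''(φ)λ` stay in `H₀¹` with bounds, so with
`α = -λ` both sources are bounded in `H₀¹` and both Duhamel terms are bounded in `D(A)`. What is
left is `S(t - t₀)φ₀` and the terminal value `2K(φ(T) - φ₋)`. Here `φ₋ ∈ D(A)` by the Euler-Lagrange
equation, and the semigroup costs `t^(-1/2)` from `D(A^(1/2))` and `t^(-2/7)` from `D(A^(5/7))`. For
`λ` the relevant time is `T - t₀`, since `φ₀` enters its terminal value through `φ(T)`. -/

namespace GinzburgLandau

open Filter Topology

/-! ### Diagonal positive operators: semigroup, weighted coefficient bounds, compactness. -/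

section Abstract

variable {H : Type*} [NormedAddCommGroup H] [InnerProductSpace ℝ H]

/-- `e` is an orthonormal basis of `H`, consisting of eigenvectors of a positive operator with
compact resolvent and eigenvalues `k`. -/
structure IsSpectral (e : ℕ → H) (k : ℕ → ℝ) : Prop where
  orthonormal : Orthonormal ℝ e
  total : ∀ f : H, (∀ n, inner ℝ (e n) f = 0) → f = 0
  pos : ∀ n, 0 < k n
  tendsto : Tendsto k atTop atTop

/-- The semigroup `exp (-t A)` generated by the operator with eigenvalues `k`. -/
noncomputable def sg (e : ℕ → H) (k : ℕ → ℝ) (t : ℝ) (f : H) : H :=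
  ∑' n, (Real.exp (-(k n * t)) * inner ℝ (e n) f) • e n

/-- All partial sums of `∑ w n (e n, f)²` are at most `B`. -/
def SumLe (e : ℕ → H) (w : ℕ → ℝ) (f : H) (B : ℝ) : Prop :=
  ∀ N, ∑ n ∈ Finset.range N, w n * inner ℝ (e n) f ^ 2 ≤ B

variable {e : ℕ → H} {k w : ℕ → ℝ}

theorem SumLe.mono {f : H} {B B' : ℝ} (h : SumLe e w f B) (hB : B ≤ B') : SumLe e w f B' :=
  fun N => (h N).trans hB

theorem SumLe.nonneg {f : H} {B : ℝ} (h : SumLe e w f B) : 0 ≤ B := by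
  simpa using h 0

theorem SumLe.summable {f : H} {B : ℝ} (hw : ∀ n, 0 ≤ w n) (h : SumLe e w f B) :
    Summable fun n => w n * inner ℝ (e n) f ^ 2 :=
  summable_of_sum_range_le (fun n => mul_nonneg (hw n) (sq_nonneg _)) h

theorem SumLe.tsum_le {f : H} {B : ℝ} (hw : ∀ n, 0 ≤ w n) (h : SumLe e w f B) :
    ∑' n, w n * inner ℝ (e n) f ^ 2 ≤ B :=
  Real.tsum_le_of_sum_range_le (fun n => mul_nonneg (hw n) (sq_nonneg _)) h

theorem SumLe.add {f g : H} {B B' : ℝ} (hw : ∀ n, 0 ≤ w n) (hf : SumLe e w f B)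
    (hg : SumLe e w g B') : SumLe e w (f + g) (2 * B + 2 * B') := by
  intro N
  calc ∑ n ∈ Finset.range N, w n * inner ℝ (e n) (f + g) ^ 2
      ≤ ∑ n ∈ Finset.range N, (2 * (w n * inner ℝ (e n) f ^ 2) +
          2 * (w n * inner ℝ (e n) g ^ 2)) := by
        refine Finset.sum_le_sum fun n _ => ?_
        rw [inner_add_right]
        nlinarith [mul_nonneg (hw n) (sq_nonneg (inner ℝ (e n) f - inner ℝ (e n) g))]
    _ ≤ _ := by
        rw [Finset.sum_add_distrib, ← Finset.mul_sum, ← Finset.mul_sum]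
        linarith [hf N, hg N]

theorem SumLe.smul {f : H} {B : ℝ} (c : ℝ) (hf : SumLe e w f B) :
    SumLe e w (c • f) (c ^ 2 * B) := by
  intro N
  calc ∑ n ∈ Finset.range N, w n * inner ℝ (e n) (c • f) ^ 2
      = c ^ 2 * ∑ n ∈ Finset.range N, w n * inner ℝ (e n) f ^ 2 := by
        rw [Finset.mul_sum]
        refine Finset.sum_congr rfl fun n _ => ?_
        rw [inner_smul_right]; ring
    _ ≤ _ := mul_le_mul_of_nonneg_left (hf N) (sq_nonneg c)

theorem SumLe.neg {f : H} {B : ℝ} (hf : SumLe e w f B) : SumLe e w (-f) B := by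
  simpa using hf.smul (-1)

theorem SumLe.sub {f g : H} {B B' : ℝ} (hw : ∀ n, 0 ≤ w n) (hf : SumLe e w f B)
    (hg : SumLe e w g B') : SumLe e w (f - g) (2 * B + 2 * B') := by
  rw [sub_eq_add_neg]; exact hf.add hw hg.neg

/-- A weighted bound passes to limits of the coefficients. -/
theorem SumLe.of_tendsto {ι : Type*} {l : Filter ι} [l.NeBot] {F : ι → H} {f : H} {B : ℝ}
    {b : ι → ℝ} (h : ∀ i, SumLe e w (F i) (b i)) (hb : Tendsto b l (𝓝 B))
    (hF : ∀ n, Tendsto (fun i => inner ℝ (e n) (F i)) l (𝓝 (inner ℝ (e n) f))) :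
    SumLe e w f B := fun N =>
  le_of_tendsto_of_tendsto' (tendsto_finsetSum _ fun n _ => ((hF n).pow 2).const_mul _) hb
    fun i => h i N

theorem sumLe_one (he : Orthonormal ℝ e) (f : H) : SumLe e (fun _ => 1) f (‖f‖ ^ 2) := by
  intro N
  have := he.sum_inner_products_le f (s := Finset.range N)
  simpa using this

namespace IsSpectral

variable (h : IsSpectral e k)
include h

theorem ext {f g : H} (hfg : ∀ n, inner ℝ (e n) f = inner ℝ (e n) g) : f = g := by
  refine sub_eq_zero.1 (h.total _ fun n => ?_)
  rw [inner_sub_right, hfg, sub_self]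

theorem inner_of_hasSum {c : ℕ → ℝ} {f : H} (hf : HasSum (fun n => c n • e n) f) (n : ℕ) :
    inner ℝ (e n) f = c n := by
  have h1 := hf.mapL (innerSL ℝ (e n))
  have h2 : HasSum (fun m => innerSL ℝ (e n) (c m • e m)) (c n) := by
    convert hasSum_ite_eq n (c n) using 2 with m
    rw [innerSL_apply_apply, inner_smul_right, orthonormal_iff_ite.1 h.orthonormal]
    by_cases hm : m = n
    · simp [hm]
    · simp [hm, Ne.symm hm]
  exact h1.unique h2

theorem exp_le_one {t : ℝ} (ht : 0 ≤ t) (n : ℕ) : Real.exp (-(k n * t)) ≤ 1 := by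
  have := h.pos n
  exact Real.exp_le_one_iff.2 (by simp; positivity)

variable [CompleteSpace H]

theorem exists_hilbertBasis : ∃ b : HilbertBasis ℕ ℝ H, ⇑b = e := by
  refine ⟨HilbertBasis.mkOfOrthogonalEqBot h.orthonormal ?_, HilbertBasis.coe_mkOfOrthogonalEqBot _ _⟩
  rw [Submodule.eq_bot_iff]
  intro f hf
  refine h.total f fun n => ?_
  exact (Submodule.mem_orthogonal _ _).1 hf _ (Submodule.subset_span (mem_range_self n))

theorem hasSum_inner_mul_inner (f g : H) :
    HasSum (fun n => inner ℝ (e n) f * inner ℝ (e n) g) (inner ℝ f g) := by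
  obtain ⟨b, rfl⟩ := h.exists_hilbertBasis
  simpa [real_inner_comm] using b.hasSum_inner_mul_inner f g

theorem hasSum_sq (f : H) : HasSum (fun n => inner ℝ (e n) f ^ 2) (‖f‖ ^ 2) := by
  have := h.hasSum_inner_mul_inner f f
  simpa [sq] using this

theorem hasSum_smul (f : H) : HasSum (fun n => (inner ℝ (e n) f : ℝ) • e n) f := by
  obtain ⟨b, rfl⟩ := h.exists_hilbertBasis
  simpa [HilbertBasis.repr_apply_apply] using b.hasSum_repr f

theorem summable_smul {c : ℕ → ℝ} (hc : Summable fun n => c n ^ 2) :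
    Summable fun n => c n • e n := by
  have := (h.orthonormal.orthogonalFamily.summable_iff_norm_sq_summable
    (f := fun n => c n)).2 (by simpa using hc)
  simpa using this

theorem inner_sg {t : ℝ} (ht : 0 ≤ t) (f : H) (n : ℕ) :
    inner ℝ (e n) (sg e k t f) = Real.exp (-(k n * t)) * inner ℝ (e n) f := by
  refine h.inner_of_hasSum (c := fun n => Real.exp (-(k n * t)) * inner ℝ (e n) f)
    (h.summable_smul ?_).hasSum n
  refine Summable.of_nonneg_of_le (fun n => sq_nonneg _) (fun n => ?_) (h.hasSum_sq f).summable
  rw [mul_pow]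
  have := h.pos n
  exact mul_le_of_le_one_left (sq_nonneg _)
    (pow_le_one₀ (Real.exp_pos _).le (Real.exp_le_one_iff.2 (by simp; positivity)))

theorem sg_zero (f : H) : sg e k 0 f = f :=
  h.ext fun n => by rw [h.inner_sg le_rfl]; simp

theorem norm_sq_le {f g : H} (hfg : ∀ n, inner ℝ (e n) f ^ 2 ≤ inner ℝ (e n) g ^ 2) :
    ‖f‖ ^ 2 ≤ ‖g‖ ^ 2 :=
  hasSum_le hfg (h.hasSum_sq f) (h.hasSum_sq g)

theorem norm_sg_le {t : ℝ} (ht : 0 ≤ t) (f : H) : ‖sg e k t f‖ ≤ ‖f‖ := by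
  refine le_of_sq_le_sq ?_ (norm_nonneg _)
  refine h.norm_sq_le fun n => ?_
  rw [h.inner_sg ht, mul_pow]
  exact mul_le_of_le_one_left (sq_nonneg _) (pow_le_one₀ (Real.exp_pos _).le (h.exp_le_one ht n))

theorem sg_add {t : ℝ} (ht : 0 ≤ t) (f g : H) :
    sg e k t (f + g) = sg e k t f + sg e k t g :=
  h.ext fun n => by simp only [h.inner_sg ht, inner_add_right]; ring

theorem sg_sub {t : ℝ} (ht : 0 ≤ t) (f g : H) :
    sg e k t (f - g) = sg e k t f - sg e k t g :=
  h.ext fun n => by simp only [h.inner_sg ht, inner_sub_right]; ring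

theorem sg_smul {t : ℝ} (ht : 0 ≤ t) (c : ℝ) (f : H) :
    sg e k t (c • f) = c • sg e k t f :=
  h.ext fun n => by simp only [h.inner_sg ht, inner_smul_right]; ring

theorem inner_sg_left {t : ℝ} (ht : 0 ≤ t) (f g : H) :
    inner ℝ (sg e k t f) g = inner ℝ f (sg e k t g) := by
  refine (h.hasSum_inner_mul_inner _ _).unique ?_
  convert h.hasSum_inner_mul_inner f (sg e k t g) using 2 with n
  simp only [h.inner_sg ht]; ring

theorem sg_sumLe {t : ℝ} (ht : 0 ≤ t) (hw : ∀ n, 0 ≤ w n) {f : H} {B : ℝ}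
    (hf : SumLe e w f B) : SumLe e w (sg e k t f) B := fun N => by
  refine (Finset.sum_le_sum fun n _ => ?_).trans (hf N)
  rw [h.inner_sg ht, mul_pow]
  exact mul_le_mul_of_nonneg_left (mul_le_of_le_one_left (sq_nonneg _)
    (pow_le_one₀ (Real.exp_pos _).le (h.exp_le_one ht n))) (hw n)

theorem norm_sq_le_of_sumLe {f : H} {B : ℝ} (hf : SumLe e (fun _ => 1) f B) : ‖f‖ ^ 2 ≤ B := by
  rw [← (h.hasSum_sq f).tsum_eq]
  simpa using hf.tsum_le fun _ => zero_le_one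

/-- Compactness of the embedding of the form domain: convergence of the coefficients and a uniform
bound in the form domain imply convergence in norm. -/
theorem tendsto_of_sumLe {ι : Type*} {l : Filter ι} {F : ι → H} {f : H} {B : ℝ}
    (hB : ∀ᶠ i in l, SumLe e k (F i) B)
    (hF : ∀ n, Tendsto (fun i => inner ℝ (e n) (F i)) l (𝓝 (inner ℝ (e n) f))) :
    Tendsto F l (𝓝 f) := by
  rcases l.eq_or_neBot with rfl | hl
  · exact tendsto_bot
  have hk : ∀ n, 0 ≤ k n := fun n => (h.pos n).le
  have hf : SumLe e k f B := fun N =>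
    le_of_tendsto (tendsto_finsetSum _ fun n _ => ((hF n).pow 2).const_mul _)
      (hB.mono fun i hi => hi N)
  have hd : ∀ᶠ i in l, SumLe e k (F i - f) (4 * B) :=
    hB.mono fun i hi => (hi.sub hk hf).mono (by linarith)
  have hB0 : 0 ≤ B := hf.nonneg
  have key : ∀ ε > 0, ∀ᶠ i in l, ‖F i - f‖ ^ 2 < ε := by
    intro ε hε
    -- Past `N` the eigenvalues exceed `c⁻¹`, so the tail of `‖F i - f‖²` is at most `c` times the
    -- form bound `4 * B` of the difference. The finitely many remaining coefficients tend to zero.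
    obtain ⟨c, hc, hcε⟩ : ∃ c > 0, c * (4 * B) < ε / 2 := by
      refine ⟨ε / (2 * (4 * B + 1)), by positivity, ?_⟩
      rw [div_mul_eq_mul_div, div_lt_div_iff₀ (by positivity) (by positivity)]
      nlinarith
    obtain ⟨N, hN⟩ := (h.tendsto.eventually_ge_atTop c⁻¹).exists_forall_of_atTop
    have h0 : Tendsto (fun i => ∑ n ∈ Finset.range N, inner ℝ (e n) (F i - f) ^ 2) l (𝓝 0) := by
      have : Tendsto (fun i => ∑ n ∈ Finset.range N, inner ℝ (e n) (F i - f) ^ 2) l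
          (𝓝 (∑ n ∈ Finset.range N, 0)) := by
        refine tendsto_finsetSum _ fun n _ => ?_
        have := ((hF n).sub_const (inner ℝ (e n) f)).pow 2
        simpa [inner_sub_right] using this
      simpa using this
    filter_upwards [hd, h0.eventually_lt_const (half_pos hε)] with i hi1 hi2
    have : ‖F i - f‖ ^ 2 ≤ ∑ n ∈ Finset.range N, inner ℝ (e n) (F i - f) ^ 2 + c * (4 * B) := by
      refine h.norm_sq_le_of_sumLe fun M => ?_
      have h1 : ∀ n, (1 : ℝ) * inner ℝ (e n) (F i - f) ^ 2 ≤
          (if n < N then inner ℝ (e n) (F i - f) ^ 2 else 0) +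
            c * (k n * inner ℝ (e n) (F i - f) ^ 2) := by
        intro n
        split_ifs with hn
        · have := mul_nonneg hc.le (mul_nonneg (hk n) (sq_nonneg (inner ℝ (e n) (F i - f))))
          linarith
        · have h2 := hN n (not_lt.1 hn)
          have h3 : 1 ≤ c * k n := by
            rw [inv_le_iff_one_le_mul₀ hc] at h2; linarith
          nlinarith [sq_nonneg (inner ℝ (e n) (F i - f))]
      refine (Finset.sum_le_sum fun n _ => h1 n).trans ?_
      rw [Finset.sum_add_distrib, ← Finset.mul_sum]
      refine add_le_add ?_ (mul_le_mul_of_nonneg_left (hi1 M) hc.le)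
      rw [← Finset.sum_filter]
      refine Finset.sum_le_sum_of_subset_of_nonneg (fun n hn => ?_) fun _ _ _ => sq_nonneg _
      simpa using (Finset.mem_filter.1 hn).2
    linarith
  rw [tendsto_iff_norm_sub_tendsto_zero, Metric.tendsto_nhds]
  intro ε hε
  filter_upwards [key (ε ^ 2) (by positivity)] with i hi
  simpa using lt_of_pow_lt_pow_left₀ 2 hε.le hi

end IsSpectral

end Abstract

end GinzburgLandau

namespace GinzburgLandau

open Filter Topology

/-! ### The Duhamel integral and its gain of half a power of the operator. -/

section Duhamel

variable {H : Type*} [NormedAddCommGroup H] [InnerProductSpace ℝ H]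
  {e : ℕ → H} {k w : ℕ → ℝ}

/-- The Duhamel integral `∫ S(t - s) g(s) ds` over `[t₀,t]`. -/
noncomputable def duhamel (e : ℕ → H) (k : ℕ → ℝ) (g : ℝ → H) (t₀ t : ℝ) : H :=
  ∫ s in t₀..t, sg e k (t - s) (g s)

theorem integral_exp_sq_le {κ t₀ t : ℝ} (hκ : 0 < κ) :
    ∫ s in t₀..t, Real.exp (-(κ * (t - s))) ^ 2 ≤ 1 / (2 * κ) := by
  have hd : ∀ s ∈ uIcc t₀ t, HasDerivAt (fun s => Real.exp (-(2 * κ * (t - s))) / (2 * κ))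
      (Real.exp (-(κ * (t - s))) ^ 2) s := by
    intro s _
    have h1 : HasDerivAt (fun s => -(2 * κ * (t - s))) (2 * κ) s :=
      (((hasDerivAt_id' s).const_sub t).const_mul (2 * κ)).fun_neg.congr_deriv (by ring)
    refine (h1.exp.div_const (2 * κ)).congr_deriv ?_
    rw [mul_div_cancel_right₀ _ (by positivity), ← Real.exp_nat_mul]
    congr 1; push_cast; ring
  rw [intervalIntegral.integral_eq_sub_of_hasDerivAt hd
    ((by fun_prop : Continuous _).intervalIntegrable _ _)]
  have : 0 ≤ Real.exp (-(2 * κ * (t - t₀))) / (2 * κ) := by positivity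
  simp only [sub_self, mul_zero, neg_zero, Real.exp_zero]
  linarith

/-- Cauchy-Schwarz with a kernel whose squared `L²` norm is at most `1 / (2κ)`. The factor `κ` on
the left is the half power of the operator that the Duhamel integral gains. -/
theorem integral_exp_mul_sq_le {κ t₀ t : ℝ} (hκ : 0 < κ) (ht : t₀ ≤ t) {b : ℝ → ℝ}
    (hb : MemLp b 2 (volume.restrict (Ioc t₀ t))) :
    κ * (∫ s in t₀..t, Real.exp (-(κ * (t - s))) * b s) ^ 2 ≤ 1 / 2 * ∫ s in t₀..t, b s ^ 2 := by
  set X := ∫ s in t₀..t, Real.exp (-(κ * (t - s))) * b s with hX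
  have hb1 : IntervalIntegrable b volume t₀ t := by
    rw [intervalIntegrable_iff_integrableOn_Ioc_of_le ht]
    exact hb.integrable (by norm_num)
  have hb2 : IntervalIntegrable (fun s => b s ^ 2) volume t₀ t := by
    rw [intervalIntegrable_iff_integrableOn_Ioc_of_le ht]
    exact hb.integrable_sq
  have hc : Continuous fun s => Real.exp (-(κ * (t - s))) := by fun_prop
  have hab : IntervalIntegrable (fun s => Real.exp (-(κ * (t - s))) * b s) volume t₀ t :=
    hb1.continuousOn_mul hc.continuousOn
  have haa : IntervalIntegrable (fun s => Real.exp (-(κ * (t - s))) ^ 2) volume t₀ t :=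
    (hc.pow 2).intervalIntegrable _ _
  -- The multiple `2κX` is the minimizing one when the squared norm of the kernel is replaced by its
  -- bound `1 / (2κ)`.
  have h0 : 0 ≤ ∫ s in t₀..t, (b s - 2 * κ * X * Real.exp (-(κ * (t - s)))) ^ 2 :=
    intervalIntegral.integral_nonneg ht fun s _ => sq_nonneg _
  have h1 : ∫ s in t₀..t, (b s - 2 * κ * X * Real.exp (-(κ * (t - s)))) ^ 2 =
      (∫ s in t₀..t, b s ^ 2) - 4 * κ * X * X +
        4 * κ ^ 2 * X ^ 2 * ∫ s in t₀..t, Real.exp (-(κ * (t - s))) ^ 2 := by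
    have h4 : (fun s => (b s - 2 * κ * X * Real.exp (-(κ * (t - s)))) ^ 2) = fun s => b s ^ 2 -
        4 * κ * X * (Real.exp (-(κ * (t - s))) * b s) +
          4 * κ ^ 2 * X ^ 2 * Real.exp (-(κ * (t - s))) ^ 2 := by ext s; ring
    rw [h4, intervalIntegral.integral_add (hb2.sub (hab.const_mul _)) (haa.const_mul _),
      intervalIntegral.integral_sub hb2 (hab.const_mul _), intervalIntegral.integral_const_mul,
      intervalIntegral.integral_const_mul]
  have h2 := mul_le_mul_of_nonneg_left (integral_exp_sq_le (t₀ := t₀) (t := t) hκ)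
    (by positivity : 0 ≤ 4 * κ ^ 2 * X ^ 2)
  have h3 : 4 * κ ^ 2 * X ^ 2 * (1 / (2 * κ)) = 2 * κ * X ^ 2 := by field_simp; ring
  rw [h3] at h2
  nlinarith

variable [CompleteSpace H]

namespace IsSpectral

variable (h : IsSpectral e k)
include h

theorem hasSum_sg {t : ℝ} (ht : 0 ≤ t) (f : H) :
    HasSum (fun n => (Real.exp (-(k n * t)) * inner ℝ (e n) f) • e n) (sg e k t f) := by
  have := h.hasSum_smul (sg e k t f)
  simpa only [h.inner_sg ht] using this

/-- The time may depend measurably on the point: the map is an a.e. limit of partial sums, each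
visibly measurable. The general base space covers the product measure in the Fubini argument of
`inner_duhamel_eq`. -/
theorem aestronglyMeasurable_sg {X : Type*} [MeasurableSpace X] {μ : Measure X} {τ : X → ℝ}
    (hτ : Measurable τ) (hτ0 : ∀ᵐ x ∂μ, 0 ≤ τ x) {g : X → H} (hg : AEStronglyMeasurable g μ) :
    AEStronglyMeasurable (fun x => sg e k (τ x) (g x)) μ := by
  refine aestronglyMeasurable_of_tendsto_ae atTop (f := fun N x => ∑ n ∈ Finset.range N,
    (Real.exp (-(k n * τ x)) * inner ℝ (e n) (g x)) • e n) (fun N => ?_) ?_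
  · refine Finset.aestronglyMeasurable_fun_sum _ fun n _ => ?_
    refine AEStronglyMeasurable.smul_const (AEStronglyMeasurable.mul ?_ ?_) _
    · exact (by fun_prop : Measurable fun x => Real.exp (-(k n * τ x))).aestronglyMeasurable
    · exact aestronglyMeasurable_const.inner hg
  · filter_upwards [hτ0] with x hx
    exact (h.hasSum_sg hx (g x)).tendsto_sum_nat

theorem intervalIntegrable_sg {t₀ t : ℝ} (ht : t₀ ≤ t) {g : ℝ → H}
    (hg : IntegrableOn g (Ioc t₀ t)) :
    IntervalIntegrable (fun s => sg e k (t - s) (g s)) volume t₀ t := by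
  rw [intervalIntegrable_iff_integrableOn_Ioc_of_le ht]
  have h0 : ∀ᵐ s ∂volume.restrict (Ioc t₀ t), 0 ≤ t - s :=
    (ae_restrict_iff' measurableSet_Ioc).2 (Eventually.of_forall fun s hs => sub_nonneg.2 hs.2)
  refine Integrable.mono hg (h.aestronglyMeasurable_sg (by fun_prop) h0 hg.1) ?_
  filter_upwards [h0] with s hs
  exact h.norm_sg_le hs _

theorem inner_duhamel {t₀ t : ℝ} (ht : t₀ ≤ t) {g : ℝ → H} (hg : IntegrableOn g (Ioc t₀ t))
    (n : ℕ) : inner ℝ (e n) (duhamel e k g t₀ t) =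
      ∫ s in t₀..t, Real.exp (-(k n * (t - s))) * inner ℝ (e n) (g s) := by
  have := (innerSL ℝ (e n)).intervalIntegral_comp_comm (h.intervalIntegrable_sg ht hg)
  simp only [innerSL_apply_apply] at this
  rw [duhamel, ← this]
  refine intervalIntegral.integral_congr fun s hs => ?_
  rw [uIcc_of_le ht] at hs
  exact h.inner_sg (sub_nonneg.2 hs.2) _ _

omit [CompleteSpace H] h in
theorem memLp_inner {t₀ t : ℝ} {g : ℝ → H} (hg : MemLp g 2 (volume.restrict (Ioc t₀ t))) (v : H) :
    MemLp (fun s => inner ℝ v (g s)) 2 (volume.restrict (Ioc t₀ t)) :=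
  (innerSL ℝ v).comp_memLp' hg

/-- Maximal regularity for the Duhamel integral. -/
theorem sum_duhamel_le {t₀ t : ℝ} (ht : t₀ ≤ t) (hw : ∀ n, 0 ≤ w n) {g : ℝ → H}
    (hg : MemLp g 2 (volume.restrict (Ioc t₀ t))) (N : ℕ) :
    ∑ n ∈ Finset.range N, w n * k n * inner ℝ (e n) (duhamel e k g t₀ t) ^ 2 ≤
      1 / 2 * ∫ s in t₀..t, ∑ n ∈ Finset.range N, w n * inner ℝ (e n) (g s) ^ 2 := by
  have hi : IntegrableOn g (Ioc t₀ t) := hg.integrable (by norm_num)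
  rw [intervalIntegral.integral_finsetSum, Finset.mul_sum]
  · refine Finset.sum_le_sum fun n _ => ?_
    rw [h.inner_duhamel ht hi, intervalIntegral.integral_const_mul]
    have := mul_le_mul_of_nonneg_left
      (integral_exp_mul_sq_le (h.pos n) ht (memLp_inner hg (e n))) (hw n)
    linarith
  · intro n _
    rw [intervalIntegrable_iff_integrableOn_Ioc_of_le ht]
    exact (memLp_inner hg (e n)).integrable_sq.const_mul _

omit [CompleteSpace H] h in
theorem sum_inner_integrableOn {t₀ t : ℝ} {g : ℝ → H}
    (hg : MemLp g 2 (volume.restrict (Ioc t₀ t))) (N : ℕ) :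
    IntegrableOn (fun s => ∑ n ∈ Finset.range N, w n * inner ℝ (e n) (g s) ^ 2) (Ioc t₀ t) :=
  integrable_finsetSum _ fun n _ => (memLp_inner hg (e n)).integrable_sq.const_mul _

/-- Maximal regularity with weight `1`, followed by Bessel: this is the source of all `H₀¹` bounds.
-/
theorem duhamel_sumLe {t₀ t : ℝ} (ht : t₀ ≤ t) {g : ℝ → H}
    (hg : MemLp g 2 (volume.restrict (Ioc t₀ t))) :
    SumLe e k (duhamel e k g t₀ t) (1 / 2 * ∫ s in t₀..t, ‖g s‖ ^ 2) := by
  intro N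
  have h1 := h.sum_duhamel_le (w := fun _ => 1) ht (fun _ => zero_le_one) hg N
  simp only [one_mul] at h1
  refine h1.trans (mul_le_mul_of_nonneg_left ?_ (by norm_num))
  refine intervalIntegral.integral_mono_on ht ?_ ?_ fun s _ => ?_
  · rw [intervalIntegrable_iff_integrableOn_Ioc_of_le ht]
    simpa using sum_inner_integrableOn (e := e) (w := fun _ => 1) hg N
  · rw [intervalIntegrable_iff_integrableOn_Ioc_of_le ht]
    exact hg.integrable_norm_pow (by norm_num)
  · simpa using sumLe_one h.orthonormal (g s) N

/-- Maximal regularity with weight `k`. It is the bootstrap step to `D(A)`, and it produces no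
singularity in time. -/
theorem duhamel_sumLe_sq {t₀ t M : ℝ} (ht : t₀ ≤ t) {g : ℝ → H}
    (hg : MemLp g 2 (volume.restrict (Ioc t₀ t)))
    (hM : ∀ᵐ s ∂volume.restrict (Ioc t₀ t), SumLe e k (g s) M) :
    SumLe e (fun n => k n ^ 2) (duhamel e k g t₀ t) (1 / 2 * ((t - t₀) * M)) := by
  intro N
  have h1 := h.sum_duhamel_le (w := k) ht (fun n => (h.pos n).le) hg N
  simp only [← sq] at h1
  refine h1.trans (mul_le_mul_of_nonneg_left ?_ (by norm_num))
  have : (t - t₀) * M = ∫ _ in t₀..t, M := by simp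
  rw [this]
  refine intervalIntegral.integral_mono_ae_restrict ht ?_ (by simp) ?_
  · rw [intervalIntegrable_iff_integrableOn_Ioc_of_le ht]
    exact sum_inner_integrableOn hg N
  · rw [← restrict_Ioc_eq_restrict_Icc]
    filter_upwards [hM] with s hs using hs N

omit h [CompleteSpace H] [InnerProductSpace ℝ H] in
theorem _root_.MeasureTheory.MemLp.restrict_Ioc {t₀ t T : ℝ} {g : ℝ → H} (ht : t ≤ T)
    (hg : MemLp g 2 (volume.restrict (Icc t₀ T))) : MemLp g 2 (volume.restrict (Ioc t₀ t)) :=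
  hg.mono_measure (Measure.restrict_mono
    (show Ioc t₀ t ⊆ Icc t₀ T from fun _ hs => ⟨hs.1.le, hs.2.trans ht⟩) le_rfl)

/-- The form bound is uniform in `t`, so by compactness it is enough that every coefficient is
continuous in `t`. -/
theorem continuousOn_duhamel {t₀ T : ℝ} {g : ℝ → H}
    (hg : MemLp g 2 (volume.restrict (Icc t₀ T))) :
    ContinuousOn (duhamel e k g t₀) (Icc t₀ T) := by
  have hi : IntegrableOn g (Icc t₀ T) := hg.integrable (by norm_num)
  have hn : IntegrableOn (fun s => ‖g s‖ ^ 2) (Icc t₀ T) := hg.integrable_norm_pow (by norm_num)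
  intro t ht
  refine h.tendsto_of_sumLe (B := 1 / 2 * ∫ s in Icc t₀ T, ‖g s‖ ^ 2) ?_ fun n => ?_
  · filter_upwards [self_mem_nhdsWithin] with s hs
    refine (h.duhamel_sumLe hs.1 (hg.restrict_Ioc hs.2)).mono ?_
    refine mul_le_mul_of_nonneg_left ?_ (by norm_num)
    rw [intervalIntegral.integral_of_le hs.1]
    exact setIntegral_mono_set hn (Eventually.of_forall fun s => by positivity)
      (show Ioc t₀ s ⊆ Icc t₀ T from fun r hr => ⟨hr.1.le, hr.2.trans hs.2⟩).eventuallyLE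
  -- With `exp (-(k n * t))` taken out of the integral, `t` occurs only in a primitive.
  · have h1 : ContinuousOn (fun t => Real.exp (-(k n * t)) *
        ∫ s in t₀..t, Real.exp (k n * s) * inner ℝ (e n) (g s)) (Icc t₀ T) := by
      refine ContinuousOn.mul (by fun_prop) ?_
      have hT : t₀ ≤ T := ht.1.trans ht.2
      rw [← uIcc_of_le hT]
      refine intervalIntegral.continuousOn_primitive_interval ?_
      rw [uIcc_of_le hT]
      have : IntegrableOn (fun s => inner ℝ (e n) (g s)) (Icc t₀ T) :=
        (innerSL ℝ (e n)).integrable_comp hi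
      exact this.continuousOn_mul (by fun_prop) isCompact_Icc
    have h2 : ContinuousOn (fun t => inner ℝ (e n) (duhamel e k g t₀ t)) (Icc t₀ T) := by
      refine h1.congr fun s hs => ?_
      simp only
      rw [h.inner_duhamel hs.1 (hi.mono_set fun r hr => ⟨hr.1.le, hr.2.trans hs.2⟩),
        ← intervalIntegral.integral_const_mul]
      congr 1; ext r
      rw [← mul_assoc, ← Real.exp_add]
      congr 2; ring
    exact h2 t ht

/-- The form bound on `f` lets the compactness criterion apply here as well; only data in the form
domain are propagated below. -/
theorem continuousOn_sg {f : H} {B : ℝ} (hf : SumLe e k f B) :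
    ContinuousOn (fun t => sg e k t f) (Ici 0) := by
  intro t ht
  refine h.tendsto_of_sumLe (B := B) ?_ fun n => ?_
  · filter_upwards [self_mem_nhdsWithin] with s hs
    exact h.sg_sumLe hs (fun n => (h.pos n).le) hf
  · have h2 : ContinuousOn (fun t => inner ℝ (e n) (sg e k t f)) (Ici 0) :=
      ContinuousOn.congr (f := fun t => Real.exp (-(k n * t)) * inner ℝ (e n) f) (by fun_prop)
        fun s hs => h.inner_sg hs f n
    exact h2 t ht

theorem duhamel_add {t₀ t : ℝ} (ht : t₀ ≤ t) {g₁ g₂ : ℝ → H} (hg₁ : IntegrableOn g₁ (Ioc t₀ t))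
    (hg₂ : IntegrableOn g₂ (Ioc t₀ t)) :
    duhamel e k (fun s => g₁ s + g₂ s) t₀ t = duhamel e k g₁ t₀ t + duhamel e k g₂ t₀ t := by
  rw [duhamel, duhamel, duhamel, ← intervalIntegral.integral_add
    (h.intervalIntegrable_sg ht hg₁) (h.intervalIntegrable_sg ht hg₂)]
  refine intervalIntegral.integral_congr fun s hs => ?_
  rw [uIcc_of_le ht] at hs
  exact h.sg_add (sub_nonneg.2 hs.2) _ _

theorem duhamel_sub {t₀ t : ℝ} (ht : t₀ ≤ t) {g₁ g₂ : ℝ → H} (hg₁ : IntegrableOn g₁ (Ioc t₀ t))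
    (hg₂ : IntegrableOn g₂ (Ioc t₀ t)) :
    duhamel e k (fun s => g₁ s - g₂ s) t₀ t = duhamel e k g₁ t₀ t - duhamel e k g₂ t₀ t := by
  rw [duhamel, duhamel, duhamel, ← intervalIntegral.integral_sub
    (h.intervalIntegrable_sg ht hg₁) (h.intervalIntegrable_sg ht hg₂)]
  refine intervalIntegral.integral_congr fun s hs => ?_
  rw [uIcc_of_le ht] at hs
  exact h.sg_sub (sub_nonneg.2 hs.2) _ _

theorem norm_duhamel_le {t₀ t : ℝ} (ht : t₀ ≤ t) {g : ℝ → H} (hg : IntegrableOn g (Ioc t₀ t)) :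
    ‖duhamel e k g t₀ t‖ ≤ ∫ s in t₀..t, ‖g s‖ := by
  refine (intervalIntegral.norm_integral_le_integral_norm ht).trans ?_
  have hi := h.intervalIntegrable_sg ht hg
  refine intervalIntegral.integral_mono_on ht hi.norm ?_ fun s hs =>
    h.norm_sg_le (sub_nonneg.2 hs.2) _
  rw [intervalIntegrable_iff_integrableOn_Ioc_of_le ht]
  exact hg.norm

end IsSpectral

end Duhamel

end GinzburgLandau

namespace GinzburgLandau

open Filter Topology

/-! ### Gronwall's inequality, mild solutions forward and backward, duality. -/

section Mild

/-- Gronwall's inequality in integral form. -/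
theorem integral_gronwall {u a : ℝ → ℝ} {t₀ T L : ℝ} (hu : ContinuousOn u (Icc t₀ T))
    (ha : ContinuousOn a (Icc t₀ T)) (ha0 : ∀ t ∈ Icc t₀ T, 0 ≤ a t) (hL : 0 ≤ L)
    (h : ∀ t ∈ Icc t₀ T, u t ≤ a t + L * ∫ s in t₀..t, u s) {t : ℝ} (ht : t ∈ Icc t₀ T) :
    u t ≤ a t + L * (Real.exp (L * (T - t₀)) * ∫ s in t₀..T, a s) := by
  have hT : t₀ ≤ T := ht.1.trans ht.2
  have hprim : ∀ f : ℝ → ℝ, ContinuousOn f (Icc t₀ T) →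
      ContinuousOn (fun t => ∫ s in t₀..t, f s) (Icc t₀ T) := fun f hf => by
    rw [← uIcc_of_le hT] at hf ⊢
    exact intervalIntegral.continuousOn_primitive_interval (hf.integrableOn_compact isCompact_uIcc)
  have hder : ∀ f : ℝ → ℝ, ContinuousOn f (Icc t₀ T) → ∀ x ∈ Ioo t₀ T,
      HasDerivAt (fun t => ∫ s in t₀..t, f s) (f x) x := fun f hf x hx => by
    refine intervalIntegral.integral_hasDerivAt_right ?_ ?_ (hf.continuousAt (Icc_mem_nhds hx.1 hx.2))
    · refine (hf.mono ?_).intervalIntegrable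
      rw [uIcc_of_le hx.1.le]; exact Icc_subset_Icc_right hx.2.le
    · exact (hf.mono Ioo_subset_Icc_self).stronglyMeasurableAtFilter isOpen_Ioo _ hx
  -- Integrating factor: `G' = exp(..) * (u - L ∫ u) - a ≤ exp(..) * a - a ≤ 0`, because `a ≥ 0` and
  -- the exponential is at most `1`.
  set G : ℝ → ℝ := fun t => Real.exp (-(L * (t - t₀))) * (∫ s in t₀..t, u s) - ∫ s in t₀..t, a s
  have hG : AntitoneOn G (Icc t₀ T) := by
    have hd : ∀ x ∈ Ioo t₀ T, HasDerivAt G (Real.exp (-(L * (x - t₀))) * (-L) *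
        (∫ s in t₀..x, u s) + Real.exp (-(L * (x - t₀))) * u x - a x) x := fun x hx => by
      have h1 : HasDerivAt (fun t => -(L * (t - t₀))) (-L) x :=
        (((hasDerivAt_id' x).sub_const t₀).const_mul L).fun_neg.congr_deriv (by ring)
      exact (h1.exp.mul (hder u hu x hx)).sub (hder a ha x hx)
    refine antitoneOn_of_deriv_nonpos (convex_Icc _ _) ?_ ?_ ?_
    · exact (ContinuousOn.mul (by fun_prop) (hprim u hu)).sub (hprim a ha)
    · rw [interior_Icc]
      exact fun x hx => (hd x hx).differentiableAt.differentiableWithinAt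
    · rw [interior_Icc]
      intro x hx
      rw [(hd x hx).deriv]
      have h1 := h x (Ioo_subset_Icc_self hx)
      have h2 := ha0 x (Ioo_subset_Icc_self hx)
      have h3 : Real.exp (-(L * (x - t₀))) ≤ 1 := by
        have := sub_nonneg.2 hx.1.le
        exact Real.exp_le_one_iff.2 (by simp; positivity)
      nlinarith [Real.exp_pos (-(L * (x - t₀)))]
  have h1 : G t ≤ G t₀ := hG (left_mem_Icc.2 hT) ht ht.1
  simp only [G, intervalIntegral.integral_same, mul_zero, sub_self] at h1
  have hai : 0 ≤ ∫ s in t₀..T, a s := intervalIntegral.integral_nonneg hT ha0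
  have h2 : ∫ s in t₀..t, a s ≤ ∫ s in t₀..T, a s := by
    have hA : IntervalIntegrable a volume t₀ T :=
      ContinuousOn.intervalIntegrable (by rwa [uIcc_of_le hT])
    refine intervalIntegral.integral_mono_interval le_rfl ht.1 ht.2 ?_ hA
    exact (ae_restrict_iff' measurableSet_Ioc).2
      (Eventually.of_forall fun x hx => ha0 x (Ioc_subset_Icc_self hx))
  have h3 : ∫ s in t₀..t, u s ≤ Real.exp (L * (T - t₀)) * ∫ s in t₀..T, a s := by
    have h4 : Real.exp (-(L * (t - t₀))) * (∫ s in t₀..t, u s) ≤ ∫ s in t₀..T, a s := by linarith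
    calc ∫ s in t₀..t, u s
        = Real.exp (L * (t - t₀)) * (Real.exp (-(L * (t - t₀))) * (∫ s in t₀..t, u s)) := by
          rw [← mul_assoc, ← Real.exp_add]; simp
      _ ≤ Real.exp (L * (t - t₀)) * ∫ s in t₀..T, a s := by gcongr
      _ ≤ _ := by
        have := ht.2
        gcongr
  exact (h t ht).trans (by gcongr)

variable {H : Type*} [NormedAddCommGroup H] [InnerProductSpace ℝ H]
  {e : ℕ → H} {k w : ℕ → ℝ}

omit [InnerProductSpace ℝ H] in
theorem memLp_of_continuousOn {g : ℝ → H} {t₀ T : ℝ} (hg : ContinuousOn g (Icc t₀ T)) :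
    MemLp g 2 (volume.restrict (Icc t₀ T)) := by
  obtain ⟨C, hC⟩ := isCompact_Icc.exists_bound_of_continuousOn hg
  exact MemLp.of_bound (hg.aestronglyMeasurable measurableSet_Icc) C
    ((ae_restrict_iff' measurableSet_Icc).2 (Eventually.of_forall hC))

/-- The backward Duhamel integral `∫ S(s - t) q(s) ds` over `[t,T]`. -/
noncomputable def duhamelBack (e : ℕ → H) (k : ℕ → ℝ) (q : ℝ → H) (t T : ℝ) : H :=
  ∫ s in t..T, sg e k (s - t) (q s)

/-- Time reflection on `[t₀,T]` converts backward into forward integrals, so the forward estimates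
need no second proof. The point `t₀` is arbitrary; the choice `t₀ = t` puts the upper endpoint at
`T`. -/
theorem duhamelBack_eq (q : ℝ → H) (t₀ t T : ℝ) :
    duhamelBack e k q t T = duhamel e k (fun s => q (T + t₀ - s)) t₀ (T + t₀ - t) := by
  have := intervalIntegral.integral_comp_sub_left (a := t₀) (b := T + t₀ - t)
    (fun s => sg e k (s - t) (q s)) (T + t₀)
  rw [sub_sub_cancel, add_sub_cancel_right] at this
  rw [duhamelBack, ← this, duhamel]
  congr 1; ext s
  congr 1; ring

theorem mapsTo_reflect (t₀ T : ℝ) : MapsTo (fun s => T + t₀ - s) (Icc t₀ T) (Icc t₀ T) :=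
  fun s hs => ⟨by linarith [hs.2], by linarith [hs.1]⟩

omit [InnerProductSpace ℝ H] in
theorem continuousOn_reflect {t₀ T : ℝ} {q : ℝ → H} (hq : ContinuousOn q (Icc t₀ T)) :
    ContinuousOn (fun s => q (T + t₀ - s)) (Icc t₀ T) :=
  hq.comp (by fun_prop) (mapsTo_reflect t₀ T)

variable [CompleteSpace H]

namespace IsSpectral

variable (h : IsSpectral e k)
include h

/-- Mild solutions of semilinear equations with a Lipschitz nonlinearity. -/
theorem exists_mild {t₀ T L : ℝ} (hT : t₀ ≤ T) (hL : 0 ≤ L) {ψ : ℝ → H}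
    (hψ : ContinuousOn ψ (Icc t₀ T)) {G : ℝ → H → H}
    (hG : ∀ φ : ℝ → H, ContinuousOn φ (Icc t₀ T) →
      ContinuousOn (fun s => G s (φ s)) (Icc t₀ T))
    (hlip : ∀ s ∈ Icc t₀ T, ∀ x y, ‖G s x - G s y‖ ≤ L * ‖x - y‖) :
    ∃ φ : ℝ → H, ContinuousOn φ (Icc t₀ T) ∧
      ∀ t ∈ Icc t₀ T, φ t = ψ t + duhamel e k (fun s => G s (φ s)) t₀ t := by
  -- Exponential weight: the unknown `v` is the solution times `exp (-(M * (s - t₀)))`, and `E v`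
  -- undoes the weight. The contraction constant is `L / M ≤ 1 / 2` whatever the length of the
  -- interval, so no gluing of short intervals is needed.
  set M := 2 * L + 1 with hM
  have hM0 : 0 < M := by positivity
  set E : C(Icc t₀ T, H) → ℝ → H := fun v s => Real.exp (M * (s - t₀)) • IccExtend hT v s with hE
  have hEc : ∀ v, Continuous (E v) := fun v =>
    Continuous.smul (by fun_prop) (v.continuous.Icc_extend' (h := hT))
  have hGc : ∀ v, ContinuousOn (fun s => G s (E v s)) (Icc t₀ T) := fun v =>
    hG _ (hEc v).continuousOn
  have hGi : ∀ v, ∀ t ∈ Icc t₀ T, IntegrableOn (fun s => G s (E v s)) (Ioc t₀ t) := fun v t ht =>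
    ((memLp_of_continuousOn (hGc v)).restrict_Ioc ht.2).integrable (by norm_num)
  set P : C(Icc t₀ T, H) → ℝ → H := fun v t => Real.exp (-(M * (t - t₀))) •
    (ψ t + duhamel e k (fun s => G s (E v s)) t₀ t) with hP
  have hPc : ∀ v, ContinuousOn (P v) (Icc t₀ T) := fun v =>
    ContinuousOn.smul (by fun_prop)
      (hψ.add (h.continuousOn_duhamel (memLp_of_continuousOn (hGc v))))
  set Φ : C(Icc t₀ T, H) → C(Icc t₀ T, H) := fun v =>
    ⟨(Icc t₀ T).domRestrict (P v), (hPc v).domRestrict⟩ with hΦ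
  have hcontr : ContractingWith (1 / 2) Φ := by
    refine ⟨by norm_num, LipschitzWith.of_dist_le_mul fun v v' => ?_⟩
    refine (ContinuousMap.dist_le (by positivity)).2 fun t => ?_
    obtain ⟨t, ht⟩ := t
    have h1 : P v t - P v' t = Real.exp (-(M * (t - t₀))) •
        duhamel e k (fun s => G s (E v s) - G s (E v' s)) t₀ t := by
      rw [h.duhamel_sub ht.1 (hGi v t ht) (hGi v' t ht)]
      simp only [hP, ← smul_sub, add_sub_add_left_eq_sub]
    have h2 : ‖duhamel e k (fun s => G s (E v s) - G s (E v' s)) t₀ t‖ ≤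
        ∫ s in t₀..t, L * dist v v' * Real.exp (M * (s - t₀)) := by
      refine (h.norm_duhamel_le ht.1 ((hGi v t ht).sub (hGi v' t ht))).trans ?_
      refine intervalIntegral.integral_mono_on ht.1 ?_ ?_ fun s hs => ?_
      · rw [intervalIntegrable_iff_integrableOn_Ioc_of_le ht.1]
        exact ((hGi v t ht).sub (hGi v' t ht)).norm
      · exact (by fun_prop : Continuous _).intervalIntegrable _ _
      · refine (hlip s ⟨hs.1, hs.2.trans ht.2⟩ _ _).trans ?_
        simp only [hE, ← smul_sub, norm_smul, Real.norm_eq_abs, Real.abs_exp]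
        have h3 : ‖IccExtend hT v s - IccExtend hT v' s‖ ≤ dist v v' := by
          rw [← dist_eq_norm]
          exact ContinuousMap.dist_apply_le_dist _
        calc L * (Real.exp (M * (s - t₀)) * ‖IccExtend hT v s - IccExtend hT v' s‖)
            ≤ L * (Real.exp (M * (s - t₀)) * dist v v') := by gcongr
          _ = _ := by ring
    have h3 : ∫ s in t₀..t, L * dist v v' * Real.exp (M * (s - t₀)) =
        L * dist v v' * ((Real.exp (M * (t - t₀)) - 1) / M) := by
      rw [intervalIntegral.integral_const_mul]
      congr 1
      have hd : ∀ s ∈ uIcc t₀ t, HasDerivAt (fun s => Real.exp (M * (s - t₀)) / M)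
          (Real.exp (M * (s - t₀))) s := fun s _ => by
        have h1 : HasDerivAt (fun s => M * (s - t₀)) M s :=
          (((hasDerivAt_id' s).sub_const t₀).const_mul M).congr_deriv (by ring)
        exact (h1.exp.div_const M).congr_deriv (mul_div_cancel_right₀ _ hM0.ne')
      rw [intervalIntegral.integral_eq_sub_of_hasDerivAt hd
        ((by fun_prop : Continuous _).intervalIntegrable _ _)]
      simp; ring
    change dist (P v t) (P v' t) ≤ _
    rw [dist_eq_norm, h1, norm_smul, Real.norm_eq_abs, Real.abs_exp]
    calc Real.exp (-(M * (t - t₀))) * ‖duhamel e k (fun s => G s (E v s) - G s (E v' s)) t₀ t‖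
        ≤ Real.exp (-(M * (t - t₀))) * (L * dist v v' * ((Real.exp (M * (t - t₀)) - 1) / M)) := by
          gcongr; exact h2.trans h3.le
      _ = L / M * dist v v' * (1 - Real.exp (-(M * (t - t₀)))) := by
          rw [Real.exp_neg]; field_simp
      _ ≤ 1 / 2 * dist v v' * 1 := by
          have : L / M ≤ 1 / 2 := by rw [div_le_div_iff₀ hM0 two_pos]; linarith
          have h5 : Real.exp (-(M * (t - t₀))) ≤ 1 := by
            have := sub_nonneg.2 ht.1
            exact Real.exp_le_one_iff.2 (by simp; positivity)
          have := Real.exp_pos (-(M * (t - t₀)))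
          refine mul_le_mul ?_ (by linarith) (by linarith) (by positivity)
          gcongr
      _ = _ := by simp
  obtain ⟨v, hv, -⟩ := hcontr.exists_fixedPoint 0 (edist_ne_top _ _)
  refine ⟨E v, (hEc v).continuousOn, fun t ht => ?_⟩
  have h1 : P v t = v ⟨t, ht⟩ := congrArg (fun u : C(Icc t₀ T, H) => u ⟨t, ht⟩) hv
  have h2 : E v t = Real.exp (M * (t - t₀)) • v ⟨t, ht⟩ := by
    simp only [hE, IccExtend_of_mem hT v ht]
  rw [h2, ← h1, hP, smul_smul, ← Real.exp_add]
  simp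

/-- Mild solutions of backward equations with a Lipschitz nonlinearity. -/
theorem exists_mild_back {t₀ T L : ℝ} (hT : t₀ ≤ T) (hL : 0 ≤ L) {f : H} {B : ℝ}
    (hf : SumLe e k f B) {G : ℝ → H → H}
    (hG : ∀ φ : ℝ → H, ContinuousOn φ (Icc t₀ T) →
      ContinuousOn (fun s => G s (φ s)) (Icc t₀ T))
    (hlip : ∀ s ∈ Icc t₀ T, ∀ x y, ‖G s x - G s y‖ ≤ L * ‖x - y‖) :
    ∃ l : ℝ → H, ContinuousOn l (Icc t₀ T) ∧ ∀ t ∈ Icc t₀ T,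
      l t = sg e k (T - t) f + duhamelBack e k (fun s => G s (l s)) t T := by
  have hψ : ContinuousOn (fun t => sg e k (t - t₀) f) (Icc t₀ T) :=
    (h.continuousOn_sg hf).comp (by fun_prop) fun s hs => sub_nonneg.2 hs.1
  have hr : ∀ s, T + t₀ - (T + t₀ - s) = s := fun s => sub_sub_cancel _ _
  obtain ⟨m, hm, hm2⟩ := h.exists_mild hT hL hψ (G := fun s => G (T + t₀ - s)) (fun φ hφ => by
      have := continuousOn_reflect (hG _ (continuousOn_reflect hφ))
      simpa only [hr] using this) (fun s hs => hlip _ (mapsTo_reflect t₀ T hs))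
  refine ⟨fun s => m (T + t₀ - s), continuousOn_reflect hm, fun t ht => ?_⟩
  rw [duhamelBack_eq _ t₀]
  simp only [hr]
  rw [hm2 _ (mapsTo_reflect t₀ T ht)]
  congr 2; ring

theorem duhamelBack_sumLe {t₀ T t : ℝ} (ht : t ∈ Icc t₀ T) {q : ℝ → H}
    (hq : ContinuousOn q (Icc t₀ T)) :
    SumLe e k (duhamelBack e k q t T) (1 / 2 * ∫ s in t₀..T, ‖q s‖ ^ 2) := by
  have hT : t₀ ≤ T := ht.1.trans ht.2
  rw [duhamelBack_eq q t t T, add_sub_cancel_right]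
  have hq' : ContinuousOn q (Icc t T) := hq.mono (Icc_subset_Icc_left ht.1)
  refine (h.duhamel_sumLe ht.2
    ((memLp_of_continuousOn (continuousOn_reflect hq')).restrict_Ioc le_rfl)).mono ?_
  refine mul_le_mul_of_nonneg_left ?_ (by norm_num)
  have := intervalIntegral.integral_comp_sub_left (a := t) (b := T)
    (fun s => ‖q s‖ ^ 2) (T + t)
  rw [this, add_sub_cancel_left, add_sub_cancel_right]
  refine intervalIntegral.integral_mono_interval ht.1 ht.2 le_rfl
    (Eventually.of_forall fun s => by positivity) ?_
  exact ContinuousOn.intervalIntegrable (by rw [uIcc_of_le hT]; fun_prop)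

theorem duhamelBack_sumLe_sq {t₀ T t M : ℝ} (ht : t ∈ Icc t₀ T) {q : ℝ → H}
    (hq : ContinuousOn q (Icc t₀ T)) (hM : ∀ s ∈ Icc t₀ T, SumLe e k (q s) M) :
    SumLe e (fun n => k n ^ 2) (duhamelBack e k q t T) (1 / 2 * ((T - t₀) * M)) := by
  rw [duhamelBack_eq q t t T, add_sub_cancel_right]
  have hq' : ContinuousOn q (Icc t T) := hq.mono (Icc_subset_Icc_left ht.1)
  refine (h.duhamel_sumLe_sq ht.2
    ((memLp_of_continuousOn (continuousOn_reflect hq')).restrict_Ioc le_rfl) (M := M) ?_).mono ?_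
  · refine (ae_restrict_iff' measurableSet_Ioc).2 (Eventually.of_forall fun s hs => hM _ ?_)
    exact ⟨by linarith [hs.2, ht.1], by linarith [hs.1]⟩
  · have := (hM t ht).nonneg
    have := ht.1
    gcongr

theorem intervalIntegrable_sg_back {t T : ℝ} (ht : t ≤ T) {g : ℝ → H}
    (hg : IntegrableOn g (Ioc t T)) :
    IntervalIntegrable (fun s => sg e k (s - t) (g s)) volume t T := by
  rw [intervalIntegrable_iff_integrableOn_Ioc_of_le ht]
  have h0 : ∀ᵐ s ∂volume.restrict (Ioc t T), 0 ≤ s - t :=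
    (ae_restrict_iff' measurableSet_Ioc).2 (Eventually.of_forall fun s hs => sub_nonneg.2 hs.1.le)
  refine Integrable.mono hg (h.aestronglyMeasurable_sg (by fun_prop) h0 hg.1) ?_
  filter_upwards [h0] with s hs
  exact h.norm_sg_le hs _

/-- Duality between the forward and the backward equation. -/
theorem inner_duhamel_eq {t₀ T : ℝ} (hT : t₀ ≤ T) {f : H} {q g l : ℝ → H}
    (hq : ContinuousOn q (Icc t₀ T)) (hg : MemLp g 2 (volume.restrict (Icc t₀ T)))
    (hl : ∀ t ∈ Icc t₀ T, l t = sg e k (T - t) f + duhamelBack e k q t T)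
    (hlc : ContinuousOn l (Icc t₀ T)) :
    inner ℝ f (duhamel e k g t₀ T) = (∫ s in t₀..T, inner ℝ (l s) (g s)) -
      ∫ s in t₀..T, inner ℝ (q s) (duhamel e k g t₀ s) := by
  have hgi : IntegrableOn g (Ioc t₀ T) := (hg.restrict_Ioc le_rfl).integrable (by norm_num)
  have hqi : IntegrableOn q (Ioc t₀ T) :=
    ((memLp_of_continuousOn hq).restrict_Ioc le_rfl).integrable (by norm_num)
  set μ : Measure ℝ := volume.restrict (Ioc t₀ T) with hμ
  -- Fubini on the triangle `s ≤ r`: integrating first in `r` gives the backward integral of `q`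
  -- against `g s`, integrating first in `s` gives the forward integral of `g` against `q r`.
  -- Truncating the time at zero keeps the semigroup measurable and contractive off the triangle.
  set F : ℝ → ℝ → ℝ := fun s r => if s ≤ r then inner ℝ (q r) (sg e k (max (r - s) 0) (g s)) else 0
  have hFm : AEStronglyMeasurable (Function.uncurry F) (μ.prod μ) := by
    have h1 : AEStronglyMeasurable (fun p : ℝ × ℝ => inner ℝ (q p.2)
        (sg e k (max (p.2 - p.1) 0) (g p.1))) (μ.prod μ) := by
      refine AEStronglyMeasurable.inner hqi.1.comp_snd
        (h.aestronglyMeasurable_sg (by fun_prop) (Eventually.of_forall fun p => le_max_right _ _)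
          hgi.1.comp_fst)
    have h2 : MeasurableSet {p : ℝ × ℝ | p.1 ≤ p.2} := measurableSet_le measurable_fst measurable_snd
    refine (h1.indicator h2).congr (Eventually.of_forall fun p => ?_)
    simp [F, Function.uncurry, indicator]
  have hFi : Integrable (Function.uncurry F) (μ.prod μ) := by
    refine Integrable.mono (hgi.norm.mul_prod hqi.norm) hFm (Eventually.of_forall fun p => ?_)
    simp only [F, Function.uncurry]
    rw [norm_mul, norm_norm, norm_norm]
    split_ifs
    · refine (norm_inner_le_norm _ _).trans ?_
      rw [mul_comm]
      gcongr
      exact h.norm_sg_le (le_max_right _ _) _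
    · simp only [norm_zero]; positivity
  have hswap := integral_integral_swap hFi
  have hinner : ∀ (t₁ t₂ : ℝ) (v : H) (p : ℝ → H), IntervalIntegrable p volume t₁ t₂ →
      inner ℝ v (∫ s in t₁..t₂, p s) = ∫ s in t₁..t₂, inner ℝ v (p s) := fun t₁ t₂ v p hp => by
    simpa using ((innerSL ℝ v).intervalIntegral_comp_comm hp).symm
  have hA : ∀ s ∈ Ioc t₀ T, ∫ r, F s r ∂μ = inner ℝ (duhamelBack e k q s T) (g s) := by
    intro s hs
    have h1 : ∫ r, F s r ∂μ = ∫ r in Ioc t₀ T, (Ici s).indicator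
        (fun r => inner ℝ (q r) (sg e k (max (r - s) 0) (g s))) r := by
      refine integral_congr_ae (Eventually.of_forall fun r => ?_)
      simp [F, indicator]
    have h2 : Ioc t₀ T ∩ Ici s = Icc s T := by
      ext r; simp only [mem_inter_iff, mem_Ioc, mem_Ici, mem_Icc]
      exact ⟨fun hr => ⟨hr.2, hr.1.2⟩, fun hr => ⟨⟨hs.1.trans_le hr.1, hr.2⟩, hr.1⟩⟩
    rw [h1, setIntegral_indicator measurableSet_Ici, h2, integral_Icc_eq_integral_Ioc,
      ← intervalIntegral.integral_of_le hs.2, real_inner_comm, duhamelBack, hinner]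
    · refine intervalIntegral.integral_congr fun r hr => ?_
      rw [uIcc_of_le hs.2] at hr
      rw [max_eq_left (sub_nonneg.2 hr.1), ← h.inner_sg_left (sub_nonneg.2 hr.1), real_inner_comm]
    · exact h.intervalIntegrable_sg_back hs.2 (hqi.mono_set (Ioc_subset_Ioc_left hs.1.le))
  have hB : ∀ r ∈ Ioc t₀ T, ∫ s, F s r ∂μ = inner ℝ (q r) (duhamel e k g t₀ r) := by
    intro r hr
    have h1 : ∫ s, F s r ∂μ = ∫ s in Ioc t₀ T, (Iic r).indicator
        (fun s => inner ℝ (q r) (sg e k (max (r - s) 0) (g s))) s := by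
      refine integral_congr_ae (Eventually.of_forall fun r => ?_)
      simp [F, indicator]
    rw [h1, setIntegral_indicator measurableSet_Iic, Ioc_inter_Iic, min_eq_right hr.2,
      ← intervalIntegral.integral_of_le hr.1.le, duhamel, hinner]
    · refine intervalIntegral.integral_congr fun s hs => ?_
      rw [uIcc_of_le hr.1.le] at hs
      rw [max_eq_left (sub_nonneg.2 hs.2)]
    · exact h.intervalIntegrable_sg hr.1.le (hgi.mono_set (Ioc_subset_Ioc_right hr.2))
  rw [setIntegral_congr_fun measurableSet_Ioc hA, setIntegral_congr_fun measurableSet_Ioc hB,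
    ← intervalIntegral.integral_of_le hT, ← intervalIntegral.integral_of_le hT] at hswap
  have hint : ∀ p : ℝ → H, ContinuousOn p (Icc t₀ T) →
      IntervalIntegrable (fun s => inner ℝ (p s) (g s)) volume t₀ T := fun p hp => by
    rw [intervalIntegrable_iff_integrableOn_Ioc_of_le hT]
    obtain ⟨C, hC⟩ := isCompact_Icc.exists_bound_of_continuousOn hp
    refine Integrable.mono (hgi.norm.const_mul C)
      (AEStronglyMeasurable.inner ((hp.mono Ioc_subset_Icc_self).aestronglyMeasurable
        measurableSet_Ioc) hgi.1) ?_
    refine (ae_restrict_iff' measurableSet_Ioc).2 (Eventually.of_forall fun s hs => ?_)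
    refine (norm_inner_le_norm _ _).trans ?_
    have := hC s (Ioc_subset_Icc_self hs)
    rw [norm_mul, norm_norm, Real.norm_of_nonneg ((norm_nonneg _).trans this)]
    gcongr
  -- Self-adjointness moves `S(T - s)` onto `f`, and `S(T - s) f` is `l s` minus its backward
  -- Duhamel term.
  rw [← hswap, duhamel, hinner _ _ _ _ (h.intervalIntegrable_sg hT hgi),
    ← intervalIntegral.integral_sub (hint l hlc)]
  · refine intervalIntegral.integral_congr fun s hs => ?_
    rw [uIcc_of_le hT] at hs
    rw [hl s hs, inner_add_left, add_sub_cancel_right, h.inner_sg_left (sub_nonneg.2 hs.2)]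
  · rw [intervalIntegrable_iff_integrableOn_Ioc_of_le hT]
    refine (hFi.integral_prod_left).congr ?_
    exact (ae_restrict_iff' measurableSet_Ioc).2 (Eventually.of_forall hA)

end IsSpectral

end Mild

end GinzburgLandau

namespace GinzburgLandau

open Filter Topology

/-! ### Weak sequential compactness for square integrable controls. -/

section WeakCompactness

variable {H : Type*} [NormedAddCommGroup H] [InnerProductSpace ℝ H]

theorem integrable_inner_of_memLp {X : Type*} [MeasurableSpace X] {μ : Measure X} {f g : X → H}
    (hf : MemLp f 2 μ) (hg : MemLp g 2 μ) : Integrable (fun s => inner ℝ (f s) (g s)) μ := by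
  have : Integrable (fun s => ‖f s‖ * ‖g s‖) μ := hf.norm.integrable_mul hg.norm
  refine this.mono (hf.1.inner hg.1) (Eventually.of_forall fun s => ?_)
  rw [norm_mul, norm_norm, norm_norm]
  exact norm_inner_le_norm _ _

theorem inner_toLp_eq {X : Type*} [MeasurableSpace X] {μ : Measure X} {f g : X → H}
    (hf : MemLp f 2 μ) (hg : MemLp g 2 μ) :
    inner ℝ (hf.toLp f) (hg.toLp g) = ∫ s, inner ℝ (f s) (g s) ∂μ := by
  rw [L2.inner_def]
  refine integral_congr_ae ?_
  filter_upwards [hf.coeFn_toLp, hg.coeFn_toLp] with s h1 h2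
  rw [h1, h2]

theorem norm_toLp_sq {X : Type*} [MeasurableSpace X] {μ : Measure X} {f : X → H}
    (hf : MemLp f 2 μ) : ‖hf.toLp f‖ ^ 2 = ∫ s, ‖f s‖ ^ 2 ∂μ := by
  rw [← real_inner_self_eq_norm_sq, inner_toLp_eq]
  simp only [real_inner_self_eq_norm_sq]

/-- Bounded sequences in a separable Hilbert space have weakly convergent subsequences. -/
theorem exists_weak_subseq [CompleteSpace H] [TopologicalSpace.SeparableSpace H] {x : ℕ → H}
    {R : ℝ} (hx : ∀ j, ‖x j‖ ≤ R) : ∃ (y : H) (σ : ℕ → ℕ), StrictMono σ ∧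
      ∀ v, Tendsto (fun j => inner ℝ v (x (σ j))) atTop (𝓝 (inner ℝ v y)) := by
  have hc := WeakDual.isSeqCompact_closedBall ℝ H 0 R
  obtain ⟨z, -, σ, hσ, hz⟩ := hc (x := fun j => StrongDual.toWeakDual (InnerProductSpace.toDual ℝ H (x j)))
    (fun j => by simpa using hx j)
  refine ⟨(InnerProductSpace.toDual ℝ H).symm (WeakDual.toStrongDual z), σ, hσ, fun v => ?_⟩
  have h1 := ((WeakDual.eval_continuous v).tendsto z).comp hz
  have h2 : inner ℝ v ((InnerProductSpace.toDual ℝ H).symm (WeakDual.toStrongDual z)) = z v := by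
    rw [real_inner_comm, InnerProductSpace.toDual_symm_apply]; rfl
  rw [h2]
  refine h1.congr fun j => ?_
  rw [real_inner_comm]
  rfl

/-- The bound describes a ball of the Hilbert space of square integrable `H`-valued functions, which
is separable because `H` is. The result is phrased for functions so that integrals can be used
directly. -/
theorem exists_weak_subseq_memLp [CompleteSpace H] [TopologicalSpace.SeparableSpace H]
    {μ : Measure ℝ} [SFinite μ] {α : ℕ → ℝ → H} (hα : ∀ j, MemLp (α j) 2 μ) {R : ℝ}
    (hR : ∀ j, ∫ s, ‖α j s‖ ^ 2 ∂μ ≤ R) :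
    ∃ (a : ℝ → H) (σ : ℕ → ℕ), MemLp a 2 μ ∧ StrictMono σ ∧ ∀ β : ℝ → H, MemLp β 2 μ →
      Tendsto (fun j => ∫ s, inner ℝ (β s) (α (σ j) s) ∂μ) atTop
        (𝓝 (∫ s, inner ℝ (β s) (a s) ∂μ)) := by
  have : Fact ((2 : ENNReal) ≠ ⊤) := ⟨by norm_num⟩
  obtain ⟨y, σ, hσ, hy⟩ := exists_weak_subseq (x := fun j => (hα j).toLp (α j)) (R := √R)
    (fun j => Real.le_sqrt_of_sq_le (by rw [norm_toLp_sq]; exact hR j))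
  refine ⟨y, σ, Lp.memLp y, hσ, fun β hβ => ?_⟩
  have h1 := hy (hβ.toLp β)
  simp only [inner_toLp_eq] at h1
  rw [← inner_toLp_eq hβ (Lp.memLp y), Lp.toLp_coeFn]
  exact h1

end WeakCompactness

/-! ### The abstract control problem and the existence of optimal controls. -/

section Control

variable {H : Type*} [NormedAddCommGroup H] [InnerProductSpace ℝ H]
  {e : ℕ → H} {k w : ℕ → ℝ}

/-- `φ` is the mild state with control `α`. -/
def IsState (e : ℕ → H) (k : ℕ → ℝ) (F : H → H) (t₀ T : ℝ) (φ₀ : H) (α φ : ℝ → H) : Prop :=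
  ContinuousOn φ (Icc t₀ T) ∧ ∀ t ∈ Icc t₀ T,
    φ t = sg e k (t - t₀) φ₀ + duhamel e k (fun s => F (φ s) + α s) t₀ t

/-- The hypotheses on the nonlinearity `F` and on its derivative `DF`. -/
structure IsNonlinearity (e : ℕ → H) (k : ℕ → ℝ) (F : H → H) (DF : H → H → H) (L : ℝ) :
    Prop where
  nonneg : 0 ≤ L
  bound : ∀ x, ‖F x‖ ≤ L
  lip : ∀ x y, ‖F x - F y‖ ≤ L * ‖x - y‖
  deriv_sub : ∀ x f g, DF x (f - g) = DF x f - DF x g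
  deriv_bound : ∀ x f, ‖DF x f‖ ≤ L * ‖f‖
  deriv_symm : ∀ x f g, inner ℝ (DF x f) g = inner ℝ f (DF x g)
  deriv_cont : Continuous fun p : H × H => DF p.1 p.2
  -- Differentiability in this weak sense only: a superposition operator on `L²` need not be Fréchet
  -- differentiable, but its remainder is quadratic when paired with `l` in the form domain.
  taylor : ∀ B, ∃ R, 0 ≤ R ∧ ∀ l, SumLe e k l B → ∀ x d,
    |inner ℝ l (F (x + d) - F x - DF x d)| ≤ R * ‖d‖ ^ 2
  -- The last two conditions keep the sources of the state and of the dual equation in the form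
  -- domain.
  form : ∀ B, ∃ B', ∀ x, SumLe e k x B → SumLe e k (F x) B'
  deriv_form : ∀ B, ∃ B', ∀ x f, SumLe e k x B → SumLe e k f B → SumLe e k (DF x f) B'

variable {F : H → H} {DF : H → H → H} {L : ℝ}

theorem IsNonlinearity.continuous (hF : IsNonlinearity e k F DF L) : Continuous F :=
  (LipschitzWith.of_dist_le_mul (K := ⟨L, hF.nonneg⟩) fun x y => by
    rw [dist_eq_norm, dist_eq_norm]; exact hF.lip x y).continuous

theorem IsNonlinearity.memLp {T t₀ : ℝ} (hF : IsNonlinearity e k F DF L) {φ : ℝ → H}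
    (hφ : ContinuousOn φ (Icc t₀ T)) :
    MemLp (fun s => F (φ s)) 2 (volume.restrict (Icc t₀ T)) :=
  memLp_of_continuousOn (hF.continuous.comp_continuousOn hφ)

variable [CompleteSpace H]

namespace IsSpectral

variable (h : IsSpectral e k) (hF : IsNonlinearity e k F DF L)
include h hF

theorem exists_state {t₀ T : ℝ} (hT : t₀ ≤ T) {φ₀ : H} {B : ℝ} (hφ₀ : SumLe e k φ₀ B)
    {α : ℝ → H} (hα : MemLp α 2 (volume.restrict (Icc t₀ T))) :
    ∃ φ, IsState e k F t₀ T φ₀ α φ := by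
  -- The control is only `L²` in time, so its Duhamel integral is put into the continuous
  -- inhomogeneity; the remaining nonlinearity is autonomous and Lipschitz.
  have hψ : ContinuousOn (fun t => sg e k (t - t₀) φ₀ + duhamel e k α t₀ t) (Icc t₀ T) :=
    ((h.continuousOn_sg hφ₀).comp (by fun_prop) fun s hs => sub_nonneg.2 hs.1).add
      (h.continuousOn_duhamel hα)
  obtain ⟨φ, hφ, hφ2⟩ := h.exists_mild hT hF.nonneg hψ (G := fun _ x => F x)
    (fun φ hφ => hF.continuous.comp_continuousOn hφ) (fun _ _ => hF.lip)
  refine ⟨φ, hφ, fun t ht => ?_⟩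
  rw [hφ2 t ht, h.duhamel_add ht.1 (((hF.memLp hφ).restrict_Ioc ht.2).integrable (by norm_num))
    ((hα.restrict_Ioc ht.2).integrable (by norm_num))]
  abel

omit h [CompleteSpace H] in
theorem memLp_source {t₀ T : ℝ} {φ α : ℝ → H} (hφ : ContinuousOn φ (Icc t₀ T))
    (hα : MemLp α 2 (volume.restrict (Icc t₀ T))) :
    MemLp (fun s => F (φ s) + α s) 2 (volume.restrict (Icc t₀ T)) :=
  (hF.memLp hφ).add hα

theorem state_sub {t₀ T t : ℝ} {φ₀ : H} {α α' φ φ' : ℝ → H}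
    (hα : MemLp α 2 (volume.restrict (Icc t₀ T))) (hα' : MemLp α' 2 (volume.restrict (Icc t₀ T)))
    (hφ : IsState e k F t₀ T φ₀ α φ) (hφ' : IsState e k F t₀ T φ₀ α' φ') (ht : t ∈ Icc t₀ T) :
    φ' t - φ t = duhamel e k (fun s => F (φ' s) + α' s - (F (φ s) + α s)) t₀ t := by
  rw [h.duhamel_sub ht.1
    (((memLp_source hF hφ'.1 hα').restrict_Ioc ht.2).integrable (by norm_num))
    (((memLp_source hF hφ.1 hα).restrict_Ioc ht.2).integrable (by norm_num)),
    hφ.2 t ht, hφ'.2 t ht]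
  abel

/-- The states depend continuously on the controls. -/
theorem norm_state_sub_le {t₀ T t : ℝ} {φ₀ : H} {α α' φ φ' : ℝ → H}
    (hα : MemLp α 2 (volume.restrict (Icc t₀ T))) (hα' : MemLp α' 2 (volume.restrict (Icc t₀ T)))
    (hφ : IsState e k F t₀ T φ₀ α φ) (hφ' : IsState e k F t₀ T φ₀ α' φ') (ht : t ∈ Icc t₀ T) :
    ‖φ' t - φ t‖ ≤ ‖duhamel e k (fun s => α' s - α s) t₀ t‖ + L * (Real.exp (L * (T - t₀)) *
      ∫ s in t₀..T, ‖duhamel e k (fun s => α' s - α s) t₀ s‖) := by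
  refine integral_gronwall (u := fun t => ‖φ' t - φ t‖) (hφ'.1.sub hφ.1).norm
    (h.continuousOn_duhamel (hα'.sub hα)).norm (fun _ _ => norm_nonneg _) hF.nonneg
    (fun t ht => ?_) ht
  have hi : ∀ {g : ℝ → H}, MemLp g 2 (volume.restrict (Icc t₀ T)) → IntegrableOn g (Ioc t₀ t) :=
    fun hg => (hg.restrict_Ioc ht.2).integrable (by norm_num)
  have h1 : φ' t - φ t = duhamel e k (fun s => α' s - α s) t₀ t +
      duhamel e k (fun s => F (φ' s) - F (φ s)) t₀ t := by
    rw [state_sub h hF hα hα' hφ hφ' ht, ← h.duhamel_add (g₁ := fun s => α' s - α s)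
      (g₂ := fun s => F (φ' s) - F (φ s)) ht.1 (hi (hα'.sub hα))
      (hi ((hF.memLp hφ'.1).sub (hF.memLp hφ.1)))]
    congr 1; ext s; abel
  rw [h1, ← intervalIntegral.integral_const_mul]
  refine (norm_add_le _ _).trans (add_le_add le_rfl ?_)
  refine (h.norm_duhamel_le ht.1 (hi ((hF.memLp hφ'.1).sub (hF.memLp hφ.1)))).trans ?_
  refine intervalIntegral.integral_mono_on ht.1 ?_ ?_ fun s _ => hF.lip _ _
  · rw [intervalIntegrable_iff_integrableOn_Ioc_of_le ht.1]
    exact (hi ((hF.memLp hφ'.1).sub (hF.memLp hφ.1))).norm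
  · refine ContinuousOn.intervalIntegrable ?_
    rw [uIcc_of_le ht.1]
    exact ((hφ'.1.sub hφ.1).norm.const_mul L).mono (Icc_subset_Icc_right ht.2)

omit h hF in
-- Weak convergence of controls becomes strong convergence: each coefficient of the integral is a
-- pairing of the control with a fixed square integrable function, and the form bound is uniform, so
-- compactness applies.
theorem tendsto_duhamel (h : IsSpectral e k) {t₀ T t : ℝ} {α : ℕ → ℝ → H} {a : ℝ → H}
    (hα : ∀ j, MemLp (α j) 2 (volume.restrict (Icc t₀ T)))
    (ha : MemLp a 2 (volume.restrict (Icc t₀ T))) {R : ℝ}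
    (hR : ∀ j, ∫ s in Icc t₀ T, ‖α j s‖ ^ 2 ≤ R)
    (hw : ∀ β : ℝ → H, MemLp β 2 (volume.restrict (Icc t₀ T)) →
      Tendsto (fun j => ∫ s in Icc t₀ T, inner ℝ (β s) (α j s)) atTop
        (𝓝 (∫ s in Icc t₀ T, inner ℝ (β s) (a s)))) (ht : t ∈ Icc t₀ T) :
    Tendsto (fun j => duhamel e k (α j) t₀ t) atTop (𝓝 (duhamel e k a t₀ t)) := by
  refine h.tendsto_of_sumLe (B := 1 / 2 * R) (Eventually.of_forall fun j => ?_) fun n => ?_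
  · refine (h.duhamel_sumLe ht.1 ((hα j).restrict_Ioc ht.2)).mono ?_
    refine mul_le_mul_of_nonneg_left ((?_ : _ ≤ _).trans (hR j)) (by norm_num)
    rw [intervalIntegral.integral_of_le ht.1]
    exact setIntegral_mono_set ((hα j).integrable_norm_pow (by norm_num))
      (Eventually.of_forall fun s => by positivity)
      (show Ioc t₀ t ⊆ Icc t₀ T from fun r hr => ⟨hr.1.le, hr.2.trans ht.2⟩).eventuallyLE
  · set β : ℝ → H := (Ioc t₀ t).indicator fun s => Real.exp (-(k n * (t - s))) • e n
    have hβ : MemLp β 2 (volume.restrict (Icc t₀ T)) :=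
      (memLp_of_continuousOn (by fun_prop)).indicator measurableSet_Ioc
    have key : ∀ p : ℝ → H, MemLp p 2 (volume.restrict (Icc t₀ T)) →
        ∫ s in Icc t₀ T, inner ℝ (β s) (p s) = inner ℝ (e n) (duhamel e k p t₀ t) := by
      intro p hp
      have h1 : (fun s => inner ℝ (β s) (p s)) = (Ioc t₀ t).indicator fun s =>
          Real.exp (-(k n * (t - s))) * inner ℝ (e n) (p s) := by
        ext s
        by_cases hs : s ∈ Ioc t₀ t
        · simp [β, hs, inner_smul_left]
        · simp [β, hs]
      rw [h.inner_duhamel ht.1 ((hp.restrict_Ioc ht.2).integrable (by norm_num)), h1,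
        setIntegral_indicator measurableSet_Ioc, intervalIntegral.integral_of_le ht.1,
        inter_eq_self_of_subset_right
          (show Ioc t₀ t ⊆ Icc t₀ T from fun r hr => ⟨hr.1.le, hr.2.trans ht.2⟩)]
    simpa only [key _ (hα _), key _ ha] using hw β hβ

/-- The cost of a control and its state. -/
noncomputable def _root_.GinzburgLandau.controlCost (K : ℝ) (m : H) (t₀ T : ℝ) (α φ : ℝ → H) : ℝ :=
  (∫ t in t₀..T, ‖α t‖ ^ 2 / 2) + K * ‖φ T - m‖ ^ 2

/-- Existence of optimal controls. -/
theorem exists_optimal [TopologicalSpace.SeparableSpace H] {t₀ T K : ℝ} (hT : t₀ ≤ T) (hK : 0 < K)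
    (m : H) {φ₀ : H} {B : ℝ} (hφ₀ : SumLe e k φ₀ B) :
    ∃ α φ : ℝ → H, MemLp α 2 (volume.restrict (Icc t₀ T)) ∧ IsState e k F t₀ T φ₀ α φ ∧
      ∀ α' φ' : ℝ → H, MemLp α' 2 (volume.restrict (Icc t₀ T)) → IsState e k F t₀ T φ₀ α' φ' →
        controlCost K m t₀ T α φ ≤ controlCost K m t₀ T α' φ' := by
  set S : Set ℝ := {c | ∃ α φ : ℝ → H, (MemLp α 2 (volume.restrict (Icc t₀ T)) ∧
    IsState e k F t₀ T φ₀ α φ) ∧ c = controlCost K m t₀ T α φ} with hS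
  have hcost0 : ∀ α φ : ℝ → H, 0 ≤ ∫ t in t₀..T, ‖α t‖ ^ 2 / 2 := fun α φ =>
    intervalIntegral.integral_nonneg hT fun s _ => by positivity
  have hne : S.Nonempty := by
    obtain ⟨φ, hφ⟩ := h.exists_state hF hT hφ₀ (α := fun _ => 0) (memLp_of_continuousOn (by fun_prop))
    exact ⟨_, _, φ, ⟨memLp_of_continuousOn (by fun_prop), hφ⟩, rfl⟩
  have hbdd : BddBelow S := by
    refine ⟨0, ?_⟩
    rintro c ⟨α, φ, -, rfl⟩
    have := hcost0 α φ
    unfold controlCost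
    positivity
  obtain ⟨c, -, hclim, hcS⟩ := exists_seq_tendsto_sInf hne hbdd
  choose α φ hαφ hc using hcS
  have hint : ∀ p : ℝ → H, ∫ t in t₀..T, ‖p t‖ ^ 2 / 2 = 1 / 2 * ∫ s in Icc t₀ T, ‖p s‖ ^ 2 := by
    intro p
    rw [intervalIntegral.integral_div, intervalIntegral.integral_of_le hT,
      integral_Icc_eq_integral_Ioc]
    ring
  obtain ⟨R, hR⟩ := hclim.bddAbove_range
  have hR' : ∀ j, ∫ s in Icc t₀ T, ‖α j s‖ ^ 2 ≤ 2 * R := by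
    intro j
    have h1 : c j ≤ R := hR (mem_range_self j)
    rw [hc j, controlCost, hint] at h1
    have : 0 ≤ K * ‖φ j T - m‖ ^ 2 := by positivity
    linarith
  obtain ⟨a, σ, ha, hσ, hw⟩ := exists_weak_subseq_memLp (fun j => (hαφ j).1) hR'
  obtain ⟨ψ, hψ⟩ := h.exists_state hF hT hφ₀ ha
  have hdu : ∀ t ∈ Icc t₀ T, Tendsto (fun j => duhamel e k (fun s => α (σ j) s - a s) t₀ t)
      atTop (𝓝 0) := by
    intro t ht
    have h1 := (h.tendsto_duhamel (fun j => (hαφ (σ j)).1) ha (fun j => hR' (σ j)) hw ht).sub_const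
      (duhamel e k a t₀ t)
    rw [sub_self] at h1
    refine h1.congr fun j => ?_
    rw [h.duhamel_sub ht.1 (((hαφ (σ j)).1.restrict_Ioc ht.2).integrable (by norm_num))
      ((ha.restrict_Ioc ht.2).integrable (by norm_num))]
  have hduc : ∀ j, ContinuousOn (fun t => ‖duhamel e k (fun s => α (σ j) s - a s) t₀ t‖)
      (Icc t₀ T) := fun j => (h.continuousOn_duhamel ((hαφ (σ j)).1.sub ha)).norm
  -- A constant dominating all the integrals, from `‖p‖ ≤ 1 + ‖p‖²` and the bound on the controls;
  -- dominated convergence then gives `hI`.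
  obtain ⟨Q, hQ⟩ : ∃ Q, ∀ j, ∀ t ∈ Icc t₀ T, ‖duhamel e k (fun s => α (σ j) s - a s) t₀ t‖ ≤ Q := by
    have hi : ∀ p : ℝ → H, MemLp p 2 (volume.restrict (Icc t₀ T)) → ∀ t ∈ Icc t₀ T,
        ‖duhamel e k p t₀ t‖ ≤ ∫ s in Icc t₀ T, (1 + ‖p s‖ ^ 2) := fun p hp t ht => by
      have hp1 : IntegrableOn p (Icc t₀ T) := hp.integrable (by norm_num)
      have hp2 : IntegrableOn (fun s => 1 + ‖p s‖ ^ 2) (Icc t₀ T) :=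
        (integrable_const _).add (hp.integrable_norm_pow (by norm_num))
      have hsub : Ioc t₀ t ⊆ Icc t₀ T := fun r hr => ⟨hr.1.le, hr.2.trans ht.2⟩
      refine (h.norm_duhamel_le ht.1 (hp1.mono_set hsub)).trans ?_
      rw [intervalIntegral.integral_of_le ht.1]
      refine (integral_mono (hp1.mono_set hsub).norm (hp2.mono_set hsub) fun s => ?_).trans
        (setIntegral_mono_set hp2 (Eventually.of_forall fun s => by positivity) hsub.eventuallyLE)
      simp only
      nlinarith [sq_nonneg (‖p s‖ - 1)]
    refine ⟨(∫ s in Icc t₀ T, (1 : ℝ)) + 2 * R + ∫ s in Icc t₀ T, (1 + ‖a s‖ ^ 2), fun j t ht => ?_⟩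
    rw [h.duhamel_sub ht.1 (((hαφ (σ j)).1.restrict_Ioc ht.2).integrable (by norm_num))
      ((ha.restrict_Ioc ht.2).integrable (by norm_num))]
    refine (norm_sub_le _ _).trans (add_le_add ((hi _ (hαφ (σ j)).1 t ht).trans ?_) (hi _ ha t ht))
    rw [integral_add (integrable_const _) ((hαφ (σ j)).1.integrable_norm_pow (by norm_num))]
    exact add_le_add le_rfl (hR' _)
  have hI : Tendsto (fun j => ∫ s in t₀..T, ‖duhamel e k (fun s => α (σ j) s - a s) t₀ s‖) atTop
      (𝓝 0) := by
    have := intervalIntegral.tendsto_integral_filter_of_dominated_convergence (μ := volume)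
      (a := t₀) (b := T) (l := atTop)
      (F := fun j s => ‖duhamel e k (fun s => α (σ j) s - a s) t₀ s‖) (f := fun _ => (0 : ℝ))
      (fun _ => Q) (Eventually.of_forall fun j => ?_) (Eventually.of_forall fun j => ?_) (by simp)
      (Eventually.of_forall fun s hs => ?_)
    · simpa using this
    · rw [uIoc_of_le hT]
      exact ((hduc j).mono Ioc_subset_Icc_self).aestronglyMeasurable measurableSet_Ioc
    · refine Eventually.of_forall fun s hs => ?_
      rw [uIoc_of_le hT] at hs
      rw [norm_norm]
      exact hQ j s (Ioc_subset_Icc_self hs)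
    · rw [uIoc_of_le hT] at hs
      simpa using (hdu s (Ioc_subset_Icc_self hs)).norm
  have hTT : T ∈ Icc t₀ T := right_mem_Icc.2 hT
  have hφlim : Tendsto (fun j => φ (σ j) T) atTop (𝓝 (ψ T)) := by
    rw [tendsto_iff_norm_sub_tendsto_zero]
    refine squeeze_zero (fun j => norm_nonneg _) (fun j =>
      norm_state_sub_le h hF ha (hαφ (σ j)).1 hψ (hαφ (σ j)).2 hTT) ?_
    simpa using (hdu T hTT).norm.add ((hI.const_mul _).const_mul L)
  have hle : controlCost K m t₀ T a ψ ≤ sInf S := by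
    -- Weak lower semicontinuity: `‖α‖² / 2 ≥ ⟨a, α⟩ - ‖a‖² / 2`, and the right-hand side is weakly
    -- continuous in `α`. The terminal cost converges because the states do.
    have h1 : Tendsto (fun j => (∫ s in Icc t₀ T, inner ℝ (a s) (α (σ j) s)) -
        1 / 2 * (∫ s in Icc t₀ T, ‖a s‖ ^ 2) + K * ‖φ (σ j) T - m‖ ^ 2) atTop
        (𝓝 ((∫ s in Icc t₀ T, inner ℝ (a s) (a s)) -
          1 / 2 * (∫ s in Icc t₀ T, ‖a s‖ ^ 2) + K * ‖ψ T - m‖ ^ 2)) :=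
      ((hw a ha).sub_const _).add (((hφlim.sub_const m).norm.pow 2).const_mul K)
    have h2 : controlCost K m t₀ T a ψ = (∫ s in Icc t₀ T, inner ℝ (a s) (a s)) -
          1 / 2 * (∫ s in Icc t₀ T, ‖a s‖ ^ 2) + K * ‖ψ T - m‖ ^ 2 := by
      rw [controlCost, hint]
      simp only [real_inner_self_eq_norm_sq]
      ring
    rw [h2]
    refine le_of_tendsto_of_tendsto' h1 (hclim.comp hσ.tendsto_atTop) fun j => ?_
    simp only [Function.comp]
    rw [hc, controlCost, hint]
    have h3 : (∫ s in Icc t₀ T, inner ℝ (a s) (α (σ j) s)) ≤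
        ∫ s in Icc t₀ T, (1 / 2 * ‖a s‖ ^ 2 + 1 / 2 * ‖α (σ j) s‖ ^ 2) := by
      refine integral_mono (integrable_inner_of_memLp ha (hαφ (σ j)).1)
        (((ha.integrable_norm_pow (by norm_num)).const_mul _).add
          (((hαφ (σ j)).1.integrable_norm_pow (by norm_num)).const_mul _)) fun s => ?_
      have := real_inner_le_norm (a s) (α (σ j) s)
      simp only
      nlinarith [sq_nonneg (‖a s‖ - ‖α (σ j) s‖)]
    rw [integral_add ((ha.integrable_norm_pow (by norm_num)).const_mul _)
      (((hαφ (σ j)).1.integrable_norm_pow (by norm_num)).const_mul _), integral_const_mul,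
      integral_const_mul] at h3
    linarith
  exact ⟨a, ψ, ha, hψ, fun α' φ' h1 h2 => hle.trans (csInf_le hbdd ⟨α', φ', ⟨h1, h2⟩, rfl⟩)⟩

end IsSpectral

end Control

end GinzburgLandau

namespace GinzburgLandau

open Filter Topology

/-! ### First order condition and uniform regularity of optimal pairs. -/

section Optimality

variable {H : Type*} [NormedAddCommGroup H] [InnerProductSpace ℝ H] [CompleteSpace H]
  {e : ℕ → H} {k w : ℕ → ℝ} {F : H → H} {DF : H → H → H} {L : ℝ}

namespace IsSpectral

variable (h : IsSpectral e k) (hF : IsNonlinearity e k F DF L)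
include h hF

omit h [CompleteSpace H] in
theorem continuousOn_deriv {t₀ T : ℝ} {φ l : ℝ → H} (hφ : ContinuousOn φ (Icc t₀ T))
    (hl : ContinuousOn l (Icc t₀ T)) : ContinuousOn (fun s => DF (φ s) (l s)) (Icc t₀ T) :=
  hF.deriv_cont.comp_continuousOn (hφ.prodMk hl)

theorem exists_dual {t₀ T : ℝ} (hT : t₀ ≤ T) {φ : ℝ → H} (hφ : ContinuousOn φ (Icc t₀ T))
    {f : H} {B : ℝ} (hf : SumLe e k f B) :
    ∃ l : ℝ → H, ContinuousOn l (Icc t₀ T) ∧ l T = f ∧ ∀ t ∈ Icc t₀ T,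
      l t = sg e k (T - t) f + duhamelBack e k (fun s => DF (φ s) (l s)) t T := by
  obtain ⟨l, hl, hl2⟩ := h.exists_mild_back hT hF.nonneg hf (G := fun s x => DF (φ s) x)
    (fun l hl => continuousOn_deriv hF hφ hl) (fun s _ x y => by
      rw [← hF.deriv_sub]; exact hF.deriv_bound _ _)
  refine ⟨l, hl, ?_, hl2⟩
  rw [hl2 T (right_mem_Icc.2 hT), sub_self, h.sg_zero]
  simp [duhamelBack]

/-- The first order optimality condition: an optimal control is the negative of the dual state. -/
theorem optimal_eq_neg_dual {t₀ T K : ℝ} (hT : t₀ ≤ T) (hK : 0 < K) {m : H} {φ₀ : H} {B : ℝ}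
    (hφ₀ : SumLe e k φ₀ B) {α φ l : ℝ → H} (hα : MemLp α 2 (volume.restrict (Icc t₀ T)))
    (hφ : IsState e k F t₀ T φ₀ α φ)
    (hopt : ∀ α' φ' : ℝ → H, MemLp α' 2 (volume.restrict (Icc t₀ T)) →
      IsState e k F t₀ T φ₀ α' φ' → controlCost K m t₀ T α φ ≤ controlCost K m t₀ T α' φ')
    (hl : ContinuousOn l (Icc t₀ T)) {B' : ℝ} (hlB : ∀ t ∈ Icc t₀ T, SumLe e k (l t) B')
    (hl2 : ∀ t ∈ Icc t₀ T, l t = sg e k (T - t) ((2 * K) • (φ T - m)) +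
      duhamelBack e k (fun s => DF (φ s) (l s)) t T) :
    ∀ᵐ s ∂volume.restrict (Icc t₀ T), α s = -l s := by
  have hTT : T ∈ Icc t₀ T := right_mem_Icc.2 hT
  have hlm : MemLp l 2 (volume.restrict (Icc t₀ T)) := memLp_of_continuousOn hl
  -- `β` is the gradient of the cost at `α`; the competitor is a gradient step `α - ε β`.
  set β : ℝ → H := fun s => α s + l s with hβdef
  have hβ : MemLp β 2 (volume.restrict (Icc t₀ T)) := hα.add hlm
  obtain ⟨R, hR0, hR⟩ := hF.taylor B'
  have hduβ : ContinuousOn (fun t => duhamel e k β t₀ t) (Icc t₀ T) := h.continuousOn_duhamel hβ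
  -- The stability estimate `norm_state_sub_le` is homogeneous in the difference of the controls, so
  -- the step `-ε β` moves the state by at most `ε * Q`.
  obtain ⟨Q, hQ⟩ : ∃ Q, ∀ t ∈ Icc t₀ T, ‖duhamel e k β t₀ t‖ +
      L * (Real.exp (L * (T - t₀)) * ∫ s in t₀..T, ‖duhamel e k β t₀ s‖) ≤ Q := by
    obtain ⟨Q, hQ⟩ := isCompact_Icc.exists_bound_of_continuousOn hduβ
    exact ⟨_, fun t ht => add_le_add (hQ t ht) le_rfl⟩
  have hii : ∀ {p q : ℝ → H}, MemLp p 2 (volume.restrict (Icc t₀ T)) →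
      MemLp q 2 (volume.restrict (Icc t₀ T)) →
      IntervalIntegrable (fun s => inner ℝ (p s) (q s)) volume t₀ T := fun hp hq => by
    rw [intervalIntegrable_iff_integrableOn_Icc_of_le hT]
    exact integrable_inner_of_memLp hp hq
  set N := ∫ s in t₀..T, inner ℝ (β s) (β s) with hN
  -- Optimality says that the decrease `ε N` is paid for by second order terms: half of `N` from the
  -- control cost, the term with `R` from the Taylor remainder along the trajectory, and `K * Q ^ 2`
  -- from the terminal cost.
  have key : ∀ ε : ℝ, 0 < ε → N ≤ ε * (1 / 2 * N + (T - t₀) * (R * Q ^ 2) + K * Q ^ 2) := by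
    intro ε hε
    have hα' : MemLp (fun s => α s - ε • β s) 2 (volume.restrict (Icc t₀ T)) :=
      hα.sub (hβ.const_smul ε)
    obtain ⟨φ', hφ'⟩ := h.exists_state hF hT hφ₀ hα'
    set d : ℝ → H := fun s => φ' s - φ s with hd
    have hdm : MemLp d 2 (volume.restrict (Icc t₀ T)) := memLp_of_continuousOn (hφ'.1.sub hφ.1)
    have hdn : ∀ t ∈ Icc t₀ T, ‖d t‖ ≤ ε * Q := by
      intro t ht
      have h1 := norm_state_sub_le h hF hα hα' hφ hφ' ht
      have h2 : ∀ s ∈ Icc t₀ T, ‖duhamel e k (fun s => α s - ε • β s - α s) t₀ s‖ =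
          ε * ‖duhamel e k β t₀ s‖ := by
        intro s hs
        have : duhamel e k (fun s => α s - ε • β s - α s) t₀ s = (-ε) • duhamel e k β t₀ s := by
          rw [duhamel, duhamel, ← intervalIntegral.integral_smul]
          refine intervalIntegral.integral_congr fun r hr => ?_
          rw [uIcc_of_le hs.1] at hr
          simp only [sub_sub_cancel_left]
          rw [← neg_smul, h.sg_smul (sub_nonneg.2 hr.2)]
        rw [this, norm_smul, norm_neg, Real.norm_of_nonneg hε.le]
      rw [h2 t ht, intervalIntegral.integral_congr (g := fun s => ε * ‖duhamel e k β t₀ s‖)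
        (fun s hs => h2 s (by rwa [uIcc_of_le hT] at hs)),
        intervalIntegral.integral_const_mul] at h1
      refine h1.trans ?_
      rw [show ε * ‖duhamel e k β t₀ t‖ + L * (Real.exp (L * (T - t₀)) *
          (ε * ∫ s in t₀..T, ‖duhamel e k β t₀ s‖)) = ε * (‖duhamel e k β t₀ t‖ +
          L * (Real.exp (L * (T - t₀)) * ∫ s in t₀..T, ‖duhamel e k β t₀ s‖)) by ring]
      exact mul_le_mul_of_nonneg_left (hQ t ht) hε.le
    set g : ℝ → H := fun s => F (φ' s) + (α s - ε • β s) - (F (φ s) + α s) with hg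
    have hgm : MemLp g 2 (volume.restrict (Icc t₀ T)) :=
      (memLp_source hF hφ'.1 hα').sub (memLp_source hF hφ.1 hα)
    have hdg : ∀ t ∈ Icc t₀ T, duhamel e k g t₀ t = d t := fun t ht =>
      (state_sub h hF hα hα' hφ hφ' ht).symm
    have hqc := continuousOn_deriv hF hφ.1 hl
    -- The increment `d` of the state is itself the Duhamel integral of `g`, so duality turns its
    -- terminal pairing into a time integral.
    have hdual := h.inner_duhamel_eq hT hqc hgm hl2 hl
    rw [hdg T hTT, intervalIntegral.integral_congr
      (f := fun s => inner ℝ (DF (φ s) (l s)) (duhamel e k g t₀ s))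
      (g := fun s => inner ℝ (DF (φ s) (l s)) (d s)) (fun s hs => by
        rw [uIcc_of_le hT] at hs; simp only [hdg s hs]),
      ← intervalIntegral.integral_sub (hii hlm hgm) (hii (memLp_of_continuousOn hqc) hdm)] at hdual
    have hrem : inner ℝ ((2 * K) • (φ T - m)) (d T) ≤
        (T - t₀) * (R * (ε * Q) ^ 2) - ε * ∫ s in t₀..T, inner ℝ (l s) (β s) := by
      rw [hdual, ← intervalIntegral.integral_const_mul]
      have h1 : (T - t₀) * (R * (ε * Q) ^ 2) = ∫ _ in t₀..T, R * (ε * Q) ^ 2 := by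
        simp; ring
      rw [h1, ← intervalIntegral.integral_sub (by simp) ((hii hlm hβ).const_mul ε)]
      refine intervalIntegral.integral_mono_on hT
        ((hii hlm hgm).sub (hii (memLp_of_continuousOn hqc) hdm))
        (IntervalIntegrable.sub (by simp) ((hii hlm hβ).const_mul ε)) fun s hs => ?_
      -- By symmetry of `DF` the dual source cancels the linear part of the increment of `F`; the
      -- Taylor remainder and `-ε ⟨l, β⟩` remain.
      have h2 := (abs_le.1 (hR _ (hlB s hs) (φ s) (d s))).2
      have h3 : φ s + d s = φ' s := add_sub_cancel _ _
      rw [h3, inner_sub_right, inner_sub_right, ← hF.deriv_symm] at h2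
      have h4 : R * ‖d s‖ ^ 2 ≤ R * (ε * Q) ^ 2 := by gcongr; exact hdn s hs
      simp only [hg, inner_sub_right, inner_add_right, inner_smul_right]
      linarith
    have hJ := hopt _ φ' hα' hφ'
    have hns : ‖φ' T - m‖ ^ 2 = ‖φ T - m‖ ^ 2 + 2 * inner ℝ (φ T - m) (d T) + ‖d T‖ ^ 2 := by
      rw [← norm_add_sq_real]; congr 2; simp only [hd]; abel
    have hi1 : ∫ t in t₀..T, ‖α t - ε • β t‖ ^ 2 / 2 = (∫ t in t₀..T, ‖α t‖ ^ 2 / 2) -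
        ε * (∫ s in t₀..T, inner ℝ (α s) (β s)) + ε ^ 2 / 2 * N := by
      have ha2 : IntervalIntegrable (fun t => ‖α t‖ ^ 2 / 2) volume t₀ T := by
        simpa only [real_inner_self_eq_norm_sq] using (hii hα hα).div_const 2
      rw [hN, ← intervalIntegral.integral_const_mul, ← intervalIntegral.integral_const_mul,
        ← intervalIntegral.integral_sub ha2 ((hii hα hβ).const_mul ε),
        ← intervalIntegral.integral_add (ha2.sub ((hii hα hβ).const_mul ε))
          ((hii hβ hβ).const_mul _)]
      congr 1; ext s
      rw [norm_sub_sq_real, inner_smul_right, norm_smul, mul_pow, Real.norm_eq_abs, sq_abs,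
        real_inner_self_eq_norm_sq]
      ring
    have hsum : N = (∫ s in t₀..T, inner ℝ (α s) (β s)) + ∫ s in t₀..T, inner ℝ (l s) (β s) := by
      rw [hN, ← intervalIntegral.integral_add (hii hα hβ) (hii hlm hβ)]
      congr 1; ext s; rw [← inner_add_left]
    rw [controlCost, controlCost, hns, hi1] at hJ
    rw [inner_smul_left] at hrem
    simp only [RCLike.conj_to_real] at hrem
    have hdT : K * ‖d T‖ ^ 2 ≤ K * (ε * Q) ^ 2 := by
      gcongr; exact hdn T hTT
    have h5 : ε * N ≤ ε * (ε * (1 / 2 * N + (T - t₀) * (R * Q ^ 2) + K * Q ^ 2)) := by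
      rw [mul_pow] at hdT hrem
      rw [hsum] at hJ ⊢
      linarith
    exact le_of_mul_le_mul_left h5 hε
  have hN0 : N ≤ 0 := by
    have : Tendsto (fun ε : ℝ => ε * (1 / 2 * N + (T - t₀) * (R * Q ^ 2) + K * Q ^ 2)) (𝓝[>] 0)
        (𝓝 0) := by
      have h1 : Continuous fun ε : ℝ =>
        ε * (1 / 2 * N + (T - t₀) * (R * Q ^ 2) + K * Q ^ 2) := by fun_prop
      simpa using (h1.tendsto 0).mono_left nhdsWithin_le_nhds
    exact ge_of_tendsto this (eventually_nhdsWithin_of_forall fun ε hε => key ε hε)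
  have hN1 : N = ∫ s in Icc t₀ T, ‖β s‖ ^ 2 := by
    rw [hN, intervalIntegral.integral_of_le hT, integral_Icc_eq_integral_Ioc]
    simp only [real_inner_self_eq_norm_sq]
  have hz := (integral_eq_zero_iff_of_nonneg (fun s => by positivity)
    (hβ.integrable_norm_pow (by norm_num))).1 (le_antisymm (hN1 ▸ hN0)
      (integral_nonneg fun s => by positivity))
  filter_upwards [hz] with s hs
  have : β s = 0 := by simpa using hs
  exact eq_neg_of_add_eq_zero_left this

theorem norm_state_le {t₀ T t : ℝ} {φ₀ : H} {α φ : ℝ → H}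
    (hα : MemLp α 2 (volume.restrict (Icc t₀ T))) (hφ : IsState e k F t₀ T φ₀ α φ)
    (ht : t ∈ Icc t₀ T) : ‖φ t‖ ≤ ‖φ₀‖ + ∫ s in t₀..t, (L + ‖α s‖) := by
  rw [hφ.2 t ht]
  have hs := ((memLp_source hF hφ.1 hα).restrict_Ioc ht.2).integrable (by norm_num)
  have ha : IntegrableOn α (Ioc t₀ t) := (hα.restrict_Ioc ht.2).integrable (by norm_num)
  refine (norm_add_le _ _).trans (add_le_add (h.norm_sg_le (sub_nonneg.2 ht.1) _) ?_)
  refine (h.norm_duhamel_le ht.1 hs).trans ?_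
  refine intervalIntegral.integral_mono_on ht.1 ?_ ?_ fun s _ =>
    (norm_add_le _ _).trans (add_le_add (hF.bound _) le_rfl)
  · rw [intervalIntegrable_iff_integrableOn_Ioc_of_le ht.1]; exact hs.norm
  · rw [intervalIntegrable_iff_integrableOn_Ioc_of_le ht.1]
    exact (integrable_const L).add ha.norm

/-- Optimal controls with regular states and dual states. -/
theorem exists_optimal_regular [TopologicalSpace.SeparableSpace H] {T K : ℝ}
    (hK : 0 < K) {m : H} {Bm : ℝ} (hm : SumLe e k m Bm) (hm2 : SumLe e (fun n => k n ^ 2) m Bm)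
    (C : ℝ) :
    ∃ D, 0 ≤ D ∧ ∀ (φ₀ : H) (t₀ : ℝ), ‖φ₀‖ ≤ C → SumLe e k φ₀ C → 0 ≤ t₀ → t₀ ≤ T →
      ∃ α φ l : ℝ → H, MemLp α 2 (volume.restrict (Icc t₀ T)) ∧ IsState e k F t₀ T φ₀ α φ ∧
        (∀ α' φ' : ℝ → H, MemLp α' 2 (volume.restrict (Icc t₀ T)) →
          IsState e k F t₀ T φ₀ α' φ' → controlCost K m t₀ T α φ ≤ controlCost K m t₀ T α' φ') ∧
        ContinuousOn l (Icc t₀ T) ∧ l T = (2 * K) • (φ T - m) ∧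
        (∀ t ∈ Icc t₀ T, l t = sg e k (T - t) (l T) +
          duhamelBack e k (fun s => DF (φ s) (l s)) t T) ∧
        (∀ t ∈ Icc t₀ T, SumLe e k (φ t) D ∧ SumLe e k (l t) D) ∧
        (∀ t ∈ Icc t₀ T, ∀ E, SumLe e (fun n => k n ^ 2) (sg e k (t - t₀) φ₀) E →
          SumLe e (fun n => k n ^ 2) (φ t) (D * (1 + E))) ∧
        (∀ t ∈ Icc t₀ T, ∀ E, SumLe e (fun n => k n ^ 2) (sg e k (T - t₀) φ₀) E →
          SumLe e (fun n => k n ^ 2) (l t) (D * (1 + E))) := by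
  set J := K * (C + T * L + ‖m‖) ^ 2 with hJ
  set D₁ := 2 * C + 2 * (1 / 2 * (T * (2 * L ^ 2) + 4 * J)) with hD₁
  set D₂ := (2 * K) ^ 2 * (2 * D₁ + 2 * Bm) with hD₂
  set D₃ := 2 * D₂ + 2 * (1 / 2 * (L ^ 2 * (2 * J))) with hD₃
  obtain ⟨M₁, hM₁⟩ := hF.form D₁
  obtain ⟨M₂, hM₂⟩ := hF.deriv_form (max D₁ D₃)
  set M₃ := 2 * M₁ + 2 * D₃ with hM₃
  set D₄ := (2 * K) ^ 2 * (2 * (2 + |T * M₃|) + 2 * |Bm|) with hD₄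
  have hk : ∀ n, 0 ≤ k n := fun n => (h.pos n).le
  have hk2 : ∀ n, 0 ≤ k n ^ 2 := fun n => sq_nonneg _
  have hD₄0 : 0 ≤ D₄ := by positivity
  clear_value D₄ M₃ D₃ D₂ D₁ J
  refine ⟨|D₁| + |D₃| + (2 + |T * M₃|) + (2 * D₄ + |T * M₂|), by positivity,
    fun φ₀ t₀ hφC hφ₀ ht₀ hT => ?_⟩
  have hTT : T ∈ Icc t₀ T := right_mem_Icc.2 hT
  have hL := hF.nonneg
  have hTt : T - t₀ ≤ T := by linarith
  have hT0 : 0 ≤ T := ht₀.trans hT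
  have hC0 : 0 ≤ C := hφ₀.nonneg
  obtain ⟨α, φ, hα, hφ, hopt⟩ := h.exists_optimal hF hT hK m hφ₀
  have hn2 : IntervalIntegrable (fun s => ‖α s‖ ^ 2) volume t₀ T := by
    rw [intervalIntegrable_iff_integrableOn_Icc_of_le hT]
    exact hα.integrable_norm_pow (by norm_num)
  have hαJ : ∫ s in t₀..T, ‖α s‖ ^ 2 ≤ 2 * J := by
    have h0 : MemLp (fun _ => (0 : H)) 2 (volume.restrict (Icc t₀ T)) :=
      memLp_of_continuousOn (by fun_prop)
    obtain ⟨φ', hφ'⟩ := h.exists_state hF hT hφ₀ h0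
    have h1 := hopt _ φ' h0 hφ'
    have h2 := norm_state_le h hF h0 hφ' hTT
    simp only [norm_zero, add_zero, intervalIntegral.integral_const, smul_eq_mul] at h2
    rw [controlCost, controlCost, intervalIntegral.integral_div] at h1
    simp only [norm_zero, ne_eq, OfNat.ofNat_ne_zero, not_false_eq_true, zero_pow, zero_div,
      intervalIntegral.integral_zero, zero_add] at h1
    have h3 : ‖φ' T - m‖ ≤ C + T * L + ‖m‖ := by
      refine (norm_sub_le _ _).trans (add_le_add (h2.trans (add_le_add hφC ?_)) le_rfl)
      gcongr
    have h4 : K * ‖φ' T - m‖ ^ 2 ≤ J := by rw [hJ]; gcongr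
    have h5 : 0 ≤ K * ‖φ T - m‖ ^ 2 := by positivity
    linarith
  have hφ1 : ∀ t ∈ Icc t₀ T, SumLe e k (φ t) D₁ := by
    intro t ht
    rw [hφ.2 t ht]
    have hsrc := memLp_source hF hφ.1 hα
    refine ((h.sg_sumLe (sub_nonneg.2 ht.1) hk hφ₀).add hk
      (h.duhamel_sumLe ht.1 (hsrc.restrict_Ioc ht.2))).mono ?_
    rw [hD₁]
    gcongr
    have hsi : IntervalIntegrable (fun s => ‖F (φ s) + α s‖ ^ 2) volume t₀ T := by
      rw [intervalIntegrable_iff_integrableOn_Icc_of_le hT]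
      exact hsrc.integrable_norm_pow (by norm_num)
    calc ∫ s in t₀..t, ‖F (φ s) + α s‖ ^ 2 ≤ ∫ s in t₀..T, ‖F (φ s) + α s‖ ^ 2 :=
          intervalIntegral.integral_mono_interval le_rfl ht.1 ht.2
            (Eventually.of_forall fun s => by positivity) hsi
      _ ≤ ∫ s in t₀..T, (2 * L ^ 2 + 2 * ‖α s‖ ^ 2) := by
          refine intervalIntegral.integral_mono_on hT hsi
            (IntervalIntegrable.add (by simp) (hn2.const_mul 2)) fun s _ => ?_
          have h1 : ‖F (φ s) + α s‖ ≤ L + ‖α s‖ :=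
            (norm_add_le _ _).trans (add_le_add (hF.bound _) le_rfl)
          nlinarith [sq_nonneg (L - ‖α s‖), norm_nonneg (F (φ s) + α s)]
      _ = (T - t₀) * (2 * L ^ 2) + 2 * ∫ s in t₀..T, ‖α s‖ ^ 2 := by
          rw [intervalIntegral.integral_add (by simp) (hn2.const_mul 2),
            intervalIntegral.integral_const_mul]
          simp; ring
      _ ≤ T * (2 * L ^ 2) + 4 * J := by
          have : (T - t₀) * (2 * L ^ 2) ≤ T * (2 * L ^ 2) := by gcongr
          linarith
  have hlT : SumLe e k ((2 * K) • (φ T - m)) D₂ := by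
    rw [hD₂]; exact ((hφ1 T hTT).sub hk hm).smul _
  obtain ⟨l, hl, hlT', hl2⟩ := h.exists_dual hF hT hφ.1 hlT
  have hqc := continuousOn_deriv hF hφ.1 hl
  -- The form bound supplied here still depends on `l`. It suffices for the optimality condition,
  -- which in turn yields the uniform bound `D₃`.
  have hαl := optimal_eq_neg_dual h hF hT hK hφ₀ hα hφ hopt hl (B' := 2 * D₂ + 2 *
      (1 / 2 * ∫ s in t₀..T, ‖DF (φ s) (l s)‖ ^ 2)) (fun t ht => by
    rw [hl2 t ht]
    exact (h.sg_sumLe (sub_nonneg.2 ht.2) hk hlT).add hk (h.duhamelBack_sumLe ht hqc)) hl2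
  have hl1 : ∀ t ∈ Icc t₀ T, SumLe e k (l t) D₃ := by
    intro t ht
    rw [hl2 t ht]
    refine ((h.sg_sumLe (sub_nonneg.2 ht.2) hk hlT).add hk (h.duhamelBack_sumLe ht hqc)).mono ?_
    rw [hD₃]
    gcongr
    -- As `l = -α` a.e., the energy bound on the control controls the dual source, and no Gronwall
    -- argument for `l` is needed.
    calc ∫ s in t₀..T, ‖DF (φ s) (l s)‖ ^ 2 ≤ ∫ s in t₀..T, L ^ 2 * ‖α s‖ ^ 2 := by
          refine intervalIntegral.integral_mono_ae_restrict hT ?_ (hn2.const_mul _) ?_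
          · refine ContinuousOn.intervalIntegrable ?_
            rw [uIcc_of_le hT]
            exact hqc.norm.pow 2
          · filter_upwards [hαl] with s hs
            rw [hs, norm_neg, ← mul_pow]
            gcongr
            exact hF.deriv_bound _ _
      _ ≤ L ^ 2 * (2 * J) := by
          rw [intervalIntegral.integral_const_mul]; gcongr
  have hD₁0 : 0 ≤ D₁ := (hφ1 T hTT).nonneg
  have hD₃0 : 0 ≤ D₃ := (hl1 T hTT).nonneg
  have hM₃0 : 0 ≤ M₃ := by
    have := (hM₁ _ (hφ1 T hTT)).nonneg
    rw [hM₃]; positivity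
  have hφ2 : ∀ t ∈ Icc t₀ T, ∀ E, SumLe e (fun n => k n ^ 2) (sg e k (t - t₀) φ₀) E →
      SumLe e (fun n => k n ^ 2) (φ t) ((2 + |T * M₃|) * (1 + E)) := by
    intro t ht E hE
    have hE0 := hE.nonneg
    rw [hφ.2 t ht]
    refine (hE.add hk2 (h.duhamel_sumLe_sq ht.1 ((memLp_source hF hφ.1 hα).restrict_Ioc ht.2)
      (M := M₃) ?_)).mono ?_
    · have hsub : Ioc t₀ t ⊆ Icc t₀ T := fun r hr => ⟨hr.1.le, hr.2.trans ht.2⟩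
      filter_upwards [ae_restrict_of_ae_restrict_of_subset hsub hαl,
        ae_restrict_mem measurableSet_Ioc] with s hs hs2
      -- The optimality condition replaces the merely square integrable control by `-l`, so the
      -- source `F(φ) - l` is bounded in the form domain.
      rw [hs, hM₃]
      exact (hM₁ _ (hφ1 s (hsub hs2))).add hk (hl1 s (hsub hs2)).neg
    · have h1 : (t - t₀) * M₃ ≤ |T * M₃| := by
        refine le_trans ?_ (le_abs_self _)
        have : t - t₀ ≤ T := by linarith [ht.2]
        gcongr
      have h2 := mul_nonneg (abs_nonneg (T * M₃)) hE0
      linarith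
  have hl2' : ∀ t ∈ Icc t₀ T, ∀ E, SumLe e (fun n => k n ^ 2) (sg e k (T - t₀) φ₀) E →
      SumLe e (fun n => k n ^ 2) (l t) ((2 * D₄ + |T * M₂|) * (1 + E)) := by
    intro t ht E hE
    have hE0 := hE.nonneg
    rw [hl2 t ht]
    -- The singularity of `l` sits in its terminal value and is that of `φ` at time `T`, hence the
    -- same `E` serves every `t`. The regularity of the target `m` is needed here.
    have h1 : SumLe e (fun n => k n ^ 2) ((2 * K) • (φ T - m)) (D₄ * (1 + E)) := by
      refine (((hφ2 T hTT E hE).sub hk2 hm2).smul (2 * K)).mono ?_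
      rw [hD₄, mul_assoc]
      refine mul_le_mul_of_nonneg_left ?_ (sq_nonneg _)
      have h2 := mul_nonneg (abs_nonneg Bm) hE0
      linarith [le_abs_self Bm]
    refine ((h.sg_sumLe (sub_nonneg.2 ht.2) hk2 h1).add hk2
      (h.duhamelBack_sumLe_sq ht hqc (M := M₂) fun s hs => hM₂ _ _
        ((hφ1 s hs).mono (le_max_left _ _)) ((hl1 s hs).mono (le_max_right _ _)))).mono ?_
    have hM₂0 : 0 ≤ M₂ := (hM₂ _ _ ((hφ1 T hTT).mono (le_max_left _ _))
      ((hl1 T hTT).mono (le_max_right _ _))).nonneg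
    have h2 : (T - t₀) * M₂ ≤ |T * M₂| := by
      refine le_trans ?_ (le_abs_self _)
      gcongr
    have h3 := mul_nonneg (abs_nonneg (T * M₂)) hE0
    linarith
  have ha1 := le_abs_self D₁
  have ha3 := le_abs_self D₃
  have hp3 := abs_nonneg (T * M₃)
  have hp2 := abs_nonneg (T * M₂)
  refine ⟨α, φ, l, hα, hφ, hopt, hl, hlT', by rwa [hlT'], fun t ht =>
    ⟨(hφ1 t ht).mono (by linarith [abs_nonneg D₃]), (hl1 t ht).mono (by linarith [abs_nonneg D₁])⟩,
    fun t ht E hE => (hφ2 t ht E hE).mono ?_, fun t ht E hE => (hl2' t ht E hE).mono ?_⟩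
  · have := hE.nonneg
    refine mul_le_mul_of_nonneg_right ?_ (by linarith)
    linarith [abs_nonneg D₁, abs_nonneg D₃]
  · have := hE.nonneg
    refine mul_le_mul_of_nonneg_right ?_ (by linarith)
    linarith [abs_nonneg D₁, abs_nonneg D₃]

end IsSpectral

end Optimality

end GinzburgLandau

namespace GinzburgLandau

open Filter Topology

/-! ### Sines and cosines in `L²(0,1)`; completeness of the sines. -/

section Basis

theorem memLp_of_bound {u : ℝ → ℝ} (hu : AEStronglyMeasurable u spaceMeasure) {C : ℝ}
    (hC : ∀ x ∈ Ioo (0 : ℝ) 1, |u x| ≤ C) : MemLp u 2 spaceMeasure :=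
  MemLp.of_bound hu C ((ae_restrict_iff' measurableSet_Ioo).2 (Eventually.of_forall hC))

theorem memLp_of_continuous {u : ℝ → ℝ} (hu : Continuous u) : MemLp u 2 spaceMeasure := by
  obtain ⟨C, hC⟩ := isCompact_Icc.exists_bound_of_continuousOn (hu.continuousOn (s := Icc 0 1))
  exact memLp_of_bound hu.aestronglyMeasurable fun x hx => hC x (Ioo_subset_Icc_self hx)

theorem inner_L2_eq (f g : L2) : inner ℝ f g = ∫ x, f x * g x ∂spaceMeasure := by
  rw [L2.inner_def]
  refine integral_congr_ae (Eventually.of_forall fun x => ?_)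
  simp [mul_comm]

theorem inner_toL2_left {u : ℝ → ℝ} (hu : MemLp u 2 spaceMeasure) (f : L2) :
    inner ℝ (toL2 u) f = ∫ x, u x * f x ∂spaceMeasure := by
  rw [inner_L2_eq]
  refine integral_congr_ae ?_
  filter_upwards [toL2_coe_ae hu] with x hx
  rw [hx]

theorem inner_toL2_right {u : ℝ → ℝ} (hu : MemLp u 2 spaceMeasure) (f : L2) :
    inner ℝ f (toL2 u) = ∫ x, f x * u x ∂spaceMeasure := by
  rw [real_inner_comm, inner_toL2_left hu]
  simp only [mul_comm]

theorem toL2_congr {u v : ℝ → ℝ} (hu : MemLp u 2 spaceMeasure) (h : u =ᵐ[spaceMeasure] v) :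
    toL2 u = toL2 v := by
  have hv : MemLp v 2 spaceMeasure := (memLp_congr_ae h).1 hu
  refine Lp.ext ?_
  filter_upwards [toL2_coe_ae hu, toL2_coe_ae hv, h] with x h1 h2 h3
  rw [h1, h2, h3]

theorem toL2_add {u v : ℝ → ℝ} (hu : MemLp u 2 spaceMeasure) (hv : MemLp v 2 spaceMeasure) :
    toL2 (fun x => u x + v x) = toL2 u + toL2 v := by
  refine Lp.ext ?_
  filter_upwards [toL2_coe_ae hu, toL2_coe_ae hv, toL2_coe_ae (hu.add hv),
    Lp.coeFn_add (toL2 u) (toL2 v)] with x h1 h2 h3 h4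
  exact h3.trans (by rw [h4, Pi.add_apply, Pi.add_apply, h1, h2])

theorem toL2_smul {u : ℝ → ℝ} (c : ℝ) (hu : MemLp u 2 spaceMeasure) :
    toL2 (fun x => c * u x) = c • toL2 u := by
  refine Lp.ext ?_
  filter_upwards [toL2_coe_ae hu, toL2_coe_ae (hu.const_mul c),
    Lp.coeFn_smul c (toL2 u)] with x h1 h3 h4
  exact h3.trans (by rw [h4, Pi.smul_apply, h1, smul_eq_mul])

theorem toL2_sub {u v : ℝ → ℝ} (hu : MemLp u 2 spaceMeasure) (hv : MemLp v 2 spaceMeasure) :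
    toL2 (fun x => u x - v x) = toL2 u - toL2 v := by
  refine Lp.ext ?_
  filter_upwards [toL2_coe_ae hu, toL2_coe_ae hv, toL2_coe_ae (hu.sub hv),
    Lp.coeFn_sub (toL2 u) (toL2 v)] with x h1 h2 h3 h4
  exact h3.trans (by rw [h4, Pi.sub_apply, Pi.sub_apply, h1, h2])

/-- The frequency `(n+1) π`. -/
noncomputable def freq (n : ℕ) : ℝ := ((n : ℝ) + 1) * Real.pi

theorem one_le_freq (n : ℕ) : 1 ≤ freq n := by
  unfold freq
  have := Real.pi_gt_three
  have : (0 : ℝ) ≤ n := n.cast_nonneg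
  nlinarith

theorem freq_pos (n : ℕ) : 0 < freq n := zero_lt_one.trans_le (one_le_freq n)

theorem eigenvalue_eq (δ : ℝ) (n : ℕ) : eigenvalue δ n = δ * freq n ^ 2 := by
  unfold eigenvalue freq; ring

/-- The function `√2 cos ((n+1) π x)`. -/
noncomputable def cosfun (n : ℕ) : L2 := toL2 fun x => Real.sqrt 2 * Real.cos (freq n * x)

theorem memLp_sin (n : ℕ) :
    MemLp (fun x => Real.sqrt 2 * Real.sin (freq n * x)) 2 spaceMeasure :=
  memLp_of_continuous (by fun_prop)

theorem memLp_cos (n : ℕ) :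
    MemLp (fun x => Real.sqrt 2 * Real.cos (freq n * x)) 2 spaceMeasure :=
  memLp_of_continuous (by fun_prop)

theorem eigenfun_eq (n : ℕ) : eigenfun n = toL2 fun x => Real.sqrt 2 * Real.sin (freq n * x) :=
  rfl

theorem integral_space_eq (u : ℝ → ℝ) : ∫ x, u x ∂spaceMeasure = ∫ x in (0 : ℝ)..1, u x := by
  rw [← integral_Ioc_eq_integral_Ioo, ← intervalIntegral.integral_of_le zero_le_one]

theorem integral_cos_int_mul (j : ℤ) : ∫ x in (0 : ℝ)..1, Real.cos ((j : ℝ) * Real.pi * x) =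
    if j = 0 then 1 else 0 := by
  split_ifs with hk
  · simp [hk]
  · have hne : (j : ℝ) * Real.pi ≠ 0 := mul_ne_zero (by exact_mod_cast hk) Real.pi_ne_zero
    rw [intervalIntegral.integral_comp_mul_left (fun y => Real.cos y) hne]
    simp [Real.sin_int_mul_pi]

theorem orthonormal_cosfun : Orthonormal ℝ cosfun := by
  rw [orthonormal_iff_ite]
  intro i j
  rw [cosfun, cosfun, inner_toL2_left (memLp_cos i)]
  have h1 : ∫ x, Real.sqrt 2 * Real.cos (freq i * x) *
      (toL2 fun x => Real.sqrt 2 * Real.cos (freq j * x)) x ∂spaceMeasure =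
      ∫ x, (Real.cos ((((i : ℤ) - j : ℤ) : ℝ) * Real.pi * x) +
        Real.cos ((((i : ℤ) + j + 2 : ℤ) : ℝ) * Real.pi * x)) ∂spaceMeasure := by
    refine integral_congr_ae ?_
    filter_upwards [toL2_coe_ae (memLp_cos j)] with x hj
    rw [hj]
    have e1 : (((i : ℤ) - j : ℤ) : ℝ) * Real.pi * x = freq i * x - freq j * x := by
      unfold freq; push_cast; ring
    have e2 : (((i : ℤ) + j + 2 : ℤ) : ℝ) * Real.pi * x = freq i * x + freq j * x := by
      unfold freq; push_cast; ring
    rw [e1, e2, Real.cos_sub, Real.cos_add]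
    have h2 : Real.sqrt 2 * Real.sqrt 2 = 2 := Real.mul_self_sqrt (by norm_num)
    linear_combination Real.cos (freq i * x) * Real.cos (freq j * x) * h2
  rw [h1, integral_space_eq, intervalIntegral.integral_add
    ((by fun_prop : Continuous _).intervalIntegrable _ _)
    ((by fun_prop : Continuous _).intervalIntegrable _ _), integral_cos_int_mul,
    integral_cos_int_mul, if_neg (by omega : ((i : ℤ) + j + 2) ≠ 0)]
  by_cases hij : i = j
  · simp [hij]
  · rw [if_neg (by omega), if_neg hij]; ring

theorem integrable_mul_continuous (f : L2) {u : ℝ → ℝ} (hu : Continuous u) :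
    Integrable (fun x => f x * u x) spaceMeasure :=
  (Lp.memLp f).integrable_mul (memLp_of_continuous hu)

/-- Induction on `j`, for all `n` at once: one factor `cos (πx)` turns `sin (nπx)` into half the sum
of its neighbours. The index `n = 0` is included because the recursion reaches it. -/
theorem integral_mul_sin_mul_cos_pow {f : L2} (hf : ∀ n, inner ℝ (eigenfun n) f = 0) (j n : ℕ) :
    ∫ x, f x * (Real.sin ((n : ℝ) * Real.pi * x) * Real.cos (Real.pi * x) ^ j) ∂spaceMeasure
      = 0 := by
  induction j generalizing n with
  | zero =>
    rcases n with _ | n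
    · simp
    · have h1 := hf n
      rw [eigenfun_eq, inner_toL2_left (memLp_sin n)] at h1
      have h2 : (fun x => Real.sqrt 2 * Real.sin (freq n * x) * f x) = fun x =>
          Real.sqrt 2 * (f x * (Real.sin (((n + 1 : ℕ) : ℝ) * Real.pi * x) *
            Real.cos (Real.pi * x) ^ 0)) := by
        ext x; simp only [freq]; push_cast; ring
      rw [h2, integral_const_mul] at h1
      exact (mul_eq_zero.1 h1).resolve_left (by positivity)
  | succ j ih =>
    rcases n with _ | n
    · simp
    · have h2 : (fun x => f x * (Real.sin (((n + 1 : ℕ) : ℝ) * Real.pi * x) *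
          Real.cos (Real.pi * x) ^ (j + 1))) = fun x =>
          1 / 2 * (f x * (Real.sin (((n + 2 : ℕ) : ℝ) * Real.pi * x) * Real.cos (Real.pi * x) ^ j)) +
          1 / 2 * (f x * (Real.sin ((n : ℝ) * Real.pi * x) * Real.cos (Real.pi * x) ^ j)) := by
        ext x
        have e1 : ((n + 2 : ℕ) : ℝ) * Real.pi * x =
          ((n + 1 : ℕ) : ℝ) * Real.pi * x + Real.pi * x := by push_cast; ring
        have e2 : (n : ℝ) * Real.pi * x =
          ((n + 1 : ℕ) : ℝ) * Real.pi * x - Real.pi * x := by push_cast; ring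
        rw [e1, e2, Real.sin_add, Real.sin_sub]
        ring
      rw [h2, integral_add ((integrable_mul_continuous f (by fun_prop)).const_mul _)
        ((integrable_mul_continuous f (by fun_prop)).const_mul _), integral_const_mul,
        integral_const_mul, ih, ih]
      simp

theorem integral_mul_sin_mul_polynomial {f : L2} (hf : ∀ n, inner ℝ (eigenfun n) f = 0)
    (p : Polynomial ℝ) :
    ∫ x, f x * (Real.sin (Real.pi * x) * p.eval (Real.cos (Real.pi * x))) ∂spaceMeasure = 0 := by
  induction p using Polynomial.induction_on' with
  | add p q hp hq =>
    have h2 : (fun x => f x * (Real.sin (Real.pi * x) *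
        (p + q).eval (Real.cos (Real.pi * x)))) = fun x =>
        f x * (Real.sin (Real.pi * x) * p.eval (Real.cos (Real.pi * x))) +
        f x * (Real.sin (Real.pi * x) * q.eval (Real.cos (Real.pi * x))) := by
      ext x; rw [Polynomial.eval_add]; ring
    rw [h2, integral_add (integrable_mul_continuous f (by fun_prop))
      (integrable_mul_continuous f (by fun_prop)), hp, hq, add_zero]
  | monomial n a =>
    have h2 : (fun x => f x * (Real.sin (Real.pi * x) *
        (Polynomial.monomial n a).eval (Real.cos (Real.pi * x)))) = fun x =>
        a * (f x * (Real.sin (((1 : ℕ) : ℝ) * Real.pi * x) * Real.cos (Real.pi * x) ^ n)) := by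
      ext x; rw [Polynomial.eval_monomial]; push_cast; ring_nf
    rw [h2, integral_const_mul, integral_mul_sin_mul_cos_pow hf, mul_zero]

/-- On `(0,1)` the function `cos (πx)` is a coordinate with inverse `arccos / π`, so Weierstrass
approximation in that variable passes from polynomials in the cosine to all continuous functions. -/
theorem integral_mul_sin_mul_continuous {f : L2} (hf : ∀ n, inner ℝ (eigenfun n) f = 0)
    {θ : ℝ → ℝ} (hθ : Continuous θ) :
    ∫ x, f x * (Real.sin (Real.pi * x) * θ x) ∂spaceMeasure = 0 := by
  have hfi : Integrable (fun x => f x) spaceMeasure := (Lp.memLp f).integrable (by norm_num)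
  set g : ℝ → ℝ := fun y => θ (Real.arccos y / Real.pi) with hg
  have hgc : Continuous g := hθ.comp (Real.continuous_arccos.div_const _)
  have hgθ : ∀ x ∈ Ioo (0 : ℝ) 1, g (Real.cos (Real.pi * x)) = θ x := by
    intro x hx
    simp only [hg]
    rw [Real.arccos_cos (by have := Real.pi_pos; nlinarith [hx.1])
      (by have := Real.pi_pos; nlinarith [hx.2]), mul_div_cancel_left₀ _ Real.pi_ne_zero]
  have key : ∀ ε > 0, |∫ x, f x * (Real.sin (Real.pi * x) * θ x) ∂spaceMeasure| ≤
      ε * ∫ x, |f x| ∂spaceMeasure := by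
    intro ε hε
    obtain ⟨p, hp⟩ := exists_polynomial_near_of_continuousOn (-1) 1 g hgc.continuousOn ε hε
    have h1 := integral_mul_sin_mul_polynomial hf p
    have h2 : ∫ x, f x * (Real.sin (Real.pi * x) * θ x) ∂spaceMeasure =
        ∫ x, f x * (Real.sin (Real.pi * x) *
          (θ x - p.eval (Real.cos (Real.pi * x)))) ∂spaceMeasure := by
      have h3 : (fun x => f x * (Real.sin (Real.pi * x) *
          (θ x - p.eval (Real.cos (Real.pi * x))))) = fun x =>
          f x * (Real.sin (Real.pi * x) * θ x) -
          f x * (Real.sin (Real.pi * x) * p.eval (Real.cos (Real.pi * x))) := by ext x; ring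
      rw [h3, integral_sub (integrable_mul_continuous f (by fun_prop))
        (integrable_mul_continuous f (by fun_prop)), h1, sub_zero]
    rw [h2, ← integral_const_mul]
    rw [← Real.norm_eq_abs]
    refine norm_integral_le_of_norm_le (hfi.abs.const_mul ε) ?_
    refine (ae_restrict_iff' measurableSet_Ioo).2 (Eventually.of_forall fun x hx => ?_)
    rw [Real.norm_eq_abs, abs_mul, abs_mul, mul_comm ε]
    refine mul_le_mul_of_nonneg_left ?_ (abs_nonneg _)
    have h4 := hp (Real.cos (Real.pi * x)) ⟨Real.neg_one_le_cos _, Real.cos_le_one _⟩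
    rw [hgθ x hx, abs_sub_comm] at h4
    calc |Real.sin (Real.pi * x)| * |θ x - p.eval (Real.cos (Real.pi * x))| ≤ 1 * ε :=
          mul_le_mul (Real.abs_sin_le_one _) h4.le (abs_nonneg _) zero_le_one
      _ = ε := one_mul ε
  have hlim : Tendsto (fun ε : ℝ => ε * ∫ x, |f x| ∂spaceMeasure) (𝓝[>] 0) (𝓝 0) := by
    have h1 : Continuous fun ε : ℝ => ε * ∫ x, |f x| ∂spaceMeasure := by fun_prop
    simpa using (h1.tendsto 0).mono_left nhdsWithin_le_nhds
  exact abs_nonpos_iff.1 (ge_of_tendsto hlim (eventually_nhdsWithin_of_forall key))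

/-- The sine functions are complete in `L²(0,1)`. -/
theorem eigenfun_total (f : L2) (hf : ∀ n, inner ℝ (eigenfun n) f = 0) : f = 0 := by
  have hfi : Integrable (fun x => f x) spaceMeasure := (Lp.memLp f).integrable (by norm_num)
  -- The weight `sin (πx)` has no zero in `(0,1)`, so it is enough that its product with `f`
  -- vanishes a.e.
  have key := isOpen_Ioo.ae_eq_zero_of_integral_contDiff_smul_eq_zero
    (U := Ioo (0 : ℝ) 1) (μ := volume) (f := fun x => f x * Real.sin (Real.pi * x))
    (IntegrableOn.locallyIntegrableOn (integrable_mul_continuous f (by fun_prop)))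
    (by
      intro η hη hc hs
      have h1 := integral_mul_sin_mul_continuous hf hη.continuous
      refine Eq.trans (Eq.symm ?_) h1
      have h2 : (fun x => f x * (Real.sin (Real.pi * x) * η x)) =
        fun x => η x • (f x * Real.sin (Real.pi * x)) := by
        ext x; simp only [smul_eq_mul]; ring
      rw [h2]
      refine setIntegral_eq_integral_of_forall_compl_eq_zero (E := ℝ) fun x hx => ?_
      have : η x = 0 := by
        by_contra hne
        exact hx (hs (subset_tsupport _ hne))
      simp [this])
  refine Lp.ext ?_
  have h3 := (ae_restrict_iff' (μ := volume) measurableSet_Ioo).2 key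
  filter_upwards [h3, Lp.coeFn_zero ℝ 2 spaceMeasure,
    ae_restrict_mem (μ := volume) measurableSet_Ioo] with x hx h0 hmem
  rw [h0, Pi.zero_apply]
  refine (mul_eq_zero.1 hx).resolve_right (Real.sin_pos_of_pos_of_lt_pi ?_ ?_).ne'
  · exact mul_pos Real.pi_pos hmem.1
  · have := Real.pi_pos
    nlinarith [hmem.2]

theorem isSpectral_eigenfun {δ : ℝ} (hδ : 0 < δ) : IsSpectral eigenfun (eigenvalue δ) where
  orthonormal := orthonormal_eigenfun
  total := eigenfun_total
  pos n := by
    have := freq_pos n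
    rw [eigenvalue_eq]; positivity
  tendsto := by
    refine tendsto_atTop_mono (f := fun n : ℕ => δ * (n : ℝ)) (fun n => ?_)
      (tendsto_natCast_atTop_atTop.const_mul_atTop hδ)
    simp only [eigenvalue_eq]
    refine mul_le_mul_of_nonneg_left ?_ hδ.le
    have h1 : (n : ℝ) ≤ freq n := by
      unfold freq
      have := Real.pi_gt_three
      have : (0 : ℝ) ≤ n := n.cast_nonneg
      nlinarith
    nlinarith [one_le_freq n]

end Basis

end GinzburgLandau

namespace GinzburgLandau

open Filter Topology

/-! ### Sobolev spaces in terms of sine coefficients. -/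

section Sobolev

namespace IsTest

variable {η θ : ℝ → ℝ}

theorem eq_zero (h : IsTest η) {x : ℝ} (hx : x ∉ Ioo (0 : ℝ) 1) : η x = 0 := by
  by_contra hne
  exact hx (h.2.2 (subset_tsupport _ hne))

theorem continuous (h : IsTest η) : Continuous η := h.1.continuous

theorem hasDerivAt (h : IsTest η) (x : ℝ) : HasDerivAt η (deriv η x) x :=
  (h.1.differentiable (by simp) x).hasDerivAt

theorem continuous_deriv (h : IsTest η) : Continuous (deriv η) :=
  h.1.continuous_deriv (by simp)

theorem memLp (h : IsTest η) : MemLp η 2 spaceMeasure := memLp_of_continuous h.continuous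

theorem memLp_deriv (h : IsTest η) : MemLp (deriv η) 2 spaceMeasure :=
  memLp_of_continuous h.continuous_deriv

theorem of_contDiff {v : ℝ → ℝ} (h : IsTest η) (hv : ContDiff ℝ ∞ v)
    (h0 : ∀ x, η x = 0 → v x = 0) : IsTest v := by
  have hs : tsupport v ⊆ tsupport η :=
    closure_mono fun x hx => fun h1 => hx (h0 x h1)
  exact ⟨hv, h.2.1.of_isClosed_subset (isClosed_tsupport _) hs, hs.trans h.2.2⟩

theorem zero : IsTest fun _ => 0 := by
  refine ⟨contDiff_const, HasCompactSupport.zero, ?_⟩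
  have : tsupport (fun _ : ℝ => (0 : ℝ)) = ∅ := tsupport_eq_empty_iff.2 rfl
  rw [this]; exact empty_subset _

theorem add (h : IsTest η) (h' : IsTest θ) : IsTest fun x => η x + θ x :=
  ⟨h.1.add h'.1, h.2.1.add h'.2.1, (tsupport_add η θ).trans (union_subset h.2.2 h'.2.2)⟩

theorem const_mul (c : ℝ) (h : IsTest η) : IsTest fun x => c * η x :=
  h.of_contDiff (contDiff_const.mul h.1) fun x hx => by rw [hx, mul_zero]

end IsTest

/-- Integration by parts against a test function. -/
theorem integral_mul_deriv_test {u u' : ℝ → ℝ} (hu : ∀ x, HasDerivAt u (u' x) x)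
    (hu' : Continuous u') {η : ℝ → ℝ} (hη : IsTest η) :
    ∫ x, u x * deriv η x ∂spaceMeasure = -∫ x, u' x * η x ∂spaceMeasure := by
  rw [integral_space_eq, integral_space_eq,
    intervalIntegral.integral_mul_deriv_eq_deriv_mul (fun x _ => hu x) (fun x _ => hη.hasDerivAt x)
      (hu'.intervalIntegrable _ _) (hη.continuous_deriv.intervalIntegrable _ _),
    hη.eq_zero (by simp), hη.eq_zero (by simp)]
  simp

theorem isWeakDeriv_iff {f g : L2} : IsWeakDeriv f g ↔ ∀ η : ℝ → ℝ, IsTest η →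
    inner ℝ f (toL2 (deriv η)) = -inner ℝ g (toL2 η) := by
  refine forall₂_congr fun η hη => ?_
  rw [inner_toL2_right hη.memLp, inner_toL2_right hη.memLp_deriv]

theorem isWeakDeriv_toL2 {u u' : ℝ → ℝ} (hu : ∀ x, HasDerivAt u (u' x) x)
    (hu' : Continuous u') : IsWeakDeriv (toL2 u) (toL2 u') := by
  have huc : Continuous u := continuous_iff_continuousAt.2 fun x => (hu x).continuousAt
  rw [isWeakDeriv_iff]
  intro η hη
  have h1 := integral_mul_deriv_test hu hu' hη
  rw [inner_toL2_left (memLp_of_continuous huc), inner_toL2_left (memLp_of_continuous hu')]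
  convert h1 using 1
  · refine integral_congr_ae ?_
    filter_upwards [toL2_coe_ae hη.memLp_deriv] with x hx
    rw [hx]
  · congr 1
    refine integral_congr_ae ?_
    filter_upwards [toL2_coe_ae hη.memLp] with x hx
    rw [hx]

theorem IsWeakDeriv.add {f g f' g' : L2} (h : IsWeakDeriv f g) (h' : IsWeakDeriv f' g') :
    IsWeakDeriv (f + f') (g + g') := by
  rw [isWeakDeriv_iff] at *
  intro η hη
  rw [inner_add_left, inner_add_left, h η hη, h' η hη]; ring

theorem IsWeakDeriv.smul {f g : L2} (c : ℝ) (h : IsWeakDeriv f g) :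
    IsWeakDeriv (c • f) (c • g) := by
  rw [isWeakDeriv_iff] at *
  intro η hη
  rw [inner_smul_left, inner_smul_left, h η hη]; ring

theorem hasDerivAt_sin_freq (n : ℕ) (x : ℝ) :
    HasDerivAt (fun x => Real.sqrt 2 * Real.sin (freq n * x))
      (freq n * (Real.sqrt 2 * Real.cos (freq n * x))) x :=
  ((((hasDerivAt_id' x).const_mul (freq n)).sin).const_mul (Real.sqrt 2)).congr_deriv (by ring)

theorem hasDerivAt_cos_freq (n : ℕ) (x : ℝ) :
    HasDerivAt (fun x => Real.sqrt 2 * Real.cos (freq n * x))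
      (-freq n * (Real.sqrt 2 * Real.sin (freq n * x))) x :=
  ((((hasDerivAt_id' x).const_mul (freq n)).cos).const_mul (Real.sqrt 2)).congr_deriv (by ring)

theorem isWeakDeriv_eigenfun (n : ℕ) : IsWeakDeriv (eigenfun n) (freq n • cosfun n) := by
  have h1 := isWeakDeriv_toL2 (hasDerivAt_sin_freq n) (by fun_prop)
  rwa [toL2_smul _ (memLp_cos n)] at h1

theorem isWeakDeriv_cosfun (n : ℕ) : IsWeakDeriv (cosfun n) ((-freq n) • eigenfun n) := by
  have h1 := isWeakDeriv_toL2 (hasDerivAt_cos_freq n) (by fun_prop)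
  rwa [toL2_smul _ (memLp_sin n)] at h1

theorem inner_eigenfun_deriv {η : ℝ → ℝ} (hη : IsTest η) (n : ℕ) :
    inner ℝ (eigenfun n) (toL2 (deriv η)) = -(freq n * inner ℝ (cosfun n) (toL2 η)) := by
  rw [isWeakDeriv_iff.1 (isWeakDeriv_eigenfun n) η hη, inner_smul_left]
  simp

theorem inner_cosfun_deriv {η : ℝ → ℝ} (hη : IsTest η) (n : ℕ) :
    inner ℝ (cosfun n) (toL2 (deriv η)) = freq n * inner ℝ (eigenfun n) (toL2 η) := by
  rw [isWeakDeriv_iff.1 (isWeakDeriv_cosfun n) η hη, inner_smul_left]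
  simp

theorem MemH1.isWeakDeriv {f : L2} (h : MemH1 f) : IsWeakDeriv f (weakDeriv f) := by
  obtain ⟨g, hg⟩ := h
  rwa [hg.weakDeriv_eq]

/-- Elements of `H₀¹` are limits of test functions. -/
theorem MemH10.exists_seq {f : L2} (h : MemH10 f) : ∃ η : ℕ → ℝ → ℝ, (∀ j, IsTest (η j)) ∧
    Tendsto (fun j => toL2 (η j)) atTop (𝓝 f) ∧
    Tendsto (fun j => toL2 (deriv (η j))) atTop (𝓝 (weakDeriv f)) := by
  have h1 : ∀ j : ℕ, (0 : ℝ) < 1 / ((j : ℝ) + 1) := fun j => by positivity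
  choose η hη h2 h3 using fun j => h.2 _ (h1 j)
  refine ⟨η, hη, ?_, ?_⟩
  · rw [tendsto_iff_norm_sub_tendsto_zero]
    refine squeeze_zero (fun _ => norm_nonneg _) (fun j => ?_) tendsto_one_div_add_atTop_nhds_zero_nat
    rw [norm_sub_rev]; exact (h2 j).le
  · rw [tendsto_iff_norm_sub_tendsto_zero]
    refine squeeze_zero (fun _ => norm_nonneg _) (fun j => ?_) tendsto_one_div_add_atTop_nhds_zero_nat
    rw [norm_sub_rev]; exact (h3 j).le

/-- The Dirichlet condition enters here. The cosines do not vanish at the endpoints, so integration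
by parts leaves no boundary term only because `f` is a limit of test functions. -/
theorem MemH10.inner_cosfun {f : L2} (h : MemH10 f) (n : ℕ) :
    inner ℝ (cosfun n) (weakDeriv f) = freq n * inner ℝ (eigenfun n) f := by
  obtain ⟨η, hη, h1, h2⟩ := h.exists_seq
  refine tendsto_nhds_unique ((innerSL ℝ (cosfun n)).continuous.tendsto _ |>.comp h2) ?_
  refine (((innerSL ℝ (eigenfun n)).continuous.tendsto _ |>.comp h1).const_mul (freq n)).congr
    fun j => ?_
  simp only [Function.comp, innerSL_apply_apply]
  exact (inner_cosfun_deriv (hη j) n).symm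

/-- Bessel's inequality for the cosine coefficients of the weak derivative. -/
theorem MemH10.sumLe {f : L2} (h : MemH10 f) :
    SumLe eigenfun (fun n => freq n ^ 2) f (‖weakDeriv f‖ ^ 2) := by
  intro N
  have h1 := sumLe_one orthonormal_cosfun (weakDeriv f) N
  simpa only [one_mul, h.inner_cosfun, mul_pow] using h1

theorem IsTest.isWeakDeriv {η : ℝ → ℝ} (h : IsTest η) : IsWeakDeriv (toL2 η) (toL2 (deriv η)) :=
  isWeakDeriv_toL2 h.hasDerivAt h.continuous_deriv

theorem IsTest.memH10 {η : ℝ → ℝ} (h : IsTest η) : MemH10 (toL2 η) :=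
  ⟨⟨_, h.isWeakDeriv⟩, fun ε hε => ⟨η, h, by simpa, by simpa [h.isWeakDeriv.weakDeriv_eq]⟩⟩

theorem IsTest.sumLe {η : ℝ → ℝ} (h : IsTest η) :
    SumLe eigenfun (fun n => freq n ^ 2) (toL2 η) (‖toL2 (deriv η)‖ ^ 2) := by
  simpa [h.isWeakDeriv.weakDeriv_eq] using h.memH10.sumLe

theorem norm_toL2_sq {u : ℝ → ℝ} (hu : MemLp u 2 spaceMeasure) :
    ‖toL2 u‖ ^ 2 = ∫ x, u x ^ 2 ∂spaceMeasure := by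
  rw [← real_inner_self_eq_norm_sq, inner_toL2_left hu]
  refine integral_congr_ae ?_
  filter_upwards [toL2_coe_ae hu] with x hx
  rw [hx, sq]

theorem integral_abs_le_norm {u : ℝ → ℝ} (hu : MemLp u 2 spaceMeasure) :
    ∫ x, |u x| ∂spaceMeasure ≤ ‖toL2 u‖ := by
  have h0 : (0 : ℝ) ≤ ∫ x, |u x| ∂spaceMeasure := integral_nonneg fun x => abs_nonneg _
  have hi : Integrable u spaceMeasure := hu.integrable (by norm_num)
  set I := ∫ x, |u x| ∂spaceMeasure with hI
  refine le_of_sq_le_sq ?_ (norm_nonneg _)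
  -- Nonnegativity of the variance of `|u|`; the interval has measure one.
  have h1 : 0 ≤ ∫ x, (|u x| - I) ^ 2 ∂spaceMeasure := integral_nonneg fun x => sq_nonneg _
  have h2 : (fun x => (|u x| - I) ^ 2) = fun x => u x ^ 2 - 2 * I * |u x| + I ^ 2 := by
    ext x; rw [← sq_abs (u x)]; ring
  rw [h2, integral_add (f := fun x => u x ^ 2 - 2 * I * |u x|) (g := fun _ => I ^ 2)
    (hu.integrable_sq.sub (hi.abs.const_mul _)) (integrable_const _), integral_sub hu.integrable_sq (hi.abs.const_mul _), integral_const_mul, ← hI,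
    ← norm_toL2_sq hu] at h1
  simp at h1
  nlinarith

theorem IsTest.abs_le {η : ℝ → ℝ} (h : IsTest η) (x : ℝ) : |η x| ≤ ‖toL2 (deriv η)‖ := by
  by_cases hx : x ∈ Ioo (0 : ℝ) 1
  · have h1 : η x = ∫ y in (0 : ℝ)..x, deriv η y := by
      rw [intervalIntegral.integral_deriv_eq_sub (fun y _ => (h.hasDerivAt y).differentiableAt)
        (h.continuous_deriv.intervalIntegrable _ _), h.eq_zero (x := 0) (by simp), sub_zero]
    rw [h1]
    refine (intervalIntegral.abs_integral_le_integral_abs hx.1.le).trans ?_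
    refine le_trans ?_ (integral_abs_le_norm h.memLp_deriv)
    rw [integral_space_eq]
    exact intervalIntegral.integral_mono_interval le_rfl hx.1.le hx.2.le
      (Eventually.of_forall fun y => abs_nonneg _) (h.continuous_deriv.abs.intervalIntegrable _ _)
  · rw [h.eq_zero hx, abs_zero]; exact norm_nonneg _

/-- The embedding of `H₀¹(0,1)` into the bounded functions. -/
theorem MemH10.ae_abs_le {f : L2} (h : MemH10 f) :
    ∀ᵐ x ∂spaceMeasure, |f x| ≤ ‖weakDeriv f‖ := by
  obtain ⟨η, hη, h1, h2⟩ := h.exists_seq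
  have h3 : TendstoInMeasure spaceMeasure (fun j => toL2 (η j)) atTop f :=
    tendstoInMeasure_of_tendsto_Lp h1
  obtain ⟨σ, hσ, h4⟩ := h3.exists_seq_tendsto_ae
  have h5 : ∀ᵐ x ∂spaceMeasure, ∀ j, toL2 (η j) x = η j x :=
    ae_all_iff.2 fun j => toL2_coe_ae (hη j).memLp
  filter_upwards [h4, h5] with x hx hx2
  refine le_of_tendsto_of_tendsto' hx.abs ((h2.norm).comp hσ.tendsto_atTop) fun j => ?_
  rw [hx2]
  exact (hη _).abs_le x

/-- Pairs of a test function and its derivative. -/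
noncomputable def testPairs : Submodule ℝ (L2 × L2) where
  carrier := {p | ∃ η, IsTest η ∧ p = (toL2 η, toL2 (deriv η))}
  add_mem' := by
    rintro _ _ ⟨η, hη, rfl⟩ ⟨θ, hθ, rfl⟩
    refine ⟨fun x => η x + θ x, hη.add hθ, ?_⟩
    have : deriv (fun x => η x + θ x) = fun x => deriv η x + deriv θ x :=
      funext fun x => ((hη.hasDerivAt x).add (hθ.hasDerivAt x)).deriv
    rw [this, toL2_add hη.memLp hθ.memLp, toL2_add hη.memLp_deriv hθ.memLp_deriv, Prod.mk_add_mk]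
  zero_mem' := by
    refine ⟨fun _ => 0, IsTest.zero, ?_⟩
    have h0 : toL2 (fun _ => 0) = 0 := by
      simpa using toL2_smul (u := fun _ => 0) 0 IsTest.zero.memLp
    have hd : deriv (fun _ : ℝ => (0 : ℝ)) = fun _ => 0 := funext fun x => deriv_const x 0
    rw [hd, h0]; rfl
  smul_mem' := by
    rintro c _ ⟨η, hη, rfl⟩
    refine ⟨fun x => c * η x, hη.const_mul c, ?_⟩
    have : deriv (fun x => c * η x) = fun x => c * deriv η x :=
      funext fun x => ((hη.hasDerivAt x).const_mul c).deriv
    rw [this, toL2_smul c hη.memLp, toL2_smul c hη.memLp_deriv, Prod.smul_mk]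

/-- Recasts `H₀¹` as the closure of a linear subspace of pairs, so that finite sums and limits of
series can be handled at once. -/
theorem memH10_of_mem_closure {f g : L2} (h : IsWeakDeriv f g)
    (hc : (f, g) ∈ testPairs.topologicalClosure) : MemH10 f := by
  refine ⟨⟨g, h⟩, fun ε hε => ?_⟩
  have h1 : (f, g) ∈ closure (testPairs : Set (L2 × L2)) := hc
  obtain ⟨p, ⟨η, hη, rfl⟩, hp⟩ := Metric.mem_closure_iff.1 h1 ε hε
  rw [Prod.dist_eq, max_lt_iff, dist_eq_norm, dist_eq_norm] at hp
  exact ⟨η, hη, hp.1, by rw [h.weakDeriv_eq]; exact hp.2⟩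

theorem tendsto_toL2 {v : ℕ → ℝ → ℝ} {u : ℝ → ℝ} {C : ℝ} (hv : ∀ j, Continuous (v j))
    (hu : Continuous u) (hC : ∀ j, ∀ x ∈ Ioo (0 : ℝ) 1, |v j x| ≤ C)
    (hlim : ∀ x ∈ Ioo (0 : ℝ) 1, Tendsto (fun j => v j x) atTop (𝓝 (u x))) :
    Tendsto (fun j => toL2 (v j)) atTop (𝓝 (toL2 u)) := by
  have huC : ∀ x ∈ Ioo (0 : ℝ) 1, |u x| ≤ C := fun x hx =>
    le_of_tendsto (hlim x hx).abs (Eventually.of_forall fun j => hC j x hx)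
  have h1 : Tendsto (fun j => ∫ x, (v j x - u x) ^ 2 ∂spaceMeasure) atTop (𝓝 0) := by
    have := tendsto_integral_of_dominated_convergence (μ := spaceMeasure)
      (F := fun j x => (v j x - u x) ^ 2) (f := fun _ => (0 : ℝ)) (fun _ => (2 * C) ^ 2)
      (fun j => (((hv j).sub hu).pow 2).aestronglyMeasurable) (integrable_const _)
      (fun j => (ae_restrict_iff' measurableSet_Ioo).2 (Eventually.of_forall fun x hx => ?_))
      ((ae_restrict_iff' measurableSet_Ioo).2 (Eventually.of_forall fun x hx => ?_))
    · simpa using this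
    · rw [norm_pow, Real.norm_eq_abs]
      gcongr
      exact (abs_sub _ _).trans (by linarith [hC j x hx, huC x hx])
    · simpa using ((hlim x hx).sub_const (u x)).pow 2
  rw [tendsto_iff_norm_sub_tendsto_zero]
  have h2 : ∀ j, ‖toL2 (v j) - toL2 u‖ = √(∫ x, (v j x - u x) ^ 2 ∂spaceMeasure) := fun j => by
    rw [← toL2_sub (memLp_of_continuous (hv j)) (memLp_of_continuous hu),
      ← norm_toL2_sq (u := fun x => v j x - u x) (memLp_of_continuous ((hv j).sub hu)), Real.sqrt_sq (norm_nonneg _)]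
  simp only [h2]
  simpa using h1.sqrt

theorem deriv_smoothTransition_eq_zero {z : ℝ} (hz : z ∉ Icc (0 : ℝ) 1) :
    deriv Real.smoothTransition z = 0 := by
  rcases lt_or_ge z 0 with h | h
  · have : Real.smoothTransition =ᶠ[𝓝 z] fun _ => 0 := by
      filter_upwards [Iio_mem_nhds h] with y hy
      exact Real.smoothTransition.zero_of_nonpos (le_of_lt hy)
    rw [this.deriv_eq, deriv_const]
  · have h1 : 1 < z := not_le.1 fun h1 => hz ⟨h, h1⟩
    have : Real.smoothTransition =ᶠ[𝓝 z] fun _ => 1 := by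
      filter_upwards [Ioi_mem_nhds h1] with y hy
      exact Real.smoothTransition.one_of_one_le (le_of_lt hy)
    rw [this.deriv_eq, deriv_const]

/-- The derivative lives on `1 ≤ z ≤ 2`. With `z = a x` this says that the derivative of a cutoff at
scale `1 / a`, multiplied by a function of size `x`, is bounded independently of `a`. -/
theorem exists_bound_mul_deriv_smoothTransition :
    ∃ B, 0 ≤ B ∧ ∀ z, |z * deriv Real.smoothTransition (z - 1)| ≤ B := by
  have hc : Continuous (deriv Real.smoothTransition) :=
    (Real.smoothTransition.contDiff (n := 1)).continuous_deriv le_rfl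
  obtain ⟨B, hB⟩ := (isCompact_Icc (a := (1 : ℝ)) (b := 2)).exists_bound_of_continuousOn
    (f := fun z => z * deriv Real.smoothTransition (z - 1)) (by fun_prop)
  have hB0 : 0 ≤ B := (norm_nonneg _).trans (hB 1 (by simp))
  refine ⟨B, hB0, fun z => ?_⟩
  by_cases hz : z ∈ Icc (1 : ℝ) 2
  · exact hB z hz
  · rw [deriv_smoothTransition_eq_zero, mul_zero, abs_zero]
    · exact hB0
    · exact fun h => hz ⟨by linarith [h.1], by linarith [h.2]⟩

/-- Smooth functions on the line that vanish at `0` and at `1` belong to `H₀¹`. -/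
theorem mem_closure_testPairs {u u' : ℝ → ℝ} (hu : ContDiff ℝ ∞ u)
    (hu' : ∀ x, HasDerivAt u (u' x) x) {C : ℝ} (hC : ∀ x ∈ Ioo (0 : ℝ) 1, |u' x| ≤ C)
    (h0 : ∀ x ∈ Ioo (0 : ℝ) 1, |u x| ≤ C * x) (h1 : ∀ x ∈ Ioo (0 : ℝ) 1, |u x| ≤ C * (1 - x)) :
    (toL2 u, toL2 u') ∈ testPairs.topologicalClosure := by
  obtain ⟨B, hB0, hB⟩ := exists_bound_mul_deriv_smoothTransition
  have hC0 : 0 ≤ C := (abs_nonneg _).trans (hC (1 / 2) (by norm_num))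
  set st := Real.smoothTransition with hst
  have hstd : ∀ z, HasDerivAt st (deriv st z) z := fun z =>
    ((Real.smoothTransition.contDiff (n := 1)).differentiable (by simp) z).hasDerivAt
  have hstc : Continuous (deriv st) :=
    (Real.smoothTransition.contDiff (n := 1)).continuous_deriv le_rfl
  have hst1 : ∀ z, |st z| ≤ 1 := fun z => by
    rw [abs_of_nonneg (Real.smoothTransition.nonneg z)]; exact Real.smoothTransition.le_one z
  have hu'c : Continuous u' := by
    have : u' = deriv u := funext fun x => (hu' x).deriv.symm
    rw [this]; exact hu.continuous_deriv (by simp)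
  set a : ℕ → ℝ := fun j => (j : ℝ) + 1 with ha
  have ha0 : ∀ j, 0 < a j := fun j => by positivity
  -- The cutoffs vanish within `1 / a j` of the endpoints and equal one beyond `2 / a j`. Their
  -- derivatives are of size `a j`, but there `u` is of size `1 / a j` by the linear bounds at the
  -- endpoints, so dominated convergence applies to `η'`.
  set η : ℕ → ℝ → ℝ := fun j x => st (a j * x - 1) * st (a j * (1 - x) - 1) * u x with hη
  set η' : ℕ → ℝ → ℝ := fun j x => a j * deriv st (a j * x - 1) * u x * st (a j * (1 - x) - 1) -
    a j * deriv st (a j * (1 - x) - 1) * u x * st (a j * x - 1) +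
      st (a j * x - 1) * st (a j * (1 - x) - 1) * u' x with hη'
  have hder : ∀ j x, HasDerivAt (η j) (η' j x) x := by
    intro j x
    have e1 : HasDerivAt (fun x => st (a j * x - 1)) (deriv st (a j * x - 1) * a j) x :=
      HasDerivAt.comp x (hstd _) ((((hasDerivAt_id' x).const_mul (a j)).sub_const 1).congr_deriv
        (by ring))
    have e2 : HasDerivAt (fun x => st (a j * (1 - x) - 1))
        (deriv st (a j * (1 - x) - 1) * (-a j)) x :=
      HasDerivAt.comp x (hstd _) (((((hasDerivAt_id' x).const_sub 1).const_mul
        (a j)).sub_const 1).congr_deriv (by ring))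
    refine ((e1.mul e2).mul (hu' x)).congr_deriv ?_
    simp only [hη', Pi.mul_apply]; ring
  have hdη : ∀ j, deriv (η j) = η' j := fun j => funext fun x => (hder j x).deriv
  have hstcont : Continuous st := Real.smoothTransition.continuous
  have htest : ∀ j, IsTest (η j) := by
    intro j
    have hz : ∀ x, x ∉ Icc (1 / a j) (1 - 1 / a j) → η j x = 0 := by
      intro x hx
      rw [mem_Icc, not_and_or, not_le, not_le] at hx
      rcases hx with hx | hx
      · rw [lt_div_iff₀ (ha0 j)] at hx
        simp only [hη]
        rw [hst, Real.smoothTransition.zero_of_nonpos (x := a j * x - 1) (by linarith)]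
        ring
      · have : 1 - x < 1 / a j := by linarith
        rw [lt_div_iff₀ (ha0 j)] at this
        simp only [hη]
        rw [hst, Real.smoothTransition.zero_of_nonpos (x := a j * (1 - x) - 1) (by linarith)]
        ring
    refine ⟨?_, HasCompactSupport.intro isCompact_Icc fun x hx => hz x hx, ?_⟩
    · exact ((Real.smoothTransition.contDiff.comp (by fun_prop)).mul
        (Real.smoothTransition.contDiff.comp (by fun_prop))).mul hu
    · have : tsupport (η j) ⊆ Icc (1 / a j) (1 - 1 / a j) :=
        closure_minimal (fun x hx => by_contra fun h => hx (hz x h)) isClosed_Icc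
      refine this.trans fun x hx => ?_
      have := one_div_pos.2 (ha0 j)
      exact ⟨by linarith [hx.1], by linarith [hx.2]⟩
  have hlarge : ∀ x : ℝ, 0 < x → ∀ᶠ j in atTop, 2 < a j * x := fun x hx => by
    have : Tendsto (fun j => a j * x) atTop atTop :=
      (tendsto_natCast_atTop_atTop.atTop_add tendsto_const_nhds).atTop_mul_const hx
    exact this.eventually_gt_atTop 2
  have hlim1 : Tendsto (fun j => toL2 (η j)) atTop (𝓝 (toL2 u)) := by
    refine tendsto_toL2 (C := C) (fun j => (htest j).continuous) hu.continuous (fun j x hx => ?_)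
      fun x hx => ?_
    · simp only [hη, abs_mul]
      have e1 : |u x| ≤ C := (h0 x hx).trans (mul_le_of_le_one_right hC0 hx.2.le)
      have e2 := mul_le_one₀ (hst1 (a j * x - 1)) (abs_nonneg _) (hst1 (a j * (1 - x) - 1))
      exact (mul_le_of_le_one_left (abs_nonneg _) e2).trans e1
    · refine tendsto_const_nhds.congr' ?_
      filter_upwards [hlarge x hx.1, hlarge (1 - x) (by linarith [hx.2])] with j j1 j2
      simp only [hη, hst]
      rw [Real.smoothTransition.one_of_one_le (by linarith),
        Real.smoothTransition.one_of_one_le (by linarith)]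
      ring
  have hlim2 : Tendsto (fun j => toL2 (deriv (η j))) atTop (𝓝 (toL2 u')) := by
    refine tendsto_toL2 (C := C * B + C * B + C) (fun j => (htest j).continuous_deriv) hu'c
      (fun j x hx => ?_) fun x hx => ?_
    · rw [hdη]
      have e2 := mul_le_one₀ (hst1 (a j * x - 1)) (abs_nonneg _) (hst1 (a j * (1 - x) - 1))
      have key : ∀ y, 0 ≤ y → |u x| ≤ C * y → |a j * deriv st (a j * y - 1) * u x| ≤ C * B := by
        intro y hy huy
        have := hB (a j * y)
        rw [abs_mul, abs_mul, abs_of_pos (ha0 j)]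
        rw [abs_mul, abs_of_nonneg (mul_nonneg (ha0 j).le hy)] at this
        calc a j * |deriv st (a j * y - 1)| * |u x| ≤ a j * |deriv st (a j * y - 1)| * (C * y) :=
              mul_le_mul_of_nonneg_left huy (mul_nonneg (ha0 j).le (abs_nonneg _))
          _ = C * (a j * y * |deriv st (a j * y - 1)|) := by ring
          _ ≤ C * B := mul_le_mul_of_nonneg_left this hC0
      simp only [hη']
      refine (abs_add_le _ _).trans (add_le_add ((abs_sub _ _).trans (add_le_add ?_ ?_)) ?_)
      · rw [abs_mul]
        exact (mul_le_of_le_one_right (abs_nonneg _) (hst1 _)).trans (key x hx.1.le (h0 x hx))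
      · rw [abs_mul]
        exact (mul_le_of_le_one_right (abs_nonneg _) (hst1 _)).trans
          (key (1 - x) (by linarith [hx.2]) (h1 x hx))
      · rw [abs_mul, abs_mul]
        exact (mul_le_of_le_one_left (abs_nonneg _) e2).trans (hC x hx)
    · refine tendsto_const_nhds.congr' ?_
      filter_upwards [hlarge x hx.1, hlarge (1 - x) (by linarith [hx.2])] with j j1 j2
      rw [hdη]
      simp only [hη', hst]
      rw [Real.smoothTransition.one_of_one_le (x := a j * x - 1) (by linarith),
        Real.smoothTransition.one_of_one_le (x := a j * (1 - x) - 1) (by linarith),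
        deriv_smoothTransition_eq_zero (z := a j * x - 1) (fun h => by linarith [h.2]),
        deriv_smoothTransition_eq_zero (z := a j * (1 - x) - 1) (fun h => by linarith [h.2])]
      ring
  exact mem_closure_of_tendsto (hlim1.prodMk_nhds hlim2)
    (Eventually.of_forall fun j => ⟨η j, htest j, rfl⟩)

theorem eigenfun_mem_closure (n : ℕ) :
    (eigenfun n, freq n • cosfun n) ∈ testPairs.topologicalClosure := by
  rw [cosfun, ← toL2_smul _ (memLp_cos n), eigenfun_eq]
  have hf := freq_pos n
  have hsin : Real.sin (freq n * 1) = 0 := by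
    have := Real.sin_nat_mul_pi (n + 1)
    rw [mul_one, freq]
    exact_mod_cast this
  have hlip : ∀ x y : ℝ, |Real.sqrt 2 * Real.sin (freq n * x) - Real.sqrt 2 * Real.sin (freq n * y)|
      ≤ freq n * Real.sqrt 2 * |x - y| := fun x y => by
    have := Real.lipschitzWith_sin.dist_le_mul (freq n * x) (freq n * y)
    rw [Real.dist_eq, Real.dist_eq, ← mul_sub, abs_mul, abs_of_pos hf] at this
    simp only [NNReal.coe_one, one_mul] at this
    rw [← mul_sub, abs_mul, abs_of_nonneg (Real.sqrt_nonneg 2)]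
    calc √2 * |Real.sin (freq n * x) - Real.sin (freq n * y)| ≤ √2 * (freq n * |x - y|) := by gcongr
      _ = _ := by ring
  refine mem_closure_testPairs (C := freq n * Real.sqrt 2) (by fun_prop) (hasDerivAt_sin_freq n)
    (fun x _ => ?_) (fun x hx => ?_) (fun x hx => ?_)
  · rw [abs_mul, abs_mul, abs_of_pos hf, abs_of_nonneg (Real.sqrt_nonneg 2)]
    exact mul_le_mul_of_nonneg_left (mul_le_of_le_one_right (Real.sqrt_nonneg 2)
      (Real.abs_cos_le_one _)) hf.le
  · have := hlip x 0
    rwa [mul_zero, Real.sin_zero, mul_zero, sub_zero, sub_zero, abs_of_pos hx.1] at this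
  · have := hlip x 1
    rwa [hsin, mul_zero, sub_zero, abs_sub_comm, abs_of_pos (sub_pos.2 hx.2)] at this

/-- Sine series with square summable derivative are in `H₀¹(0,1)`. -/
theorem memH10_of_sumLe {f : L2} {B : ℝ} (h : SumLe eigenfun (fun n => freq n ^ 2) f B) :
    MemH10 f ∧ HasSum (fun n => (freq n * inner ℝ (eigenfun n) f) • cosfun n) (weakDeriv f) ∧
      ‖weakDeriv f‖ ^ 2 ≤ B := by
  have hs := isSpectral_eigenfun one_pos
  have hsum : Summable fun n => (freq n * inner ℝ (eigenfun n) f) • cosfun n := by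
    have := (orthonormal_cosfun.orthogonalFamily.summable_iff_norm_sq_summable
      (f := fun n => freq n * inner ℝ (eigenfun n) f)).2 (by
        have := h.summable fun n => sq_nonneg _
        simpa [mul_pow] using this)
    simpa using this
  obtain ⟨g, hg⟩ := hsum
  -- The series of `f` and of its derivative converge together in the product, so `(f, g)` is a
  -- limit of combinations of pairs that lie in the closed subspace.
  have hfg : HasSum (fun n => (inner ℝ (eigenfun n) f : ℝ) • (eigenfun n, freq n • cosfun n))
      (f, g) := by
    refine HasSum.congr_fun (HasSum.prodMk (hs.hasSum_smul f) hg) ?_ 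
    intro n
    simp [smul_smul, mul_comm]
  have hw : IsWeakDeriv f g := by
    rw [isWeakDeriv_iff]
    intro η hη
    have h1 := (hs.hasSum_smul f).mapL (innerSL ℝ (toL2 (deriv η)))
    have h2 := (hg.mapL (innerSL ℝ (toL2 η))).neg
    rw [real_inner_comm, real_inner_comm (toL2 η)]
    refine h1.unique (h2.congr_fun fun n => ?_)
    simp only [innerSL_apply_apply, inner_smul_right]
    rw [real_inner_comm _ (toL2 (deriv η)), inner_eigenfun_deriv hη, real_inner_comm _ (toL2 η)]
    ring
  have hgB : ‖g‖ ^ 2 ≤ B := by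
    refine le_of_tendsto' (hg.tendsto_sum_nat.norm.pow 2) fun N => ?_
    rw [← real_inner_self_eq_norm_sq, orthonormal_cosfun.inner_sum]
    refine le_trans (le_of_eq (Finset.sum_congr rfl fun n _ => ?_)) (h N)
    simp; ring
  refine ⟨memH10_of_mem_closure hw ?_, ?_, ?_⟩
  · exact testPairs.isClosed_topologicalClosure.mem_of_tendsto hfg.tendsto_sum_nat
      (Eventually.of_forall fun N => Submodule.sum_mem _ fun n _ =>
        Submodule.smul_mem _ _ (eigenfun_mem_closure n))
  · rwa [hw.weakDeriv_eq]
  · rwa [hw.weakDeriv_eq]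

/-- Sine series with square summable second derivative are in `H²(0,1)`. -/
theorem memH2_of_sumLe {f : L2} {B : ℝ} (h : SumLe eigenfun (fun n => freq n ^ 4) f B) :
    MemH2 f ∧ h2Norm f ^ 2 ≤ 3 * B := by
  have hs := isSpectral_eigenfun one_pos
  -- Every frequency is at least one, so `B` also controls the lower orders; three terms bounded by
  -- `B` give the factor `3`.
  have h2 : SumLe eigenfun (fun n => freq n ^ 2) f B := fun N =>
    (Finset.sum_le_sum fun n _ => mul_le_mul_of_nonneg_right
      (pow_le_pow_right₀ (one_le_freq n) (by norm_num)) (sq_nonneg _)).trans (h N)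
  have h0 : SumLe eigenfun (fun _ => 1) f B := fun N =>
    (Finset.sum_le_sum fun n _ => mul_le_mul_of_nonneg_right
      (one_le_pow₀ (one_le_freq n)) (sq_nonneg _)).trans (h N)
  obtain ⟨hf, hg, hgB⟩ := memH10_of_sumLe h2
  have hsum : Summable fun n => (-(freq n ^ 2 * inner ℝ (eigenfun n) f)) • eigenfun n := by
    refine hs.summable_smul ?_
    have := h.summable fun n => by positivity
    refine this.congr fun n => ?_
    ring
  obtain ⟨q, hq⟩ := hsum
  have hw : IsWeakDeriv (weakDeriv f) q := by
    rw [isWeakDeriv_iff]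
    intro η hη
    have h1 := hg.mapL (innerSL ℝ (toL2 (deriv η)))
    have h2 := (hq.mapL (innerSL ℝ (toL2 η))).neg
    rw [real_inner_comm, real_inner_comm (toL2 η)]
    refine h1.unique (h2.congr_fun fun n => ?_)
    simp only [innerSL_apply_apply, inner_smul_right]
    rw [real_inner_comm _ (toL2 (deriv η)), inner_cosfun_deriv hη, real_inner_comm _ (toL2 η)]
    ring
  have hqB : ‖q‖ ^ 2 ≤ B := by
    refine hs.norm_sq_le_of_sumLe fun N => le_trans (le_of_eq (Finset.sum_congr rfl fun n _ => ?_)) (h N)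
    rw [hs.inner_of_hasSum hq]; ring
  refine ⟨⟨hf.1, ⟨q, hw⟩⟩, ?_⟩
  rw [h2Norm, Real.sq_sqrt (by positivity), hw.weakDeriv_eq]
  have := hs.norm_sq_le_of_sumLe h0
  linarith

theorem h1Norm_sq_le {f : L2} {B : ℝ} (h : SumLe eigenfun (fun n => freq n ^ 2) f B) :
    h1Norm f ^ 2 ≤ 2 * B := by
  have h0 : SumLe eigenfun (fun _ => 1) f B := fun N =>
    (Finset.sum_le_sum fun n _ => mul_le_mul_of_nonneg_right
      (one_le_pow₀ (one_le_freq n)) (sq_nonneg _)).trans (h N)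
  rw [h1Norm, Real.sq_sqrt (by positivity)]
  have h1 := (isSpectral_eigenfun one_pos).norm_sq_le_of_sumLe h0
  have h2 := (memH10_of_sumLe h).2.2
  linarith

end Sobolev

end GinzburgLandau

namespace GinzburgLandau

open Filter Topology

/-! ### The superposition operators `V'(φ)` and `V''(φ) λ`. -/

section Nonlinearity

theorem sumLe_freq_of_sumLe {δ : ℝ} (hδ : 0 < δ) {f : L2} {B : ℝ}
    (h : SumLe eigenfun (eigenvalue δ) f B) :
    SumLe eigenfun (fun n => freq n ^ 2) f (B / δ) := by
  intro N
  rw [le_div_iff₀ hδ, Finset.sum_mul]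
  refine le_trans (le_of_eq (Finset.sum_congr rfl fun n _ => ?_)) (h N)
  rw [eigenvalue_eq]; ring

theorem sumLe_of_sumLe_freq {δ : ℝ} (hδ : 0 < δ) {f : L2} {B : ℝ}
    (h : SumLe eigenfun (fun n => freq n ^ 2) f B) :
    SumLe eigenfun (eigenvalue δ) f (δ * B) := by
  intro N
  refine le_trans (le_of_eq ?_) (mul_le_mul_of_nonneg_left (h N) hδ.le)
  rw [Finset.mul_sum]
  refine Finset.sum_congr rfl fun n _ => ?_
  rw [eigenvalue_eq]; ring

theorem sumLe_freq_of_sumLe_sq {δ : ℝ} (hδ : 0 < δ) {f : L2} {B : ℝ}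
    (h : SumLe eigenfun (fun n => eigenvalue δ n ^ 2) f B) :
    SumLe eigenfun (fun n => freq n ^ 4) f (B / δ ^ 2) := by
  intro N
  rw [le_div_iff₀ (by positivity), Finset.sum_mul]
  refine le_trans (le_of_eq (Finset.sum_congr rfl fun n _ => ?_)) (h N)
  simp only [eigenvalue_eq]; ring

/-- Regularity and bounds for the derivatives of the potential. -/
structure PotentialBounds (V : ℝ → ℝ) (M : ℝ) : Prop where
  nonneg : 0 ≤ M
  contDiff : ContDiff ℝ ∞ (deriv V)
  contDiff_two : ContDiff ℝ ∞ (iteratedDeriv 2 V)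
  hasDerivAt : ∀ y, HasDerivAt (deriv V) (iteratedDeriv 2 V y) y
  hasDerivAt_two : ∀ y, HasDerivAt (iteratedDeriv 2 V) (iteratedDeriv 3 V y) y
  zero : deriv V 0 = 0
  abs_le : ∀ y, |deriv V y| ≤ M
  abs_two_le : ∀ y, |iteratedDeriv 2 V y| ≤ M
  abs_three_le : ∀ y, |iteratedDeriv 3 V y| ≤ M

theorem IsModifiedDoubleWell.exists_bounds {V : ℝ → ℝ} (hV : IsModifiedDoubleWell V) :
    ∃ M, PotentialBounds V M := by
  obtain ⟨hc, ⟨s, hs, hVs⟩, hb⟩ := hV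
  obtain ⟨M₁, h1⟩ := hb 1 le_rfl
  obtain ⟨M₂, h2⟩ := hb 2 (by norm_num)
  obtain ⟨M₃, h3⟩ := hb 3 (by norm_num)
  have hcd : ∀ n : ℕ, ContDiff ℝ ∞ (iteratedDeriv n V) := fun n =>
    (contDiff_infty.2 fun m => by
      refine ContDiff.iterate_deriv' m n ?_ |> fun h => by rwa [iteratedDeriv_eq_iterate]
      exact hc.of_le (by exact_mod_cast le_top))
  have hd : ∀ (n : ℕ) (y : ℝ), HasDerivAt (iteratedDeriv n V) (iteratedDeriv (n + 1) V y) y :=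
    fun n y => by
      rw [iteratedDeriv_succ]
      exact ((hcd n).differentiable (by simp) y).hasDerivAt
  refine ⟨max |M₁| (max |M₂| |M₃|), (abs_nonneg _).trans (le_max_left _ _), ?_, hcd 2, ?_, hd 2, ?_,
    fun y => ?_, fun y => ?_, fun y => ?_⟩
  · simpa only [iteratedDeriv_one] using hcd 1
  · simpa only [iteratedDeriv_one] using hd 1
  -- Agreement with the double well near `0` serves to give `V'(0) = 0`, which lets `V'(φ)` inherit
  -- the zero boundary values of `φ`.
  · have h4 : V =ᶠ[𝓝 0] doubleWell := by
      filter_upwards [Icc_mem_nhds (neg_lt_zero.2 hs) hs] with y hy using hVs y hy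
    rw [h4.deriv_eq]
    have h5 : HasDerivAt doubleWell (2 * ((0 : ℝ) ^ 2 - 1) ^ 1 * (2 * 0 ^ 1 * 1) / 4) 0 :=
      ((((hasDerivAt_id' (0 : ℝ)).pow 2).sub_const 1).pow 2).div_const 4
    rw [h5.deriv]; norm_num
  · have := h1 y
    rw [iteratedDeriv_one] at this
    exact this.trans ((le_abs_self _).trans (le_max_left _ _))
  · exact (h2 y).trans ((le_abs_self _).trans ((le_max_left _ _).trans (le_max_right _ _)))
  · exact (h3 y).trans ((le_abs_self _).trans ((le_max_right _ _).trans (le_max_right _ _)))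

theorem abs_sub_le_of_hasDerivAt {p q : ℝ → ℝ} {M : ℝ} (hp : ∀ y, HasDerivAt p (q y) y)
    (hq : ∀ y, |q y| ≤ M) (a b : ℝ) : |p a - p b| ≤ M * |a - b| :=
  convex_univ.norm_image_sub_le_of_norm_hasDerivWithin_le (f := p) (f' := q)
    (fun y _ => (hp y).hasDerivWithinAt) (fun y _ => hq y) (mem_univ b) (mem_univ a)

theorem norm_le_of_ae_abs_le {f g : L2} {c : ℝ} (h : ∀ᵐ x ∂spaceMeasure, |f x| ≤ c * |g x|) :
    ‖f‖ ≤ c * ‖g‖ := Lp.norm_le_mul_norm_of_ae_le_mul h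

theorem norm_toL2_le {u : ℝ → ℝ} {C : ℝ} (hu : MemLp u 2 spaceMeasure) (hC0 : 0 ≤ C)
    (hC : ∀ x, |u x| ≤ C) : ‖toL2 u‖ ≤ C := by
  refine le_of_sq_le_sq ?_ hC0
  rw [norm_toL2_sq hu]
  have : ∫ x, u x ^ 2 ∂spaceMeasure ≤ ∫ _, C ^ 2 ∂spaceMeasure :=
    integral_mono hu.integrable_sq (integrable_const _) fun x => by
      simp only [← sq_abs (u x)]
      have := hC x
      gcongr
  simpa using this

theorem coeFn_comp_ae (f : L2) {p : ℝ → ℝ} (hp : Continuous p) {M : ℝ} (hM : ∀ y, |p y| ≤ M) :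
    MemLp (fun x => p (f x)) 2 spaceMeasure :=
  memLp_of_bound (hp.comp_aestronglyMeasurable (Lp.aestronglyMeasurable f)) fun _ _ => hM _

variable {V : ℝ → ℝ} {M : ℝ}

namespace PotentialBounds

variable (hV : PotentialBounds V M)
include hV

theorem memLp_deriv (f : L2) : MemLp (fun x => deriv V (f x)) 2 spaceMeasure :=
  coeFn_comp_ae f hV.contDiff.continuous hV.abs_le

theorem memLp_dual (f l : L2) :
    MemLp (fun x => iteratedDeriv 2 V (f x) * l x) 2 spaceMeasure := by
  refine MemLp.of_le_mul (c := M) (Lp.memLp l) ?_ (Eventually.of_forall fun x => ?_)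
  · exact (hV.contDiff_two.continuous.comp_aestronglyMeasurable (Lp.aestronglyMeasurable f)).mul
      (Lp.aestronglyMeasurable l)
  · rw [norm_mul]
    exact mul_le_mul_of_nonneg_right (hV.abs_two_le _) (norm_nonneg _)

theorem dualSource_ae (f l : L2) :
    dualSource V f l =ᵐ[spaceMeasure] fun x => iteratedDeriv 2 V (f x) * l x :=
  toL2_coe_ae (hV.memLp_dual f l)

theorem norm_deriv_sub_le (f g : L2) :
    ‖toL2 (fun x => deriv V (f x)) - toL2 fun x => deriv V (g x)‖ ≤ M * ‖f - g‖ := by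
  refine norm_le_of_ae_abs_le ?_
  filter_upwards [toL2_coe_ae (hV.memLp_deriv f), toL2_coe_ae (hV.memLp_deriv g),
    Lp.coeFn_sub (toL2 fun x => deriv V (f x)) (toL2 fun x => deriv V (g x)),
    Lp.coeFn_sub f g] with x h1 h2 h3 h4
  rw [h3, h4, Pi.sub_apply, Pi.sub_apply, h1, h2]
  exact abs_sub_le_of_hasDerivAt hV.hasDerivAt hV.abs_two_le _ _

theorem norm_dualSource_le (f l : L2) : ‖dualSource V f l‖ ≤ M * ‖l‖ := by
  refine norm_le_of_ae_abs_le ?_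
  filter_upwards [hV.dualSource_ae f l] with x hx
  rw [hx, abs_mul]
  exact mul_le_mul_of_nonneg_right (hV.abs_two_le _) (abs_nonneg _)

theorem dualSource_add (f l l' : L2) :
    dualSource V f (l + l') = dualSource V f l + dualSource V f l' := by
  refine Lp.ext ?_
  filter_upwards [hV.dualSource_ae f l, hV.dualSource_ae f l', hV.dualSource_ae f (l + l'),
    Lp.coeFn_add l l', Lp.coeFn_add (dualSource V f l) (dualSource V f l')] with x h1 h2 h3 h4 h5
  rw [h3, h5, h4, Pi.add_apply, Pi.add_apply, h1, h2]; ring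

theorem dualSource_smul (f l : L2) (c : ℝ) :
    dualSource V f (c • l) = c • dualSource V f l := by
  refine Lp.ext ?_
  filter_upwards [hV.dualSource_ae f l, hV.dualSource_ae f (c • l),
    Lp.coeFn_smul c l, Lp.coeFn_smul c (dualSource V f l)] with x h1 h3 h4 h5
  rw [h3, h5, h4, Pi.smul_apply, Pi.smul_apply, h1, smul_eq_mul, smul_eq_mul]; ring

theorem dualSource_sub (f l l' : L2) :
    dualSource V f (l - l') = dualSource V f l - dualSource V f l' := by
  rw [sub_eq_add_neg, hV.dualSource_add, ← neg_one_smul ℝ l', hV.dualSource_smul, neg_one_smul,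
    ← sub_eq_add_neg]

theorem dualSource_symm (f l l' : L2) :
    inner ℝ (dualSource V f l) l' = inner ℝ l (dualSource V f l') := by
  rw [inner_L2_eq, inner_L2_eq]
  refine integral_congr_ae ?_
  filter_upwards [hV.dualSource_ae f l, hV.dualSource_ae f l'] with x h1 h2
  rw [h1, h2]; ring

/-- For a bounded `l`, such as an eigenfunction, the map is Lipschitz in `f`. A general `l` is
approximated by partial sums of its sine series, and the error is uniform in `f` because `V''` is
bounded. -/
theorem continuous_dualSource_left (l : L2) : Continuous fun f => dualSource V f l := by
  have hs := isSpectral_eigenfun one_pos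
  have he : ∀ n, Continuous fun f => dualSource V f (eigenfun n) := by
    intro n
    have hlip : ∀ f g : L2, ‖dualSource V f (eigenfun n) - dualSource V g (eigenfun n)‖ ≤
        M * √2 * ‖f - g‖ := by
      intro f g
      refine norm_le_of_ae_abs_le ?_
      filter_upwards [hV.dualSource_ae f (eigenfun n), hV.dualSource_ae g (eigenfun n),
        Lp.coeFn_sub (dualSource V f (eigenfun n)) (dualSource V g (eigenfun n)),
        Lp.coeFn_sub f g, eigenfun_coe_ae n] with x h1 h2 h3 h4 h5
      rw [h3, h4, Pi.sub_apply, Pi.sub_apply, h1, h2, h5, ← sub_mul, abs_mul]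
      have h6 := abs_sub_le_of_hasDerivAt hV.hasDerivAt_two hV.abs_three_le (f x) (g x)
      have h7 : |√2 * Real.sin (((n : ℝ) + 1) * Real.pi * x)| ≤ √2 := by
        rw [abs_mul, abs_of_nonneg (Real.sqrt_nonneg 2)]
        exact mul_le_of_le_one_right (Real.sqrt_nonneg 2) (Real.abs_sin_le_one _)
      calc _ ≤ M * |f x - g x| * √2 := mul_le_mul h6 h7 (abs_nonneg _)
            (mul_nonneg hV.nonneg (abs_nonneg _))
        _ = _ := by ring
    exact (LipschitzWith.of_dist_le_mul (K := ⟨M * √2, mul_nonneg hV.nonneg (Real.sqrt_nonneg 2)⟩)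
      fun f g => by rw [dist_eq_norm, dist_eq_norm]; exact hlip f g).continuous
  set P : ℕ → L2 := fun N => ∑ n ∈ Finset.range N, (inner ℝ (eigenfun n) l : ℝ) • eigenfun n
  have hP : ∀ N, Continuous fun f => dualSource V f (P N) := by
    intro N
    have : ∀ f, dualSource V f (P N) =
        ∑ n ∈ Finset.range N, (inner ℝ (eigenfun n) l : ℝ) • dualSource V f (eigenfun n) := by
      intro f
      let D : L2 →ₗ[ℝ] L2 :=
        { toFun := dualSource V f, map_add' := hV.dualSource_add f,
          map_smul' := fun c l => hV.dualSource_smul f l c }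
      change D (P N) = ∑ n ∈ Finset.range N, (inner ℝ (eigenfun n) l : ℝ) • D (eigenfun n)
      simp [P, map_sum]
    simp only [this]
    exact continuous_finsetSum _ fun n _ => (continuous_const_smul _).comp (he n)
  have hlim : Tendsto P atTop (𝓝 l) := (hs.hasSum_smul l).tendsto_sum_nat
  have hunif : TendstoUniformly (fun N f => dualSource V f (P N)) (fun f => dualSource V f l)
      atTop := by
    rw [Metric.tendstoUniformly_iff]
    intro ε hε
    have h1 : Tendsto (fun N => M * ‖l - P N‖) atTop (𝓝 0) := by
      simpa using ((tendsto_const_nhds (x := l)).sub hlim).norm.const_mul M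
    filter_upwards [h1.eventually_lt_const hε] with N hN f
    rw [dist_eq_norm, ← hV.dualSource_sub]
    exact (hV.norm_dualSource_le f _).trans_lt hN
  exact hunif.continuous (Frequently.of_forall hP)

theorem continuous_dualSource : Continuous fun p : L2 × L2 => dualSource V p.1 p.2 := by
  refine continuous_iff_continuousAt.2 fun p => ?_
  rw [ContinuousAt, tendsto_iff_norm_sub_tendsto_zero]
  have h1 : Continuous fun r : L2 × L2 =>
      M * ‖r.2 - p.2‖ + ‖dualSource V r.1 p.2 - dualSource V p.1 p.2‖ := by
    have := (hV.continuous_dualSource_left p.2).comp continuous_fst (X := L2 × L2)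
    fun_prop
  refine squeeze_zero (fun _ => norm_nonneg _) (fun r => ?_) (by simpa using h1.tendsto p)
  have h2 : dualSource V r.1 r.2 - dualSource V p.1 p.2 =
      dualSource V r.1 (r.2 - p.2) + (dualSource V r.1 p.2 - dualSource V p.1 p.2) := by
    rw [hV.dualSource_sub]; abel
  rw [h2]
  exact (norm_add_le _ _).trans (add_le_add (hV.norm_dualSource_le _ _) le_rfl)

theorem abs_taylor_le (a b : ℝ) :
    |deriv V (a + b) - deriv V a - iteratedDeriv 2 V a * b| ≤ M * b ^ 2 := by
  -- Mean value inequality for `V'(y) - V''(a) y`, whose derivative is at most `M |b|` on the ball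
  -- of radius `|b|` around `a`.
  have h := (convex_closedBall a |b|).norm_image_sub_le_of_norm_hasDerivWithin_le
    (f := fun y => deriv V y - iteratedDeriv 2 V a * y)
    (f' := fun y => iteratedDeriv 2 V y - iteratedDeriv 2 V a) (C := M * |b|) (x := a) (y := a + b)
    (fun y _ => ((hV.hasDerivAt y).sub (((hasDerivAt_id' y).const_mul _).congr_deriv
      (mul_one _))).hasDerivWithinAt)
    (fun y hy => by
      refine (abs_sub_le_of_hasDerivAt hV.hasDerivAt_two hV.abs_three_le y a).trans ?_
      refine mul_le_mul_of_nonneg_left ?_ hV.nonneg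
      simpa [Real.dist_eq] using hy)
    (by simp) (by simp)
  simp only [Real.norm_eq_abs, add_sub_cancel_left] at h
  calc _ = |deriv V (a + b) - iteratedDeriv 2 V a * (a + b) -
        (deriv V a - iteratedDeriv 2 V a * a)| := by congr 1; ring
    _ ≤ M * |b| * |b| := h
    _ = M * b ^ 2 := by rw [mul_assoc, ← sq, sq_abs]

/-- Pointwise the remainder is of size `d²`, which is integrable for `d` in `L²`; this is why the
other factor has to be bounded. -/
theorem abs_inner_taylor_le {B : ℝ} (hB : 0 ≤ B) {l : L2} (hl : ∀ᵐ x ∂spaceMeasure, |l x| ≤ B)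
    (f d : L2) : |inner ℝ l ((toL2 fun x => deriv V ((f + d : L2) x)) -
      (toL2 fun x => deriv V (f x)) - dualSource V f d)| ≤ B * M * ‖d‖ ^ 2 := by
  rw [inner_L2_eq, ← real_inner_self_eq_norm_sq, inner_L2_eq, ← integral_const_mul,
    ← Real.norm_eq_abs]
  refine norm_integral_le_of_norm_le
    (((Lp.memLp d).integrable_mul (Lp.memLp d)).const_mul (B * M)) ?_
  filter_upwards [hl, toL2_coe_ae (hV.memLp_deriv f), toL2_coe_ae (hV.memLp_deriv (f + d)),
    hV.dualSource_ae f d, Lp.coeFn_add f d,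
    Lp.coeFn_sub (toL2 fun x => deriv V ((f + d : L2) x)) (toL2 fun x => deriv V (f x)),
    Lp.coeFn_sub ((toL2 fun x => deriv V ((f + d : L2) x)) - toL2 fun x => deriv V (f x))
      (dualSource V f d)] with x h1 h2 h3 h4 h5 h6 h7
  rw [h7, Pi.sub_apply, h6, Pi.sub_apply, h3, h2, h4, h5, Pi.add_apply, norm_mul,
    Real.norm_eq_abs, Real.norm_eq_abs]
  have h8 := hV.abs_taylor_le (f x) (d x)
  calc _ ≤ B * (M * (d x) ^ 2) := mul_le_mul h1 h8 (abs_nonneg _) hB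
    _ = _ := by ring

theorem isTest_deriv {η : ℝ → ℝ} (hη : IsTest η) : IsTest fun x => deriv V (η x) :=
  hη.of_contDiff (hV.contDiff.comp hη.1) fun x hx => by rw [hx, hV.zero]

theorem isTest_dual {η θ : ℝ → ℝ} (hη : IsTest η) (hθ : IsTest θ) :
    IsTest fun x => iteratedDeriv 2 V (η x) * θ x :=
  hθ.of_contDiff ((hV.contDiff_two.comp hη.1).mul hθ.1) fun x hx => by rw [hx, mul_zero]

theorem norm_toL2_deriv_le {η : ℝ → ℝ} (hη : IsTest η) :
    ‖toL2 (deriv fun x => deriv V (η x))‖ ≤ M * ‖toL2 (deriv η)‖ := by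
  have hd : (deriv fun x => deriv V (η x)) = fun x => iteratedDeriv 2 V (η x) * deriv η x :=
    funext fun x => ((hV.hasDerivAt (η x)).comp x (hη.hasDerivAt x)).deriv
  refine norm_le_of_ae_abs_le ?_
  filter_upwards [toL2_coe_ae (hV.isTest_deriv hη).memLp_deriv, toL2_coe_ae hη.memLp_deriv]
    with x h1 h2
  rw [h1, h2, hd, abs_mul]
  exact mul_le_mul_of_nonneg_right (hV.abs_two_le _) (abs_nonneg _)

/-- Product rule: the term with `V'''` contains the product of `θ` and `η'`, and `θ` is bounded by
the `L²` norm of its derivative. -/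
theorem norm_toL2_dual_le {η θ : ℝ → ℝ} (hη : IsTest η) (hθ : IsTest θ) :
    ‖toL2 (deriv fun x => iteratedDeriv 2 V (η x) * θ x)‖ ≤
      M * ‖toL2 (deriv θ)‖ * ‖toL2 (deriv η)‖ + M * ‖toL2 (deriv θ)‖ := by
  have hd : (deriv fun x => iteratedDeriv 2 V (η x) * θ x) = fun x =>
      iteratedDeriv 3 V (η x) * θ x * deriv η x + iteratedDeriv 2 V (η x) * deriv θ x :=
    funext fun x => ((((hV.hasDerivAt_two (η x)).comp x (hη.hasDerivAt x)).mul
      (hθ.hasDerivAt x)).congr_deriv (by simp only [Function.comp]; ring)).deriv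
  have hV3 : Continuous (iteratedDeriv 3 V) := by
    rw [iteratedDeriv_succ]; exact hV.contDiff_two.continuous_deriv (by simp)
  have hV2 := hV.contDiff_two.continuous
  have c1 := hη.continuous
  have c2 := hθ.continuous
  have c3 := hη.continuous_deriv
  have c4 := hθ.continuous_deriv
  have m1 : MemLp (fun x => iteratedDeriv 3 V (η x) * θ x * deriv η x) 2 spaceMeasure :=
    memLp_of_continuous (((hV3.comp c1).mul c2).mul c3)
  have m2 : MemLp (fun x => iteratedDeriv 2 V (η x) * deriv θ x) 2 spaceMeasure :=
    memLp_of_continuous ((hV2.comp c1).mul c4)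
  rw [hd, toL2_add m1 m2]
  refine (norm_add_le _ _).trans (add_le_add ?_ ?_)
  · refine norm_le_of_ae_abs_le ?_
    filter_upwards [toL2_coe_ae m1, toL2_coe_ae hη.memLp_deriv] with x h1 h2
    rw [h1, h2, abs_mul, abs_mul]
    refine mul_le_mul_of_nonneg_right ?_ (abs_nonneg _)
    exact mul_le_mul (hV.abs_three_le _) (hθ.abs_le x) (abs_nonneg _) hV.nonneg
  · refine norm_le_of_ae_abs_le ?_
    filter_upwards [toL2_coe_ae m2, toL2_coe_ae hθ.memLp_deriv] with x h1 h2
    rw [h1, h2, abs_mul]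
    exact mul_le_mul_of_nonneg_right (hV.abs_two_le _) (abs_nonneg _)

/-- No chain rule for weak derivatives is needed: the estimate holds for test functions, where
`V'(0) = 0` keeps the composition a test function, and the coefficient bound survives the `L²`
limit. -/
theorem sumLe_deriv {f : L2} (hf : MemH10 f) :
    SumLe eigenfun (fun n => freq n ^ 2) (toL2 fun x => deriv V (f x))
      ((M * ‖weakDeriv f‖) ^ 2) := by
  obtain ⟨η, hη, h1, h2⟩ := hf.exists_seq
  have h3 : Tendsto (fun j => toL2 fun x => deriv V (η j x)) atTop
      (𝓝 (toL2 fun x => deriv V (f x))) := by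
    rw [tendsto_iff_norm_sub_tendsto_zero]
    have h4 : Tendsto (fun j => M * ‖toL2 (η j) - f‖) atTop (𝓝 0) := by
      simpa using (h1.sub_const f).norm.const_mul M
    refine squeeze_zero (fun _ => norm_nonneg _) (fun j => ?_) h4
    have h5 : (toL2 fun x => deriv V (η j x)) = toL2 fun x => deriv V (toL2 (η j) x) := by
      refine toL2_congr (hV.isTest_deriv (hη j)).memLp ?_
      filter_upwards [toL2_coe_ae (hη j).memLp] with x hx
      rw [hx]
    rw [h5]
    exact hV.norm_deriv_sub_le _ _
  refine SumLe.of_tendsto (l := atTop) (F := fun j => toL2 fun x => deriv V (η j x))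
    (b := fun j => (M * ‖toL2 (deriv (η j))‖) ^ 2) (fun j => ?_) ((h2.norm.const_mul M).pow 2)
    fun n => ((innerSL ℝ (eigenfun n)).continuous.tendsto _).comp h3
  refine (hV.isTest_deriv (hη j)).sumLe.mono ?_
  have := hV.norm_toL2_deriv_le (hη j)
  gcongr

/-- The same passage from test functions, now relying on joint continuity of the product in `L²`. -/
theorem sumLe_dualSource {f l : L2} (hf : MemH10 f) (hl : MemH10 l) :
    SumLe eigenfun (fun n => freq n ^ 2) (dualSource V f l)
      ((M * ‖weakDeriv l‖ * ‖weakDeriv f‖ + M * ‖weakDeriv l‖) ^ 2) := by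
  obtain ⟨η, hη, h1, h2⟩ := hf.exists_seq
  obtain ⟨θ, hθ, h1', h2'⟩ := hl.exists_seq
  have h3 : Tendsto (fun j => dualSource V (toL2 (η j)) (toL2 (θ j))) atTop
      (𝓝 (dualSource V f l)) :=
    Tendsto.comp (g := fun p : L2 × L2 => dualSource V p.1 p.2)
      (f := fun j => (toL2 (η j), toL2 (θ j))) (hV.continuous_dualSource.tendsto (f, l))
      (h1.prodMk_nhds h1')
  have h4 : ∀ j, dualSource V (toL2 (η j)) (toL2 (θ j)) =
      toL2 fun x => iteratedDeriv 2 V (η j x) * θ j x := fun j => by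
    unfold dualSource
    refine toL2_congr (hV.memLp_dual _ _) ?_
    filter_upwards [toL2_coe_ae (hη j).memLp, toL2_coe_ae (hθ j).memLp] with x hx hx'
    rw [hx, hx']
  have hb : Tendsto (fun j => (M * ‖toL2 (deriv (θ j))‖ * ‖toL2 (deriv (η j))‖ +
      M * ‖toL2 (deriv (θ j))‖) ^ 2) atTop
      (𝓝 ((M * ‖weakDeriv l‖ * ‖weakDeriv f‖ + M * ‖weakDeriv l‖) ^ 2)) :=
    (((h2'.norm.const_mul M).mul h2.norm).add (h2'.norm.const_mul M)).pow 2
  have hB : ∀ j, SumLe eigenfun (fun n => freq n ^ 2) (dualSource V (toL2 (η j)) (toL2 (θ j)))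
      ((M * ‖toL2 (deriv (θ j))‖ * ‖toL2 (deriv (η j))‖ + M * ‖toL2 (deriv (θ j))‖) ^ 2) := by
    intro j
    rw [h4]
    refine (hV.isTest_dual (hη j) (hθ j)).sumLe.mono ?_
    exact pow_le_pow_left₀ (norm_nonneg _) (hV.norm_toL2_dual_le (hη j) (hθ j)) 2
  exact SumLe.of_tendsto hB hb
    fun n => ((innerSL ℝ (eigenfun n)).continuous.tendsto _).comp h3

theorem exists_taylor_bound {δ : ℝ} (hδ : 0 < δ) (B : ℝ) : ∃ R, 0 ≤ R ∧ ∀ l : L2,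
    SumLe eigenfun (eigenvalue δ) l B → ∀ f d : L2,
    |inner ℝ l (-(δ⁻¹ • toL2 fun x => deriv V ((f + d : L2) x)) -
      -(δ⁻¹ • toL2 fun x => deriv V (f x)) - -(δ⁻¹ • dualSource V f d))| ≤ R * ‖d‖ ^ 2 := by
  refine ⟨δ⁻¹ * (√(B / δ) * M), ?_, fun l hl f d => ?_⟩
  · have := hV.nonneg
    positivity
  · obtain ⟨h1, -, h2⟩ := memH10_of_sumLe (sumLe_freq_of_sumLe hδ hl)
    have h3 : ∀ᵐ x ∂spaceMeasure, |l x| ≤ √(B / δ) := by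
      filter_upwards [h1.ae_abs_le] with x hx
      exact hx.trans (Real.le_sqrt_of_sq_le h2)
    have h4 := hV.abs_inner_taylor_le (Real.sqrt_nonneg _) h3 f d
    have h5 : -(δ⁻¹ • toL2 fun x => deriv V ((f + d : L2) x)) -
        -(δ⁻¹ • toL2 fun x => deriv V (f x)) - -(δ⁻¹ • dualSource V f d) =
        -(δ⁻¹ • ((toL2 fun x => deriv V ((f + d : L2) x)) -
          (toL2 fun x => deriv V (f x)) - dualSource V f d)) := by
      rw [smul_sub, smul_sub]; abel
    rw [h5, inner_neg_right, real_inner_smul_right, abs_neg, abs_mul,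
      abs_of_nonneg (inv_nonneg.2 hδ.le), mul_assoc]
    exact mul_le_mul_of_nonneg_left h4 (inv_nonneg.2 hδ.le)

theorem exists_form_bound {δ : ℝ} (hδ : 0 < δ) (B : ℝ) : ∃ B', ∀ f : L2,
    SumLe eigenfun (eigenvalue δ) f B →
      SumLe eigenfun (eigenvalue δ) (-(δ⁻¹ • toL2 fun x => deriv V (f x))) B' := by
  refine ⟨δ * (δ⁻¹ ^ 2 * (M * √(B / δ)) ^ 2), fun f hf => ?_⟩
  obtain ⟨h1, -, h2⟩ := memH10_of_sumLe (sumLe_freq_of_sumLe hδ hf)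
  refine (sumLe_of_sumLe_freq hδ ((hV.sumLe_deriv h1).smul δ⁻¹).neg).mono ?_
  have := Real.le_sqrt_of_sq_le h2
  have := hV.nonneg
  gcongr

theorem exists_deriv_form_bound {δ : ℝ} (hδ : 0 < δ) (B : ℝ) : ∃ B', ∀ f l : L2,
    SumLe eigenfun (eigenvalue δ) f B → SumLe eigenfun (eigenvalue δ) l B →
      SumLe eigenfun (eigenvalue δ) (-(δ⁻¹ • dualSource V f l)) B' := by
  refine ⟨δ * (δ⁻¹ ^ 2 * (M * √(B / δ) * √(B / δ) + M * √(B / δ)) ^ 2), fun f l hf hl => ?_⟩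
  obtain ⟨h1, -, h2⟩ := memH10_of_sumLe (sumLe_freq_of_sumLe hδ hf)
  obtain ⟨h1', -, h2'⟩ := memH10_of_sumLe (sumLe_freq_of_sumLe hδ hl)
  refine (sumLe_of_sumLe_freq hδ ((hV.sumLe_dualSource h1 h1').smul δ⁻¹).neg).mono ?_
  have := Real.le_sqrt_of_sq_le h2
  have := Real.le_sqrt_of_sq_le h2'
  have := hV.nonneg
  gcongr

/-- The nonlinearity of the Ginzburg-Landau equation satisfies the abstract hypotheses. -/
theorem isNonlinearity {δ : ℝ} (hδ : 0 < δ) :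
    IsNonlinearity eigenfun (eigenvalue δ) (fun f => -(δ⁻¹ • toL2 fun x => deriv V (f x)))
      (fun f l => -(δ⁻¹ • dualSource V f l)) (δ⁻¹ * M) where
  nonneg := mul_nonneg (inv_nonneg.2 hδ.le) hV.nonneg
  bound f := by
    rw [norm_neg, norm_smul, Real.norm_of_nonneg (inv_nonneg.2 hδ.le)]
    exact mul_le_mul_of_nonneg_left
      (norm_toL2_le (hV.memLp_deriv f) hV.nonneg fun x => hV.abs_le _) (inv_nonneg.2 hδ.le)
  lip f g := by
    rw [← neg_sub', norm_neg, ← smul_sub, norm_smul, Real.norm_of_nonneg (inv_nonneg.2 hδ.le),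
      mul_assoc]
    exact mul_le_mul_of_nonneg_left (hV.norm_deriv_sub_le f g) (inv_nonneg.2 hδ.le)
  deriv_sub f l l' := by
    rw [hV.dualSource_sub, smul_sub, neg_sub']
  deriv_bound f l := by
    rw [norm_neg, norm_smul, Real.norm_of_nonneg (inv_nonneg.2 hδ.le), mul_assoc]
    exact mul_le_mul_of_nonneg_left (hV.norm_dualSource_le f l) (inv_nonneg.2 hδ.le)
  deriv_symm f l l' := by
    rw [inner_neg_left, inner_neg_right, real_inner_smul_left, real_inner_smul_right,
      hV.dualSource_symm]
  deriv_cont := continuous_neg.comp ((continuous_const_smul δ⁻¹).comp hV.continuous_dualSource)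
  taylor := hV.exists_taylor_bound hδ
  form := hV.exists_form_bound hδ
  deriv_form := hV.exists_deriv_form_bound hδ

end PotentialBounds

end Nonlinearity

end GinzburgLandau

namespace GinzburgLandau
open Filter Topology

/-! ### The minimizer `φ₋` lies in the domain of `A`. -/

section EulerLagrange

/-- Exact quartic expansion; the factor of `b²` is estimated with `ab ≤ 2c` and `b² / 4 ≤ 1`,
dropping `-1/2`. The bound `2` on `b` is what a multiple `|ε| ≤ 1` of an eigenfunction satisfies. -/
theorem doubleWell_add_le {a b c : ℝ} (ha : |a| ≤ c) (hb : |b| ≤ 2) :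
    doubleWell (a + b) ≤ doubleWell a + (a ^ 3 - a) * b + (3 * c ^ 2 / 2 + 2 * c + 1) * b ^ 2 := by
  have h1 : doubleWell (a + b) = doubleWell a + (a ^ 3 - a) * b +
      (3 * a ^ 2 / 2 - 1 / 2 + a * b + b ^ 2 / 4) * b ^ 2 := by
    unfold doubleWell; ring
  have h2 : a ^ 2 ≤ c ^ 2 := sq_le_sq.2 (ha.trans (le_abs_self c))
  have h3 : b ^ 2 ≤ 2 ^ 2 := sq_le_sq.2 (hb.trans (le_abs_self 2))
  have h4 : a * b ≤ c * 2 := (le_abs_self _).trans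
    ((abs_mul a b).trans_le (mul_le_mul ha hb (abs_nonneg _) ((abs_nonneg _).trans ha)))
  rw [h1]
  exact add_le_add_right (mul_le_mul_of_nonneg_right (by linarith) (sq_nonneg b)) _

theorem eq_zero_of_forall_nonneg {b q : ℝ} (hq : 0 ≤ q)
    (h : ∀ ε : ℝ, |ε| ≤ 1 → 0 ≤ ε * b + ε ^ 2 * q) : b = 0 := by
  by_contra hb
  have hp : 0 < q + |b| := by positivity
  -- Close to the minimizer `-b / (2q)` of the quadratic; the added `|b|` keeps the step admissible
  -- and covers `q = 0`.
  have h1 : |-(b / (2 * (q + |b|)))| ≤ 1 := by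
    rw [abs_neg, abs_div, abs_of_pos (by positivity : 0 < 2 * (q + |b|)), div_le_one (by positivity)]
    linarith [abs_nonneg b]
  have h2 := h _ h1
  have h3 : -(b / (2 * (q + |b|))) * b + (-(b / (2 * (q + |b|)))) ^ 2 * q =
      -(b ^ 2 * (q + 2 * |b|) / (4 * (q + |b|) ^ 2)) := by
    field_simp
    ring
  have h4 : 0 < b ^ 2 * (q + 2 * |b|) / (4 * (q + |b|) ^ 2) := by positivity
  linarith

theorem ae_abs_eigenfun_le (n : ℕ) : ∀ᵐ x ∂spaceMeasure, |eigenfun n x| ≤ 2 := by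
  filter_upwards [eigenfun_coe_ae n] with x hx
  rw [hx, abs_mul, abs_of_nonneg (Real.sqrt_nonneg 2)]
  have h1 : √2 ≤ 2 := Real.sqrt_le_iff.2 ⟨by norm_num, by norm_num⟩
  nlinarith [Real.abs_sin_le_one (((n : ℝ) + 1) * Real.pi * x), Real.sqrt_nonneg 2,
    abs_nonneg (Real.sin (((n : ℝ) + 1) * Real.pi * x))]

theorem memH10_eigenfun (n : ℕ) : MemH10 (eigenfun n) := by
  refine memH10_of_mem_closure (isWeakDeriv_eigenfun n) (eigenfun_mem_closure n)

theorem MemH10.add_smul_eigenfun {m : L2} (hm : MemH10 m) (ε : ℝ) (n : ℕ) :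
    MemH10 (m + ε • eigenfun n) ∧
      weakDeriv (m + ε • eigenfun n) = weakDeriv m + (ε * freq n) • cosfun n := by
  refine ⟨(memH10_of_sumLe (hm.sumLe.add (fun _ => sq_nonneg _) ((memH10_eigenfun n).sumLe.smul ε))).1, ?_⟩
  rw [mul_smul]
  exact (hm.1.isWeakDeriv.add ((isWeakDeriv_eigenfun n).smul ε)).weakDeriv_eq

theorem integrable_mul (f g : L2) : Integrable (fun x => f x * g x) spaceMeasure :=
  (Lp.memLp f).integrable_mul (Lp.memLp g)

theorem integral_sq_eq (f : L2) : ∫ x, f x * f x ∂spaceMeasure = ‖f‖ ^ 2 := by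
  rw [← inner_L2_eq, real_inner_self_eq_norm_sq]

theorem energy_add_le {δ : ℝ} (hδ : 0 < δ) {m : L2} (hm : MemH10 m) {c : ℝ}
    (hc : ∀ᵐ x ∂spaceMeasure, |m x| ≤ c) {w : L2} (hw : ∀ᵐ x ∂spaceMeasure, w x = m x ^ 3 - m x)
    (n : ℕ) {ε : ℝ} (hε : |ε| ≤ 1) :
    energy δ (m + ε • eigenfun n) ≤ energy δ m +
      (ε * (δ * freq n * inner ℝ (cosfun n) (weakDeriv m) + δ⁻¹ * inner ℝ (eigenfun n) w) +
        ε ^ 2 * (δ / 2 * freq n ^ 2 + δ⁻¹ * (3 * c ^ 2 / 2 + 2 * c + 1))) := by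
  set Q := 3 * c ^ 2 / 2 + 2 * c + 1 with hQ
  set g := weakDeriv m with hg
  have hW : Integrable (fun x => doubleWell (m x)) spaceMeasure := by
    have hcont : Continuous doubleWell := by unfold doubleWell; fun_prop
    refine Integrable.of_bound
      (hcont.comp_aestronglyMeasurable (Lp.aestronglyMeasurable m)) ((c ^ 2 + 1) ^ 2 / 4) ?_
    filter_upwards [hc] with x hx
    have h2 : m x ^ 2 ≤ c ^ 2 := sq_le_sq.2 (hx.trans (le_abs_self c))
    rw [Real.norm_of_nonneg (by unfold doubleWell; positivity), doubleWell]
    have : (m x ^ 2 - 1) ^ 2 ≤ (c ^ 2 + 1) ^ 2 :=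
      sq_le_sq.2 (abs_le_abs (by linarith) (by linarith [sq_nonneg (m x), sq_nonneg c]))
    linarith
  have hE : Integrable (fun x => δ / 2 * g x ^ 2 + δ⁻¹ * doubleWell (m x)) spaceMeasure :=
    (((integrable_mul g g).const_mul (δ / 2)).congr
      (Eventually.of_forall fun x => by ring)).add (hW.const_mul _)
  have i1 := (integrable_mul (cosfun n) g).const_mul (ε * (δ * freq n))
  have i2 := (integrable_mul (eigenfun n) w).const_mul (ε * δ⁻¹)
  have i3 := (integrable_mul (cosfun n) (cosfun n)).const_mul (ε ^ 2 * (δ / 2 * freq n ^ 2))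
  have i4 := (integrable_mul (eigenfun n) (eigenfun n)).const_mul (ε ^ 2 * (δ⁻¹ * Q))
  have hR := integral_add hE (((i1.add i2).add i3).add i4)
  have hR' := integral_add ((i1.add i2).add i3) i4
  have hR'' := integral_add (i1.add i2) i3
  have hR''' := integral_add i1 i2
  simp only [Pi.add_apply, integral_const_mul, integral_sq_eq, ← inner_L2_eq,
    orthonormal_cosfun.norm_eq_one, orthonormal_eigenfun.norm_eq_one] at hR hR' hR'' hR'''
  -- Only an upper bound for the perturbed energy is wanted, and its density is nonnegative, so its
  -- integrability need not be shown.
  have hmono := integral_mono_of_nonneg (μ := spaceMeasure)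
    (f := fun x => δ / 2 * weakDeriv (m + ε • eigenfun n) x ^ 2 +
      δ⁻¹ * doubleWell ((m + ε • eigenfun n : L2) x))
    (Eventually.of_forall fun x => by
      have : 0 ≤ doubleWell ((m + ε • eigenfun n : L2) x) := by unfold doubleWell; positivity
      positivity) (hE.add (((i1.add i2).add i3).add i4)) (by
      rw [(hm.add_smul_eigenfun ε n).2]
      filter_upwards [hc, hw, ae_abs_eigenfun_le n, Lp.coeFn_add m (ε • eigenfun n),
        Lp.coeFn_smul ε (eigenfun n), Lp.coeFn_add g ((ε * freq n) • cosfun n),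
        Lp.coeFn_smul (ε * freq n) (cosfun n)] with x h1 h2 h3 h4 h5 h6 h7
      simp only [Pi.add_apply, Pi.smul_apply, smul_eq_mul] at h4 h5 h6 h7 ⊢
      rw [h4, h5, h6, h7, h2]
      have h8 : |ε * eigenfun n x| ≤ 2 := by
        rw [abs_mul]
        exact (mul_le_of_le_one_left (abs_nonneg _) hε).trans h3
      have h9 := mul_le_mul_of_nonneg_left (doubleWell_add_le h1 h8) (inv_nonneg.2 hδ.le)
      rw [← hQ] at h9
      linear_combination h9)
  simp only [Pi.add_apply] at hmono
  unfold energy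
  rw [← hg]
  linarith

/-- The Euler-Lagrange equation, in the form of `H²` regularity of the minimizer. -/
theorem IsLowerMinimizer.exists_sumLe {δ : ℝ} (hδ : 0 < δ) {m : L2} (h : IsLowerMinimizer δ m) :
    ∃ B, SumLe eigenfun (fun n => eigenvalue δ n ^ 2) m B := by
  obtain ⟨hm, -, hmin⟩ := h
  have hc := hm.ae_abs_le
  have hmem : MemLp (fun x => m x ^ 3 - m x) 2 spaceMeasure := by
    refine MemLp.of_bound ((Lp.aestronglyMeasurable m).pow 3 |>.sub (Lp.aestronglyMeasurable m))
      (‖weakDeriv m‖ ^ 3 + ‖weakDeriv m‖) ?_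
    filter_upwards [hc] with x hx
    refine (norm_sub_le _ _).trans ?_
    rw [norm_pow, Real.norm_eq_abs]
    gcongr
  have hw := toL2_coe_ae hmem
  set w := toL2 fun x => m x ^ 3 - m x
  -- The Euler-Lagrange equation, one coefficient at a time: the first variation in the direction of
  -- each eigenfunction vanishes. It says `A φ₋ = -δ⁻¹ w`, and `w` is in `L²` since `φ₋` is bounded.
  have hb : ∀ n, δ * freq n * inner ℝ (cosfun n) (weakDeriv m) + δ⁻¹ * inner ℝ (eigenfun n) w = 0 := by
    intro n
    refine eq_zero_of_forall_nonneg
      (q := δ / 2 * freq n ^ 2 + δ⁻¹ * (3 * ‖weakDeriv m‖ ^ 2 / 2 + 2 * ‖weakDeriv m‖ + 1))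
      (by positivity) fun ε hε => ?_
    have h1 := energy_add_le hδ hm hc hw n hε
    have h2 := hmin _ (hm.add_smul_eigenfun ε n).1
    linarith
  refine ⟨δ⁻¹ ^ 2 * ‖w‖ ^ 2, fun N => ?_⟩
  refine le_trans (le_of_eq (Finset.sum_congr rfl fun n _ => ?_))
    (((sumLe_one orthonormal_eigenfun w).smul δ⁻¹) N)
  have h1 := hb n
  rw [hm.inner_cosfun] at h1
  rw [real_inner_smul_right, one_mul, ← mul_pow, ← sq_abs, ← sq_abs (δ⁻¹ * _), ← abs_neg (δ⁻¹ * _)]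
  congr 2
  rw [eigenvalue_eq]
  linarith

end EulerLagrange

end GinzburgLandau

namespace GinzburgLandau
open Filter Topology

/-! ### Smoothing by the semigroup and translation to Sobolev norms. -/

section Smoothing

theorem rpow_le_exp {x p : ℝ} (hx : 0 ≤ x) (hp0 : 0 ≤ p) (hp1 : p ≤ 1) : x ^ p ≤ Real.exp x := by
  have h1 : x ≤ Real.exp x := by linarith [Real.add_one_le_exp x]
  calc x ^ p ≤ Real.exp x ^ p := Real.rpow_le_rpow hx h1 hp0
    _ ≤ Real.exp x ^ (1 : ℝ) := Real.rpow_le_rpow_of_exponent_le (Real.one_le_exp hx) hp1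
    _ = Real.exp x := Real.rpow_one _

/-- The smoothing property of the semigroup. -/
theorem IsSpectral.sg_sumLe_sq {H : Type*} [NormedAddCommGroup H] [InnerProductSpace ℝ H]
    [CompleteSpace H] {e : ℕ → H} {k : ℕ → ℝ} (h : IsSpectral e k) {t p : ℝ} (ht : 0 < t)
    (hp0 : 0 ≤ p) (hp1 : p ≤ 1) {f : H} {B : ℝ}
    (hf : SumLe e (fun n => k n ^ (2 * (1 - p))) f B) :
    SumLe e (fun n => k n ^ 2) (sg e k t f) (B * t ^ (-(2 * p))) := by
  intro N
  refine le_trans ?_ (mul_le_mul_of_nonneg_right (hf N) (Real.rpow_nonneg ht.le _))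
  rw [Finset.sum_mul]
  refine Finset.sum_le_sum fun n _ => ?_
  have hk := h.pos n
  have hx : 0 < k n * t := mul_pos hk ht
  -- Of the weight `k²`, the part `k^(2(1-p))` is covered by the data; the exponential absorbs
  -- `k^(2p)` at the price of `t^(-2p)`, with constant one.
  have h1 : (k n * t) ^ p * Real.exp (-(k n * t)) ≤ 1 := by
    rw [Real.exp_neg, ← div_eq_mul_inv, div_le_one (Real.exp_pos _)]
    exact rpow_le_exp hx.le hp0 hp1
  have h2 : ((k n * t) ^ p * Real.exp (-(k n * t))) ^ 2 ≤ 1 :=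
    pow_le_one₀ (by positivity) h1
  have h3 : k n ^ (2 * (1 - p)) * k n ^ (2 * p) = k n ^ 2 := by
    rw [← Real.rpow_add hk, ← Real.rpow_two]; ring_nf
  have h4 : t ^ (-(2 * p)) * t ^ (2 * p) = 1 := by
    rw [← Real.rpow_add ht, neg_add_cancel, Real.rpow_zero]
  have h5 : ((k n * t) ^ p) ^ 2 = k n ^ (2 * p) * t ^ (2 * p) := by
    rw [← Real.mul_rpow hk.le ht.le, mul_comm 2 p, Real.rpow_mul hx.le, Real.rpow_two]
  rw [h.inner_sg ht.le]
  calc k n ^ 2 * (Real.exp (-(k n * t)) * inner ℝ (e n) f) ^ 2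
      = k n ^ (2 * (1 - p)) * inner ℝ (e n) f ^ 2 * t ^ (-(2 * p)) *
          ((k n * t) ^ p * Real.exp (-(k n * t))) ^ 2 := by
        rw [mul_pow ((k n * t) ^ p), h5, ← h3]
        linear_combination -(k n ^ (2 * (1 - p)) * k n ^ (2 * p) *
          (Real.exp (-(k n * t)) * inner ℝ (e n) f) ^ 2) * h4
    _ ≤ k n ^ (2 * (1 - p)) * inner ℝ (e n) f ^ 2 * t ^ (-(2 * p)) * 1 :=
        mul_le_mul_of_nonneg_left h2 (by positivity)
    _ = _ := mul_one _

end Smoothing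

section Regularity

variable {δ : ℝ} (hδ : 0 < δ)

include hδ

theorem sumLe_of_memDomPow {γ : ℝ} {f : L2} (hf : MemDomPow δ γ f) :
    SumLe eigenfun (fun n => eigenvalue δ n ^ (2 * γ)) f (‖fracPow δ γ f‖ ^ 2) := by
  have h := isSpectral_eigenfun hδ
  intro N
  refine le_trans (le_of_eq (Finset.sum_congr rfl fun n _ => ?_))
    (sumLe_one orthonormal_eigenfun (fracPow δ γ f) N)
  have h1 : inner ℝ (eigenfun n) (fracPow δ γ f) =
      eigenvalue δ n ^ γ * inner ℝ (eigenfun n) f :=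
    h.inner_of_hasSum (c := fun n => eigenvalue δ n ^ γ * inner ℝ (eigenfun n) f)
      (summable_fracPow hδ.le hf).hasSum n
  have h2 : eigenvalue δ n ^ (2 * γ) = (eigenvalue δ n ^ γ) ^ 2 := by
    rw [mul_comm 2 γ, Real.rpow_mul (h.pos n).le, Real.rpow_two]
  rw [h1, one_mul, mul_pow, ← h2]

theorem memH10_and_h1Norm_le {f : L2} {B : ℝ} (hf : SumLe eigenfun (eigenvalue δ) f B) :
    MemH10 f ∧ h1Norm f ≤ √(2 * (B / δ)) :=
  have h1 := sumLe_freq_of_sumLe hδ hf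
  ⟨(memH10_of_sumLe h1).1, Real.le_sqrt_of_sq_le (h1Norm_sq_le h1)⟩

/-- Since `τ ≤ T`, the regular part `1` is at most `T^(2p) τ^(-2p)` and joins the singular part in a
single power of `τ`. -/
theorem memH2_and_h2Norm_le {f : L2} {D B p τ T : ℝ} (hD : 0 ≤ D) (hp : 0 ≤ p) (hτ : 0 < τ)
    (hτT : τ ≤ T) (hf : SumLe eigenfun (fun n => eigenvalue δ n ^ 2) f
      (D * (1 + B * τ ^ (-(2 * p))))) :
    MemH2 f ∧ h2Norm f ≤ √(3 * (D * (T ^ (2 * p) + B) / δ ^ 2)) * τ ^ (-p) := by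
  obtain ⟨h1, h2⟩ := memH2_of_sumLe (sumLe_freq_of_sumLe_sq hδ hf)
  refine ⟨h1, ?_⟩
  have h3 : 1 ≤ T ^ (2 * p) * τ ^ (-(2 * p)) := by
    rw [Real.rpow_neg hτ.le, ← div_eq_mul_inv, one_le_div (by positivity)]
    exact Real.rpow_le_rpow hτ.le hτT (by positivity)
  have h4 : τ ^ (-(2 * p)) = (τ ^ (-p)) ^ 2 := by
    rw [← Real.rpow_two, ← Real.rpow_mul hτ.le]; ring_nf
  rw [← Real.sqrt_sq (Real.rpow_nonneg hτ.le (-p)), ← h4, ← Real.sqrt_mul' _ (by positivity)]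
  refine Real.le_sqrt_of_sq_le (h2.trans ?_)
  have h5 : D * (1 + B * τ ^ (-(2 * p))) ≤ D * (T ^ (2 * p) + B) * τ ^ (-(2 * p)) := by
    rw [mul_assoc]
    exact mul_le_mul_of_nonneg_left (by rw [add_mul]; linarith) hD
  calc 3 * (D * (1 + B * τ ^ (-(2 * p))) / δ ^ 2)
      ≤ 3 * (D * (T ^ (2 * p) + B) * τ ^ (-(2 * p)) / δ ^ 2) := by gcongr
    _ = _ := by ring

theorem sumLe_of_h1Norm_le {f : L2} {C : ℝ} (hC : 0 ≤ C) (hf : MemH10 f) (h : h1Norm f ≤ C) :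
    ‖f‖ ≤ C ∧ SumLe eigenfun (eigenvalue δ) f (δ * C ^ 2) := by
  have h1 : ‖f‖ ^ 2 + ‖weakDeriv f‖ ^ 2 ≤ C ^ 2 := (Real.sqrt_le_left hC).1 h
  refine ⟨abs_le_of_sq_le_sq' (by linarith [sq_nonneg ‖weakDeriv f‖]) hC |>.2,
    (sumLe_of_sumLe_freq hδ hf.sumLe).mono ?_⟩
  exact mul_le_mul_of_nonneg_left (by linarith [sq_nonneg ‖f‖]) hδ.le

end Regularity

/-! ### The concrete control problem as an instance of the abstract one. -/

section ControlProblem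

theorem cost_eq (K T : ℝ) (m : L2) (t₀ : ℝ) (α φ : ℝ → L2) :
    cost T K m t₀ α φ = controlCost K m t₀ T α φ := rfl

variable {V : ℝ → ℝ} {M : ℝ} (hV : PotentialBounds V M) {δ : ℝ} (hδ : 0 < δ)

include hV hδ

/-- The two notions differ by the integrability of the Duhamel integrand, which is automatic for a
square integrable control and a continuous state. -/
theorem isMildState_iff {T t₀ : ℝ} {φ₀ : L2} {α φ : ℝ → L2}
    (hα : MemLp α 2 (volume.restrict (Icc t₀ T))) :
    IsMildState δ T V φ₀ t₀ α φ ↔ IsState eigenfun (eigenvalue δ)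
      (fun f => -(δ⁻¹ • toL2 fun x => deriv V (f x))) t₀ T φ₀ α φ := by
  refine ⟨fun h => ⟨h.1, fun t ht => (h.2 t ht).2⟩, fun h => ⟨h.1, fun t ht => ⟨?_, h.2 t ht⟩⟩⟩
  exact (isSpectral_eigenfun hδ).intervalIntegrable_sg ht.1
    (((IsSpectral.memLp_source (hV.isNonlinearity hδ) h.1 hα).restrict_Ioc ht.2).integrable (by norm_num))

theorem isOptimalPair_of_forall_le {T K t₀ : ℝ} {m φ₀ : L2} {α φ : ℝ → L2}
    (hα : MemLp α 2 (volume.restrict (Icc t₀ T)))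
    (hφ : IsState eigenfun (eigenvalue δ)
      (fun f => -(δ⁻¹ • toL2 fun x => deriv V (f x))) t₀ T φ₀ α φ)
    (hopt : ∀ α' φ' : ℝ → L2, MemLp α' 2 (volume.restrict (Icc t₀ T)) →
      IsState eigenfun (eigenvalue δ)
        (fun f => -(δ⁻¹ • toL2 fun x => deriv V (f x))) t₀ T φ₀ α' φ' →
      controlCost K m t₀ T α φ ≤ controlCost K m t₀ T α' φ') :
    IsOptimalPair δ T K V m φ₀ t₀ α φ := by
  have hadm : IsAdmissible δ T V φ₀ t₀ α φ := ⟨hα, (isMildState_iff hV hδ hα).2 hφ⟩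
  have hl : IsLeast {c | ∃ α φ : ℝ → L2, IsAdmissible δ T V φ₀ t₀ α φ ∧ c = cost T K m t₀ α φ}
      (cost T K m t₀ α φ) := ⟨⟨α, φ, hadm, rfl⟩, ?_⟩
  · exact ⟨hadm, hl.csInf_eq.symm⟩
  rintro _ ⟨α', φ', h', rfl⟩
  rw [cost_eq, cost_eq]
  exact hopt α' φ' h'.1 ((isMildState_iff hV hδ h'.1).1 h'.2)

theorem isMildDual_of_eq {T K t₀ : ℝ} {m : L2} {φ l : ℝ → L2} (hφ : ContinuousOn φ (Icc t₀ T))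
    (hl : ContinuousOn l (Icc t₀ T)) (hlT : l T = (2 * K) • (φ T - m))
    (heq : ∀ t ∈ Icc t₀ T, l t = sg eigenfun (eigenvalue δ) (T - t) (l T) +
      duhamelBack eigenfun (eigenvalue δ) (fun s => -(δ⁻¹ • dualSource V (φ s) (l s))) t T) :
    IsMildDual δ T K V m t₀ φ l := by
  have hs := isSpectral_eigenfun hδ
  have hc : ContinuousOn (fun s => dualSource V (φ s) (l s)) (Icc t₀ T) :=
    Continuous.comp_continuousOn (g := fun p : L2 × L2 => dualSource V p.1 p.2)
      (f := fun s => (φ s, l s)) hV.continuous_dualSource (hφ.prodMk hl)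
  refine ⟨hl, hlT, fun t ht => ⟨hs.intervalIntegrable_sg_back ht.2 ?_, ?_⟩⟩
  · have hct : ContinuousOn (fun s => dualSource V (φ s) (l s)) (Icc t T) :=
      hc.mono (Icc_subset_Icc_left ht.1)
    exact ((memLp_of_continuousOn hct).restrict_Ioc le_rfl).integrable (by norm_num)
  · have h1 : duhamelBack eigenfun (eigenvalue δ) (fun s => -(δ⁻¹ • dualSource V (φ s) (l s))) t T =
        (-δ⁻¹) • ∫ s in t..T, sg eigenfun (eigenvalue δ) (s - t) (dualSource V (φ s) (l s)) := by
      unfold duhamelBack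
      rw [← intervalIntegral.integral_smul]
      refine intervalIntegral.integral_congr fun s hs' => ?_
      rw [uIcc_of_le ht.2] at hs'
      simp only [← neg_smul]
      exact hs.sg_smul (sub_nonneg.2 hs'.1) _ _
    rw [heq t ht, h1, neg_smul, ← sub_eq_add_neg]
    rfl

end ControlProblem

end GinzburgLandau

/-! ### The theorem. -/

open GinzburgLandau in
theorem mainTheorem10 (δ T K : ℝ) (hδ : 0 < δ) (hT : 0 < T) (hK : 0 < K)
    (V : ℝ → ℝ) (hV : GinzburgLandau.IsModifiedDoubleWell V)
    (φm : GinzburgLandau.L2) (hφm : GinzburgLandau.IsLowerMinimizer δ φm)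
    (C : ℝ) (hC : 0 < C) :
    ∃ D : ℝ, 0 < D ∧
      ∀ (φ₀ : GinzburgLandau.L2) (t₀ : ℝ),
        GinzburgLandau.MemH10 φ₀ → GinzburgLandau.h1Norm φ₀ ≤ C → 0 ≤ t₀ → t₀ ≤ T →
        ∃ α φ l : ℝ → GinzburgLandau.L2,
          GinzburgLandau.IsOptimalPair δ T K V φm φ₀ t₀ α φ ∧
          GinzburgLandau.IsMildDual δ T K V φm t₀ φ l ∧
          (∀ t ∈ Set.Icc t₀ T,
            GinzburgLandau.MemH10 (φ t) ∧ GinzburgLandau.h1Norm (φ t) ≤ D) ∧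
          (∀ t ∈ Set.Icc t₀ T, t₀ < t →
            GinzburgLandau.MemH2 (φ t) ∧
              GinzburgLandau.h2Norm (φ t) ≤ D * (t - t₀) ^ (-(1 / 2) : ℝ)) ∧
          (∀ t ∈ Set.Icc t₀ T,
            GinzburgLandau.MemH10 (l t) ∧ GinzburgLandau.h1Norm (l t) ≤ D) ∧
          (∀ t ∈ Set.Icc t₀ T, t₀ < T →
            GinzburgLandau.MemH2 (l t) ∧
              GinzburgLandau.h2Norm (l t) ≤ D * (T - t₀) ^ (-(1 / 2) : ℝ)) ∧
          (GinzburgLandau.MemDomPow δ (5 / 7) φ₀ →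
            ‖GinzburgLandau.fracPow δ (5 / 7) φ₀‖ ≤ C →
              (∀ t ∈ Set.Icc t₀ T, t₀ < t →
                GinzburgLandau.h2Norm (φ t) ≤ D * (t - t₀) ^ (-(2 / 7) : ℝ)) ∧
              (∀ t ∈ Set.Icc t₀ T, t₀ < T →
                GinzburgLandau.h2Norm (l t) ≤ D * (T - t₀) ^ (-(2 / 7) : ℝ))) := by
  have hs := isSpectral_eigenfun hδ
  obtain ⟨M, hM⟩ := hV.exists_bounds
  have hF := hM.isNonlinearity hδ
  obtain ⟨B, hB⟩ := hφm.exists_sumLe hδ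
  have hB' := sumLe_of_sumLe_freq hδ hφm.1.sumLe
  have : Fact ((2 : ENNReal) ≠ ⊤) := ⟨by norm_num⟩
  have : TopologicalSpace.SeparableSpace L2 := inferInstance
  -- One constant has to bound both the norm, by `C`, and the quadratic form `δ ‖φ_x‖²`, by `δ * C ^
  -- 2`.
  obtain ⟨D, hD, hmain⟩ := hs.exists_optimal_regular hF (T := T) hK
    (hB'.mono (le_max_right B _)) (hB.mono (le_max_left _ _)) (max C (δ * C ^ 2))
  set D₁ := √(2 * (D / δ))
  set D₂ := √(3 * (D * (T ^ (2 * (1 / 2) : ℝ) + δ * C ^ 2) / δ ^ 2))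
  set D₃ := √(3 * (D * (T ^ (2 * (2 / 7) : ℝ) + C ^ 2) / δ ^ 2))
  have hD₁ : 0 ≤ D₁ := Real.sqrt_nonneg _
  have hD₂ : 0 ≤ D₂ := Real.sqrt_nonneg _
  have hD₃ : 0 ≤ D₃ := Real.sqrt_nonneg _
  have hle₁ : D₁ ≤ D₁ + D₂ + D₃ + 1 := by linarith
  have hle₂ : D₂ ≤ D₁ + D₂ + D₃ + 1 := by linarith
  have hle₃ : D₃ ≤ D₁ + D₂ + D₃ + 1 := by linarith
  refine ⟨D₁ + D₂ + D₃ + 1, by positivity, fun φ₀ t₀ hφ₀ hφC ht₀ htT => ?_⟩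
  obtain ⟨hn, hsum⟩ := sumLe_of_h1Norm_le hδ hC.le hφ₀ hφC
  obtain ⟨α, φ, l, hα, hφ, hopt, hl, hlT, hleq, hreg, hφ2, hl2⟩ := hmain φ₀ t₀
    (hn.trans (le_max_left _ _)) (hsum.mono (le_max_right _ _)) ht₀ htT
  -- Smoothing with `p = 1/2`: the data weight `k^(2(1-p))` is the form weight `k`.
  have hhalf : ∀ τ, 0 < τ → SumLe eigenfun (fun n => eigenvalue δ n ^ 2)
      (sg eigenfun (eigenvalue δ) τ φ₀) (δ * C ^ 2 * τ ^ (-(2 * (1 / 2)) : ℝ)) := fun τ hτ => by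
    refine hs.sg_sumLe_sq hτ (by norm_num) (by norm_num) ?_
    have : (2 * (1 - 1 / 2) : ℝ) = 1 := by norm_num
    simpa only [this, Real.rpow_one] using hsum
  -- Smoothing with `p = 2/7`, since `1 - 2/7 = 5/7`.
  have hsev : MemDomPow δ (5 / 7) φ₀ → ‖fracPow δ (5 / 7) φ₀‖ ≤ C → ∀ τ, 0 < τ →
      SumLe eigenfun (fun n => eigenvalue δ n ^ 2)
        (sg eigenfun (eigenvalue δ) τ φ₀) (C ^ 2 * τ ^ (-(2 * (2 / 7)) : ℝ)) := fun h1 h2 τ hτ => by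
    refine hs.sg_sumLe_sq hτ (by norm_num) (by norm_num) ?_
    have : (2 * (1 - 2 / 7) : ℝ) = 2 * (5 / 7) := by norm_num
    rw [this]
    exact (sumLe_of_memDomPow hδ h1).mono (pow_le_pow_left₀ (norm_nonneg _) h2 2)
  refine ⟨α, φ, l, isOptimalPair_of_forall_le hM hδ hα hφ hopt,
    isMildDual_of_eq hM hδ hφ.1 hl hlT hleq, fun t ht => ?_, fun t ht htt => ?_, fun t ht => ?_,
    fun t ht htt => ?_, fun h1 h2 => ⟨fun t ht htt => ?_, fun t ht htt => ?_⟩⟩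
  · obtain ⟨h1, h2⟩ := memH10_and_h1Norm_le hδ (hreg t ht).1
    exact ⟨h1, h2.trans hle₁⟩
  · have hτ := sub_pos.2 htt
    obtain ⟨h1, h2⟩ := memH2_and_h2Norm_le (T := T) hδ hD (by norm_num) hτ (by linarith [ht.2])
      (hφ2 t ht _ (hhalf _ hτ))
    exact ⟨h1, h2.trans (mul_le_mul_of_nonneg_right hle₂ (Real.rpow_nonneg hτ.le _))⟩
  · obtain ⟨h1, h2⟩ := memH10_and_h1Norm_le hδ (hreg t ht).2
    exact ⟨h1, h2.trans hle₁⟩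
  · have hτ := sub_pos.2 htt
    obtain ⟨h1, h2⟩ := memH2_and_h2Norm_le (T := T) hδ hD (by norm_num) hτ (by linarith)
      (hl2 t ht _ (hhalf _ hτ))
    exact ⟨h1, h2.trans (mul_le_mul_of_nonneg_right hle₂ (Real.rpow_nonneg hτ.le _))⟩
  · have hτ := sub_pos.2 htt
    exact (memH2_and_h2Norm_le (T := T) hδ hD (by norm_num) hτ (by linarith [ht.2])
      (hφ2 t ht _ (hsev h1 h2 _ hτ))).2.trans
      (mul_le_mul_of_nonneg_right hle₃ (Real.rpow_nonneg hτ.le _))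
  · have hτ := sub_pos.2 htt
    exact (memH2_and_h2Norm_le (T := T) hδ hD (by norm_num) hτ (by linarith)
      (hl2 t ht _ (hsev h1 h2 _ hτ))).2.trans
      (mul_le_mul_of_nonneg_right hle₃ (Real.rpow_nonneg hτ.le _))
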